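/- Work in the complex projective plane with affine coordinates $(x,y)$, and let $P_1=(0,1)$, $P_2=(0,-1)$. Consider the pairs $(B_2,B_2')$ of irreducible conics such that $B_2$ is tangent to the line $y=1$ at $P_1$ and to the line $y=-1$ at $P_2$, and such that $B_2$ and $B_2'$ meet at $P_1$ with intersection multiplicity $I(B_2,B_2';P_1)=3$ (hence transversely at one further point). Let $\Phi$ be the linear system of all conics $D$ with $I(B_2,D;P_2)\ge 3$. A smooth point $Q\in B_2'$ is called a conical flex point with respect to $\Phi$ if $I(B_2',D;Q)\ge \dim\Phi+1$ for some $D\in\Phi$. A plane sextic is of torus type if it has a defining equation of the form $F_2^3+F_3^2=0$ with nonzero homogeneous polynomials $F_2,F_3$ of degrees $2$ and $3$. Then for a generic such pair $(B_2,B_2')$ (that is, for all pairs in a non-empty, dense Zariski open subset of the family of these pairs) the following holds. The system $\Phi$ has dimension $2$. Besides the point $P_1$, which is a conical flex point because $B_2\in\Phi$, there are exactly five conical flex points $Q_1,\dots,Q_5$ on $B_2'$ with respect to $\Phi$. For each $i$ there is a unique conic $B_2''=B_2''(Q_i)\in\Phi$ with $I(B_2',B_2'';Q_i)\ge 3$;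 it is irreducible, and the singularities of the sextic $B_2+B_2'+B_2''$ are $[3A_5,3A_1]$, the three $A_5$ being at $P_1$, $P_2$ and $Q_i$. The sextic $B_2+B_2'+B_2''(Q_1)$ is of torus type, and the sextics $B_2+B_2'+B_2''(Q_i)$ for $i=2,3,4,5$ are not of torus type. -/

import Mathlib

/-! Plane curves over `ℂ`: forms in `x, y, z`, local intersection numbers, singularities of type
`A_n`, sextics of torus type, conical flex points, and generic pairs of conics. -/

noncomputable section

namespace ThreeConics

open MvPolynomial

/-- The complex projective plane. -/
abbrev Plane := Projectivization ℂ (Fin 3 → ℂ)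

/-- Polynomials in the homogeneous coordinates `x = X 0`, `y = X 1`, `z = X 2`. -/
abbrev Form := MvPolynomial (Fin 3) ℂ

/-- The ring of formal power series in two variables, the completed local ring of the plane at a
point. -/
abbrev Germ := MvPowerSeries (Fin 2) ℂ

/-- The homogeneous coordinates near the point `(v 0 : v 1 : v 2)` in terms of two affine
coordinates `X 0, X 1` centred at that point, in the first of the standard charts
`z = 1`, `y = 1`, `x = 1` that contains the point. -/
def localCoords (v : Fin 3 → ℂ) : Fin 3 → MvPolynomial (Fin 2) ℂ :=
  open Classical in
  if v 2 ≠ 0 then ![C (v 0 / v 2) + X 0, C (v 1 / v 2) + X 1, 1]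
  else if v 1 ≠ 0 then ![C (v 0 / v 1) + X 0, 1, C (v 2 / v 1) + X 1]
  else ![1, C (v 1 / v 0) + X 0, C (v 2 / v 0) + X 1]

/-- A local equation at `P` of the curve `F = 0`. -/
def germ (F : Form) (P : Plane) : Germ :=
  ((aeval (localCoords P.rep) F : MvPolynomial (Fin 2) ℂ) : MvPowerSeries (Fin 2) ℂ)

/-- The intersection number `I(F, G; P) = dim_ℂ 𝒪_P / (F, G)`, possibly infinite
(the length of a vector space over `ℂ` is its dimension). -/
def interMult (F G : Form) (P : Plane) : ℕ∞ :=
  Module.length ℂ (Germ ⧸ Ideal.span {germ F P, germ G P})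

/-- `P` is a singular point of the curve `F = 0`. -/
def IsSingularPoint (F : Form) (P : Plane) : Prop :=
  eval P.rep F = 0 ∧ ∀ i, eval P.rep (pderiv i F) = 0

/-- `P` is a smooth point of the curve `F = 0`. -/
def IsSmoothPoint (F : Form) (P : Plane) : Prop :=
  eval P.rep F = 0 ∧ ∃ i, eval P.rep (pderiv i F) ≠ 0

/-- `(u, v)` is a system of formal local coordinates of the plane at a point: both vanish there
and their differentials are linearly independent. -/
def IsLocalCoordinates (u v : Germ) : Prop :=
  MvPowerSeries.constantCoeff u = 0 ∧ MvPowerSeries.constantCoeff v = 0 ∧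
    MvPowerSeries.coeff (Finsupp.single 0 1) u * MvPowerSeries.coeff (Finsupp.single 1 1) v -
      MvPowerSeries.coeff (Finsupp.single 1 1) u * MvPowerSeries.coeff (Finsupp.single 0 1) v ≠ 0

/-- The curve `F = 0` has an `A_n` singularity at `P`: it is `v² = u^(n+1)` in suitable local
coordinates. -/
def IsTypeA (n : ℕ) (F : Form) (P : Plane) : Prop :=
  ∃ u v w : Germ, IsLocalCoordinates u v ∧ IsUnit w ∧ germ F P = w * (v ^ 2 - u ^ (n + 1))

/-- The singularities of `F = 0` are `[3A₅, 3A₁]`, the three `A₅` being the points of `S`. -/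
def HasSingularities3A5And3A1 (F : Form) (S : Set Plane) : Prop :=
  S.ncard = 3 ∧ (∀ P ∈ S, IsTypeA 5 F P) ∧
    ∃ T : Set Plane, T.ncard = 3 ∧ Disjoint S T ∧ (∀ P ∈ T, IsTypeA 1 F P) ∧
      {P | IsSingularPoint F P} = S ∪ T

/-- The sextic `F = 0` is of (2,3)-torus type. -/
def IsTorusType (F : Form) : Prop :=
  ∃ c : ℂ, c ≠ 0 ∧ ∃ F₂ F₃ : Form, F₂ ≠ 0 ∧ F₃ ≠ 0 ∧ F₂.IsHomogeneous 2 ∧ F₃.IsHomogeneous 3 ∧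
    C c * F = F₂ ^ 3 + F₃ ^ 2

/-- `F = 0` is an irreducible conic. -/
def IsConic (F : Form) : Prop := F.IsHomogeneous 2 ∧ Irreducible F

/-- `P` is a conical flex point of the curve `B = 0` with respect to the linear system of conics
`{h = 0}`, `0 ≠ h ∈ Φ`. The dimension of the linear system is `finrank Φ - 1`, so the condition
`I(B, h; P) ≥ dim + 1` reads `I(B, h; P) ≥ finrank Φ`. -/
def IsConicalFlex (Φ : Submodule ℂ Form) (B : Form) (P : Plane) : Prop :=
  IsSmoothPoint B P ∧ ∃ h ∈ Φ, h ≠ 0 ∧ (Module.finrank ℂ Φ : ℕ∞) ≤ interMult B h P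

/-- The point `(0, 1)` of the affine plane `z = 1`. -/
def P₁ : Plane := Projectivization.mk ℂ ![0, 1, 1] (fun h => by simpa using congrFun h 1)

/-- The point `(0, -1)` of the affine plane `z = 1`. -/
def P₂ : Plane := Projectivization.mk ℂ ![0, -1, 1] (fun h => by simpa using congrFun h 1)

/-- Two irreducible conics `f` and `g`: `f` touches the lines `y = 1` at `P₁` and `y = -1` at `P₂`,
and `f`, `g` meet at `P₁` with intersection number `3`. -/
structure IsConicPair (f g : Form) : Prop where
  conic_f : IsConic f
  conic_g : IsConic g
  tangent₁ : 2 ≤ interMult f (X 1 - X 2) P₁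
  tangent₂ : 2 ≤ interMult f (X 1 + X 2) P₂
  contact : interMult f g P₁ = 3

/-- The value of a polynomial `D` in the coefficients of two forms. -/
def evalCoeffs (D : MvPolynomial ((Fin 3 →₀ ℕ) ⊕ (Fin 3 →₀ ℕ)) ℂ) (f g : Form) : ℂ :=
  eval (Sum.elim (fun m => coeff m f) (fun m => coeff m g)) D

/-- `p` holds for a generic pair `(f, g)` of the family `W`: it holds on a non-empty Zariski open
subset `{D ≠ 0}` of `W` that is Zariski dense in `W`. -/
def HoldsGenerically (W p : Form → Form → Prop) : Prop :=
  ∃ D : MvPolynomial ((Fin 3 →₀ ℕ) ⊕ (Fin 3 →₀ ℕ)) ℂ,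
    (∃ f g, W f g ∧ evalCoeffs D f g ≠ 0) ∧
    (∀ E : MvPolynomial ((Fin 3 →₀ ℕ) ⊕ (Fin 3 →₀ ℕ)) ℂ,
      (∀ f g, W f g → evalCoeffs D f g ≠ 0 → evalCoeffs E f g = 0) →
        ∀ f g, W f g → evalCoeffs E f g = 0) ∧
    ∀ f g, W f g → evalCoeffs D f g ≠ 0 → p f g

end ThreeConics

end

noncomputable section

namespace ThreeConics

/-! ### The ring of germs -/

/-! Choose coordinates u, v, w proportional to x, y − z, y + z, so that P₁ = (0:0:1) and P₂ =
(0:1:0). Every pair of the family can be scaled to f = u² − vw and g = u² − vw + uv + δv², up to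
constants (`IsConicPair.exists_eq`, `exists_normal_form`); only the number δ remains. In these
coordinates Φ consists of the forms A(u² − vw) + Buw + Kw² (`mem_range_conicFamily_iff`).

The conic g is parametrized by t ↦ (t : 1 : t² + t + δ), with P₁ at t = ∞. A member of Φ restricts
to the polynomial `restr` in t, and it has contact at least 3 at t = r exactly when r is a root of
multiplicity at least 3. This gives three linear equations in (A, B, K), and a non-zero solution
forces (r + 2δ)(3r⁴ + 3r³ + r² + δr + δ²) = 0 (`IsOsculating.flex_equation`). If w is a primitive
cube root of unity, the quartic factor is the product of δ − wr − (2w + 1)r² and its conjugate. For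
general δ there are five distinct roots (`exists_flex_params`), each with an explicit osculating
conic that is unique up to a scalar; the sixth flex point is P₁.

All local statements reduce to divisibility of polynomials in t. The intersection number with a
smooth branch is the order of vanishing along it (`IsBranch.le_length_iff`,
`IsArc.le_interMult_iff`), and two smooth branches with contact exactly 3 form an A₅
(`IsBranch.exists_typeA_five`). Each two of the three conics meet once with contact 3 and once
transversally, which accounts for every singular point (`hasSingularities`).

The root r = −2δ has an explicit torus decomposition (`isTorusType_conics`). Conversely, let F₂³ +
F₃² be a multiple of the sextic. Then F₂ vanishes at no node (`eval_ne_zero_of_node`), and on the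
sextic it vanishes only at singular points (`singular_of_eval_eq_zero`), hence only at the A₅
points. Its restrictions to f and g are therefore κtⁿ and κ'(t − r)ⁿ', with even exponents because
cubes equal minus squares there. Comparing coefficients leaves only r = 0, 2r + 1 = 0 or r = −2δ,
and the first two do not occur for general δ (`not_isTorusType`).

Genericity: the family is the image of an open subset of affine 5-space, with δ = γαb/β². The
excluded values of δ are cut out by `discr`, and density holds because a polynomial ring over ℂ is a
domain (`evalCoeffs_eq_zero_of_generic`). -/

/-- The coefficient of the coordinate `X i` in a germ. -/
def lin (i : Fin 2) (a : Germ) : ℂ := MvPowerSeries.coeff (Finsupp.single i 1) a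

lemma lin_mul (i : Fin 2) (a b : Germ) :
    lin i (a * b) = lin i a * MvPowerSeries.constantCoeff b +
      MvPowerSeries.constantCoeff a * lin i b := by
  classical
  unfold lin
  rw [MvPowerSeries.coeff_mul, Finsupp.antidiagonal_single]
  rw [Finset.sum_map, Finset.Nat.antidiagonal_succ]
  simp [add_comm]

lemma lin_add (i : Fin 2) (a b : Germ) : lin i (a + b) = lin i a + lin i b := by
  simp [lin]

lemma lin_sub (i : Fin 2) (a b : Germ) : lin i (a - b) = lin i a - lin i b := by
  simp [lin]

lemma lin_C (i : Fin 2) (c : ℂ) : lin i (MvPowerSeries.C c) = 0 := by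
  classical
  simp [lin, MvPowerSeries.coeff_C]

lemma lin_X (i j : Fin 2) : lin i (MvPowerSeries.X j) = if i = j then 1 else 0 := by
  classical
  simp [lin, MvPowerSeries.coeff_X, Finsupp.single_left_inj]

lemma lin_pow_eq_zero (i : Fin 2) (a : Germ) (ha : MvPowerSeries.constantCoeff a = 0) {n : ℕ}
    (hn : 2 ≤ n) : lin i (a ^ n) = 0 := by
  obtain ⟨m, rfl⟩ := Nat.exists_eq_add_of_le hn
  rw [pow_add, pow_two, lin_mul, lin_mul]
  simp [ha]

lemma exists_eq_X_mul_add_X_mul (a : Germ) (ha : MvPowerSeries.constantCoeff a = 0) :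
    ∃ p q : Germ, a = MvPowerSeries.X 0 * p + MvPowerSeries.X 1 * q ∧
      MvPowerSeries.constantCoeff p = lin 0 a ∧ MvPowerSeries.constantCoeff q = lin 1 a := by
  -- `b` collects the monomials free of `X 0`; as `a` has no constant term, `X 1` divides `b` and `X
  -- 0` divides `a - b`.
  let b : Germ := fun m => if m 0 = 0 then MvPowerSeries.coeff m a else 0
  have hb : ∀ m, MvPowerSeries.coeff m b = if m 0 = 0 then MvPowerSeries.coeff m a else 0 :=
    fun m => rfl
  have h1 : MvPowerSeries.X 1 ∣ b := by
    rw [MvPowerSeries.X_dvd_iff]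
    intro m hm
    rw [hb]
    split_ifs with h0
    · have : m = 0 := by
        ext i
        fin_cases i
        · exact h0
        · exact hm
      rw [this]
      exact ha
    · rfl
  have h0 : MvPowerSeries.X 0 ∣ a - b := by
    rw [MvPowerSeries.X_dvd_iff]
    intro m hm
    rw [map_sub, hb, if_pos hm, sub_self]
  obtain ⟨p, hp⟩ := h0
  obtain ⟨q, hq⟩ := h1
  have h : a = MvPowerSeries.X 0 * p + MvPowerSeries.X 1 * q := by
    rw [← hp, ← hq, sub_add_cancel]
  refine ⟨p, q, h, ?_, ?_⟩ <;> rw [h] <;> simp [lin_add, lin_mul, lin_X]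

lemma isUnit_germ {a : Germ} (h : MvPowerSeries.constantCoeff a ≠ 0) : IsUnit a :=
  MvPowerSeries.isUnit_iff_constantCoeff.2 (isUnit_iff_ne_zero.2 h)

/-- Modulo a system of local coordinates every germ is constant. -/
lemma exists_eq_C_add (a c : Germ) (h : IsLocalCoordinates a c) (x : Germ) :
    ∃ e r : Germ,
      x = MvPowerSeries.C (MvPowerSeries.constantCoeff x) + a * e + c * r := by
  obtain ⟨ha, hc, hd⟩ := h
  obtain ⟨p, q, hpq, hp, hq⟩ := exists_eq_X_mul_add_X_mul a ha
  obtain ⟨p', q', hpq', hp', hq'⟩ := exists_eq_X_mul_add_X_mul c hc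
  obtain ⟨s, t, hst, -, -⟩ := exists_eq_X_mul_add_X_mul
    (x - MvPowerSeries.C (MvPowerSeries.constantCoeff x)) (by simp)
  have hu : IsUnit (p * q' - q * p') := by
    apply isUnit_germ
    rw [map_sub, map_mul, map_mul, hp, hq, hp', hq']
    exact hd
  obtain ⟨w, hw⟩ := hu.exists_left_inv
  -- Cramer's rule: `a` and `c` are combinations of `X 0`, `X 1` with unit determinant, so that
  -- linear system can be inverted.
  refine ⟨w * (s * q' - t * p'), w * (t * p - s * q), ?_⟩
  linear_combination hst - (MvPowerSeries.X 0 * s + MvPowerSeries.X 1 * t) * hw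
    - w * (s * q' - t * p') * hpq - w * (t * p - s * q) * hpq'

/-! ### Smooth branches -/

/-- A homomorphism to power series in one variable restricting germs to the smooth branch `a = 0`,
with `c` a transversal coordinate. -/
structure IsBranch (ψ : Germ →ₐ[ℂ] PowerSeries ℂ) (a c : Germ) : Prop where
  coords : IsLocalCoordinates a c
  map_eq_zero : ψ a = 0
  exists_unit : ∃ τ : PowerSeries ℂ, IsUnit τ ∧ ψ c = PowerSeries.X * τ

namespace IsBranch

variable {ψ : Germ →ₐ[ℂ] PowerSeries ℂ} {a c : Germ}

lemma constantCoeff_map (h : IsBranch ψ a c) (x : Germ) :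
    PowerSeries.constantCoeff (ψ x) = MvPowerSeries.constantCoeff x := by
  obtain ⟨e, r, her⟩ := exists_eq_C_add a c h.coords x
  obtain ⟨τ, -, hτ⟩ := h.exists_unit
  have hC : ψ (MvPowerSeries.C (MvPowerSeries.constantCoeff x)) =
      PowerSeries.C (MvPowerSeries.constantCoeff x) := ψ.commutes _
  have h1 := congrArg ψ her
  rw [map_add ψ, map_add ψ, map_mul ψ, map_mul ψ, h.map_eq_zero, hτ, hC] at h1
  rw [h1]
  simp

/-- Division by `c` one step at a time: if the cofactor of `c ^ n` still vanishes on the branch, its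
constant term is zero, so it lies in the ideal generated by `a` and `c`. -/
lemma exists_eq_of_dvd (h : IsBranch ψ a c) {n : ℕ} {x : Germ} (hx : PowerSeries.X ^ n ∣ ψ x) :
    ∃ e r : Germ, x = a * e + c ^ n * r := by
  induction n with
  | zero => exact ⟨0, x, by simp⟩
  | succ n ih =>
    obtain ⟨e, r, her⟩ := ih ((pow_dvd_pow _ n.le_succ).trans hx)
    obtain ⟨τ, hτu, hτ⟩ := h.exists_unit
    have hr : PowerSeries.X ∣ ψ r := by
      have h1 : ψ x = PowerSeries.X ^ n * (τ ^ n * ψ r) := by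
        rw [her, map_add, map_mul, map_mul, map_pow, h.map_eq_zero, hτ]
        ring
      rw [h1, pow_succ] at hx
      have h2 := (mul_dvd_mul_iff_left (pow_ne_zero n PowerSeries.X_ne_zero)).1 hx
      exact (hτu.pow n).dvd_mul_left.1 h2
    rw [PowerSeries.X_dvd_iff, h.constantCoeff_map] at hr
    obtain ⟨e', r', h'⟩ := exists_eq_C_add a c h.coords r
    rw [hr] at h'
    refine ⟨e + c ^ n * e', r', ?_⟩
    rw [her]
    conv_lhs => rw [h']
    simp only [map_zero]
    ring

lemma dvd_map_iff (h : IsBranch ψ a c) {n : ℕ} {x : Germ} :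
    PowerSeries.X ^ n ∣ ψ x ↔ x ∈ Ideal.span {a, c ^ n} := by
  rw [Ideal.mem_span_pair]
  constructor
  · intro hx
    obtain ⟨e, r, her⟩ := h.exists_eq_of_dvd hx
    exact ⟨e, r, by rw [her]; ring⟩
  · rintro ⟨e, r, rfl⟩
    obtain ⟨τ, -, hτ⟩ := h.exists_unit
    rw [map_add, map_mul, map_mul, map_pow, h.map_eq_zero, hτ]
    exact ⟨ψ r * τ ^ n, by ring⟩

/-- `ψ` is surjective modulo every power of the variable: since `ψ c` has order one, a multiple of
`c ^ n` corrects the coefficient of degree `n` without disturbing the lower ones. -/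
lemma exists_dvd_sub (h : IsBranch ψ a c) (n : ℕ) (y : PowerSeries ℂ) :
    ∃ x : Germ, PowerSeries.X ^ n ∣ y - ψ x := by
  induction n with
  | zero => exact ⟨0, by simp⟩
  | succ n ih =>
    obtain ⟨x, z, hz⟩ := ih
    obtain ⟨τ, hτu, hτ⟩ := h.exists_unit
    have hτ0 : PowerSeries.constantCoeff τ ≠ 0 :=
      isUnit_iff_ne_zero.1 (PowerSeries.isUnit_iff_constantCoeff.1 hτu)
    set κ : ℂ := PowerSeries.constantCoeff z / PowerSeries.constantCoeff τ ^ n with hκ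
    refine ⟨x + MvPowerSeries.C κ * c ^ n, ?_⟩
    have hC : ψ (MvPowerSeries.C κ) = PowerSeries.C κ := ψ.commutes _
    have h1 : y - ψ (x + MvPowerSeries.C κ * c ^ n) =
        PowerSeries.X ^ n * (z - PowerSeries.C κ * τ ^ n) := by
      rw [map_add, map_mul, map_pow, hτ, hC]
      linear_combination hz
    rw [h1, pow_succ]
    apply mul_dvd_mul_left
    rw [PowerSeries.X_dvd_iff]
    simp [hκ, hτ0]

/-- The first `n` coefficients of `ψ x` identify the quotient with ℂⁿ: the kernel comes from
`dvd_map_iff`, surjectivity from `exists_dvd_sub`. -/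
lemma length_quotient (h : IsBranch ψ a c) (n : ℕ) :
    Module.length ℂ (Germ ⧸ Ideal.span {a, c ^ n}) = n := by
  let J : Germ →ₗ[ℂ] (Fin n → ℂ) :=
    LinearMap.pi fun i => (PowerSeries.coeff (R := ℂ) (i : ℕ)) ∘ₗ ψ.toLinearMap
  have hJ : ∀ x i, J x i = PowerSeries.coeff (i : ℕ) (ψ x) := fun x i => rfl
  have hker : LinearMap.ker J = (Ideal.span {a, c ^ n}).restrictScalars ℂ := by
    ext x
    rw [LinearMap.mem_ker, Submodule.restrictScalars_mem, ← h.dvd_map_iff,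
      PowerSeries.X_pow_dvd_iff]
    constructor
    · intro hx m hm
      exact congrFun hx ⟨m, hm⟩
    · intro hx
      ext i
      exact hx i i.2
  have hsurj : Function.Surjective J := by
    intro y
    obtain ⟨x, hx⟩ := h.exists_dvd_sub n
      (PowerSeries.mk fun i => if hi : i < n then y ⟨i, hi⟩ else 0)
    refine ⟨x, ?_⟩
    ext i
    rw [PowerSeries.X_pow_dvd_iff] at hx
    have := hx i i.2
    rw [map_sub, PowerSeries.coeff_mk, dif_pos i.2, sub_eq_zero] at this
    rw [hJ, ← this]
  have e1 : (Germ ⧸ Ideal.span {a, c ^ n}) ≃ₗ[ℂ] (Fin n → ℂ) :=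
    (Submodule.Quotient.restrictScalarsEquiv ℂ (Ideal.span {a, c ^ n})).symm.trans
      ((Submodule.quotEquivOfEq _ _ hker.symm).trans (J.quotKerEquivOfSurjective hsurj))
  rw [e1.length_eq, Module.length_eq_finrank]
  simp

lemma exists_unit_of_not_dvd (h : IsBranch ψ a c) {n : ℕ} {b : Germ}
    (h1 : PowerSeries.X ^ n ∣ ψ b) (h2 : ¬ PowerSeries.X ^ (n + 1) ∣ ψ b) :
    ∃ e r : Germ, IsUnit r ∧ b = a * e + c ^ n * r := by
  obtain ⟨e, r, her⟩ := h.exists_eq_of_dvd h1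
  refine ⟨e, r, ?_, her⟩
  apply isUnit_germ
  intro hr
  apply h2
  rw [← h.constantCoeff_map, ← PowerSeries.X_dvd_iff] at hr
  obtain ⟨τ, -, hτ⟩ := h.exists_unit
  obtain ⟨y, hy⟩ := hr
  rw [her, map_add, map_mul, map_mul, map_pow, h.map_eq_zero, hτ, hy]
  exact ⟨τ ^ n * y, by ring⟩

/-- The intersection number with a smooth branch is the order of vanishing along it. -/
lemma le_length_iff (h : IsBranch ψ a c) (b : Germ) (n : ℕ) :
    (n : ℕ∞) ≤ Module.length ℂ (Germ ⧸ Ideal.span {a, b}) ↔ PowerSeries.X ^ n ∣ ψ b := by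
  constructor
  · intro hn
    by_contra hb
    -- If `ψ b` has exact order m < n, then `b` is a unit times `c ^ m` modulo `a`, so the length is
    -- m, a contradiction.
    have hex : ∃ m, ¬ PowerSeries.X ^ m ∣ ψ b := ⟨n, hb⟩
    classical
    obtain ⟨m, hm⟩ : ∃ m, Nat.find hex = m + 1 := by
      apply Nat.exists_eq_succ_of_ne_zero
      intro h0
      have := Nat.find_spec hex
      rw [h0, pow_zero] at this
      exact this (one_dvd _)
    have hmn : m < n := by
      have := Nat.find_min' hex hb
      omega
    have h1 : PowerSeries.X ^ m ∣ ψ b := by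
      by_contra hc
      have := Nat.find_min' hex hc
      omega
    have h2 : ¬ PowerSeries.X ^ (m + 1) ∣ ψ b := hm ▸ Nat.find_spec hex
    obtain ⟨e, r, hr, her⟩ := h.exists_unit_of_not_dvd h1 h2
    have hspan : Ideal.span {a, b} = Ideal.span {a, c ^ m} := by
      obtain ⟨s, hs⟩ := hr.exists_left_inv
      apply le_antisymm
      · rw [Ideal.span_le]
        rintro x (rfl | rfl)
        · exact Ideal.subset_span (by simp)
        · rw [SetLike.mem_coe, Ideal.mem_span_pair]
          exact ⟨e, r, by rw [her]; ring⟩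
      · rw [Ideal.span_le]
        rintro x (rfl | rfl)
        · exact Ideal.subset_span (by simp)
        · rw [SetLike.mem_coe, Ideal.mem_span_pair]
          exact ⟨-(s * e), s, by rw [her]; linear_combination c ^ m * hs⟩
    rw [hspan, h.length_quotient, Nat.cast_le] at hn
    omega
  · intro hb
    rw [← h.length_quotient n]
    have hle : Ideal.span {a, b} ≤ Ideal.span {a, c ^ n} := by
      rw [Ideal.span_le]
      rintro x (rfl | rfl)
      · exact Ideal.subset_span (by simp)
      · exact h.dvd_map_iff.1 hb
    exact Module.length_le_of_surjective
      ((Ideal.Quotient.factorₐ ℂ hle).toLinearMap) (Ideal.Quotient.factor_surjective hle)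

/-- Two smooth branches meeting with intersection number `3` form an `A₅` singularity. -/
lemma exists_typeA_five (h : IsBranch ψ a c) {b k : Germ} (hb : ∃ i, lin i b ≠ 0)
    (hk : IsUnit k) (h3 : PowerSeries.X ^ 3 ∣ ψ b) (h4 : ¬ PowerSeries.X ^ 4 ∣ ψ b) :
    ∃ u v w : Germ, IsLocalCoordinates u v ∧ IsUnit w ∧ a * b * k = w * (v ^ 2 - u ^ (5 + 1)) := by
  obtain ⟨e, r, hr, her⟩ := h.exists_unit_of_not_dvd h3 h4
  obtain ⟨ha, hc, hd⟩ := h.coords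
  -- The term `c ^ 3 * r` has no linear part, so the linear part of `b` is e(0) times that of `a`;
  -- smoothness of `b` makes `e` a unit.
  have he0 : MvPowerSeries.constantCoeff e ≠ 0 := by
    intro he
    obtain ⟨i, hi⟩ := hb
    apply hi
    rw [her, lin_add, lin_mul, lin_mul, lin_pow_eq_zero i c hc (by norm_num), ha, he]
    simp [hc]
  have he := isUnit_germ he0
  obtain ⟨s, hs⟩ := hr.exists_left_inv
  obtain ⟨e', he'⟩ := he.exists_left_inv
  have hs0 : MvPowerSeries.constantCoeff s ≠ 0 := by
    intro h0
    have := congrArg MvPowerSeries.constantCoeff hs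
    simp [h0] at this
  have he'0 : MvPowerSeries.constantCoeff e' ≠ 0 := by
    intro h0
    have := congrArg MvPowerSeries.constantCoeff he'
    simp [h0] at this
  have hr0 : MvPowerSeries.constantCoeff r ≠ 0 := by
    intro h0
    have := congrArg MvPowerSeries.constantCoeff hs
    simp [h0] at this
  set half : Germ := MvPowerSeries.C (1 / 2 : ℂ) with hhalf
  have hh : 2 * half = 1 := by
    rw [hhalf, show (2 : Germ) = MvPowerSeries.C (2 : ℂ) from (map_ofNat MvPowerSeries.C 2).symm,
      ← map_mul]
    norm_num
  -- Completing the square: with s = r⁻¹ one has (2esa + c³)² − c⁶ = 4esa(esa + c³) = 4es²·ab.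
  refine ⟨c, 2 * e * s * a + c ^ 3, half ^ 2 * e' * r ^ 2 * k, ?_, ?_, ?_⟩
  · refine ⟨hc, by simp [ha, hc], ?_⟩
    have hlin : ∀ i, lin i (2 * e * s * a + c ^ 3) =
        2 * MvPowerSeries.constantCoeff e * MvPowerSeries.constantCoeff s * lin i a := by
      intro i
      rw [lin_add, lin_mul, lin_pow_eq_zero i c hc (by norm_num), ha, map_mul, map_mul,
        map_ofNat MvPowerSeries.constantCoeff 2]
      simp
    change lin 0 c * lin 1 _ - lin 1 c * lin 0 _ ≠ 0
    rw [hlin, hlin]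
    have hd' : lin 0 a * lin 1 c - lin 1 a * lin 0 c ≠ 0 := hd
    intro h0
    have : (2 * MvPowerSeries.constantCoeff e * MvPowerSeries.constantCoeff s) *
        (lin 0 a * lin 1 c - lin 1 a * lin 0 c) = 0 := by linear_combination -h0
    simp [he0, hs0, hd'] at this
  · apply isUnit_germ
    rw [MvPowerSeries.isUnit_iff_constantCoeff, isUnit_iff_ne_zero] at hk
    simp [hhalf, he'0, hr0, hk]
  · rw [her]
    have h1 : half ^ 2 * 4 = 1 := by linear_combination (2 * half + 1) * hh
    linear_combination (-a ^ 2 * e * k * (s * r) ^ 2 * e' * e - a * c ^ 3 * k * r * e' * e * s * r) * h1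
      + (-a ^ 2 * e * k * (s * r) ^ 2 - a * c ^ 3 * k * r * (s * r)) * he'
      + (-a ^ 2 * e * k * (s * r + 1) - a * c ^ 3 * k * r) * hs

end IsBranch

/-- Two transversal smooth branches form an `A₁` singularity. -/
lemma exists_typeA_one {a b k : Germ} (h : IsLocalCoordinates a b) (hk : IsUnit k) :
    ∃ u v w : Germ, IsLocalCoordinates u v ∧ IsUnit w ∧ a * b * k = w * (v ^ 2 - u ^ (1 + 1)) := by
  obtain ⟨ha, hb, hd⟩ := h
  set half : Germ := MvPowerSeries.C (1 / 2 : ℂ) with hhalf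
  have hh : 2 * half = 1 := by
    rw [hhalf, show (2 : Germ) = MvPowerSeries.C (2 : ℂ) from (map_ofNat MvPowerSeries.C 2).symm,
      ← map_mul]
    norm_num
  refine ⟨a - b, a + b, half ^ 2 * k, ⟨by simp [ha, hb], by simp [ha, hb], ?_⟩, ?_, ?_⟩
  · simp only [map_sub, map_add]
    intro h0
    apply hd
    linear_combination h0 / 2
  · apply isUnit_germ
    rw [MvPowerSeries.isUnit_iff_constantCoeff, isUnit_iff_ne_zero] at hk
    simp [hhalf, hk]
  · have h1 : half ^ 2 * 4 = 1 := by linear_combination (2 * half + 1) * hh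
    linear_combination (-a * b * k) * h1

open MvPolynomial

/-! ### Forms -/

lemma aeval_mul_of_isHomogeneous {A : Type*} [CommRing A] [Algebra ℂ A] {F : Form} {n : ℕ}
    (hF : F.IsHomogeneous n) (μ : A) (g : Fin 3 → A) :
    aeval (fun l => μ * g l) F = μ ^ n * aeval g F := by
  rw [aeval_def, aeval_def, eval₂_eq', eval₂_eq', Finset.mul_sum]
  refine Finset.sum_congr rfl fun d hd => ?_
  have hdeg : ∑ i, d i = n := by
    have := hF.degree_eq_sum_deg_support hd
    rw [this]
    exact (Finset.sum_subset (Finset.subset_univ _) fun i _ hi => by simpa using hi).symm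
  simp only [mul_pow, Finset.prod_mul_distrib, Finset.prod_pow_eq_pow_sum, hdeg]
  ring

lemma eval_smul_of_isHomogeneous {F : Form} {n : ℕ} (hF : F.IsHomogeneous n) (c : ℂ)
    (v : Fin 3 → ℂ) : eval (c • v) F = c ^ n * eval v F := by
  have := aeval_mul_of_isHomogeneous hF c v
  rw [← coe_aeval_eq_eval]
  exact this

lemma derivation_aeval {A : Type*} [CommRing A] [Algebra ℂ A] (D : Derivation ℂ A A)
    (g : Fin 3 → A) (F : Form) :
    D (aeval g F) = ∑ l, aeval g (pderiv l F) * D (g l) := by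
  induction F using MvPolynomial.induction_on with
  | C a => simp
  | add p q hp hq => simp [hp, hq, add_mul, Finset.sum_add_distrib]
  | mul_X p i hp =>
    simp only [map_mul, aeval_X, Derivation.leibniz, smul_eq_mul, hp, pderiv_X, map_add,
      add_mul, Finset.sum_add_distrib, Finset.mul_sum]
    congr 1
    · rw [Finset.sum_eq_single i]
      · simp
      · intro b _ hb
        simp [hb.symm]
      · simp
    · refine Finset.sum_congr rfl fun l _ => ?_
      ring

lemma euler_eval {F : Form} {n : ℕ} (hF : F.IsHomogeneous n) (v : Fin 3 → ℂ) :
    ∑ l, v l * eval v (pderiv l F) = n * eval v F := by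
  have := congrArg (eval v) hF.sum_X_mul_pderiv
  simpa using this

/-! ### Local equations -/

/-- The chart used at `v`: the coordinate `i` is set to `1`, the coordinates `j` and `k` are the
local ones. -/
lemma exists_chart {v : Fin 3 → ℂ} (hv : v ≠ 0) :
    ∃ i j k : Fin 3, v i ≠ 0 ∧ (∀ g : Fin 3 → ℂ, ∑ l, g l = g i + g j + g k) ∧
      (∀ p : Fin 3 → Prop, p i → p j → p k → ∀ l, p l) ∧
      localCoords v i = 1 ∧ localCoords v j = C (v j / v i) + X 0 ∧
      localCoords v k = C (v k / v i) + X 1 := by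
  by_cases h2 : v 2 ≠ 0
  · refine ⟨2, 0, 1, h2, fun g => ?_, fun p h h' h'' l => ?_, ?_, ?_, ?_⟩
    · rw [Fin.sum_univ_three]; ring
    · fin_cases l <;> assumption
    all_goals simp [localCoords, h2]
  by_cases h1 : v 1 ≠ 0
  · refine ⟨1, 0, 2, h1, fun g => ?_, fun p h h' h'' l => ?_, ?_, ?_, ?_⟩
    · rw [Fin.sum_univ_three]; ring
    · fin_cases l <;> assumption
    all_goals simp [localCoords, h1, h2]
  · refine ⟨0, 1, 2, fun h0 => ?_, fun g => ?_, fun p h h' h'' l => ?_, ?_, ?_, ?_⟩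
    · apply hv
      push Not at h1 h2
      ext l
      fin_cases l <;> assumption
    · rw [Fin.sum_univ_three]
    · fin_cases l <;> assumption
    all_goals simp [localCoords, h1, h2]

lemma constantCoeff_coe (p : MvPolynomial (Fin 2) ℂ) :
    MvPowerSeries.constantCoeff (p : Germ) = eval 0 p := by
  rw [← MvPowerSeries.coeff_zero_eq_constantCoeff_apply, MvPolynomial.coeff_coe, eval_zero]
  rfl

lemma lin_coe (j : Fin 2) (p : MvPolynomial (Fin 2) ℂ) :
    lin j (p : Germ) = eval 0 (pderiv j p) := by
  rw [lin, MvPolynomial.coeff_coe, eval_zero, constantCoeff_eq, coeff_pderiv]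
  simp

/-- Treats the three charts at once: the 1-jet of a local equation consists of the value and two
partial derivatives of the form at the representative whose `i`-th coordinate is 1. -/
lemma eval_zero_aeval_localCoords (v : Fin 3 → ℂ) (hv : v ≠ 0) :
    ∃ i j k : Fin 3, v i ≠ 0 ∧ (∀ g : Fin 3 → ℂ, ∑ l, g l = g i + g j + g k) ∧
      (∀ p : Fin 3 → Prop, p i → p j → p k → ∀ l, p l) ∧
      (∀ F : Form, eval 0 (aeval (localCoords v) F) = eval ((v i)⁻¹ • v) F) ∧
      (∀ F : Form, eval 0 (pderiv 0 (aeval (localCoords v) F)) =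
        eval ((v i)⁻¹ • v) (pderiv j F)) ∧
      (∀ F : Form, eval 0 (pderiv 1 (aeval (localCoords v) F)) =
        eval ((v i)⁻¹ • v) (pderiv k F)) := by
  obtain ⟨i, j, k, hi, hsum, hall, hci, hcj, hck⟩ := exists_chart hv
  have h0 : ∀ F : Form, eval 0 (aeval (localCoords v) F) = eval ((v i)⁻¹ • v) F := by
    intro F
    have h1 : ∀ l, eval 0 (localCoords v l) = ((v i)⁻¹ • v) l := by
      apply hall
      · simp [hci, hi]
      · simp [hcj, div_eq_inv_mul]
      · simp [hck, div_eq_inv_mul]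
    have h2 : (aeval (R := ℂ) (0 : Fin 2 → ℂ)).comp (aeval (localCoords v)) =
        aeval (R := ℂ) ((v i)⁻¹ • v) := by
      apply algHom_ext
      intro l
      simpa [aeval_eq_eval] using h1 l
    simpa [aeval_eq_eval] using DFunLike.congr_fun h2 F
  refine ⟨i, j, k, hi, hsum, hall, h0, ?_, ?_⟩
  · intro F
    rw [derivation_aeval, map_sum, hsum, hci, hcj, hck]
    simp only [map_mul, h0, map_add, pderiv_C, pderiv_X]
    simp
  · intro F
    rw [derivation_aeval, map_sum, hsum, hci, hcj, hck]
    simp only [map_mul, h0, map_add, pderiv_C, pderiv_X]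
    simp

lemma constantCoeff_germ_eq_zero_iff {F : Form} {n : ℕ} (hF : F.IsHomogeneous n) (P : Plane) :
    MvPowerSeries.constantCoeff (germ F P) = 0 ↔ eval P.rep F = 0 := by
  obtain ⟨i, j, k, hi, -, -, h0, -, -⟩ := eval_zero_aeval_localCoords P.rep P.rep_nonzero
  rw [germ, constantCoeff_coe, h0, eval_smul_of_isHomogeneous hF]
  simp [hi]

lemma isUnit_germ_of_eval_ne_zero {F : Form} {n : ℕ} (hF : F.IsHomogeneous n) {P : Plane}
    (h : eval P.rep F ≠ 0) : IsUnit (germ F P) :=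
  isUnit_germ (mt (constantCoeff_germ_eq_zero_iff hF P).1 h)

/-- The local equation of a curve at a smooth point has a non-zero linear part. -/
lemma exists_lin_germ_ne_zero {F : Form} {n : ℕ} (hF : F.IsHomogeneous n) {P : Plane}
    (hP : IsSmoothPoint F P) : ∃ i, lin i (germ F P) ≠ 0 := by
  obtain ⟨i, j, k, hi, hsum, hall, -, h1, h2⟩ := eval_zero_aeval_localCoords P.rep P.rep_nonzero
  obtain ⟨h, l, hl⟩ := hP
  by_contra! hc
  have hj := hc 0
  have hk := hc 1
  rw [germ, lin_coe, h1, eval_smul_of_isHomogeneous hF.pderiv] at hj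
  rw [germ, lin_coe, h2, eval_smul_of_isHomogeneous hF.pderiv] at hk
  simp only [mul_eq_zero, pow_eq_zero_iff', inv_eq_zero, hi, false_and, false_or] at hj hk
  -- Euler's relation at a zero of `F` recovers the third partial derivative, the one along the
  -- coordinate set to 1, from the two local ones.
  have he := euler_eval hF P.rep
  rw [hsum, hj, hk, h] at he
  simp only [mul_zero, add_zero, mul_eq_zero, hi, false_or] at he
  exact hl (hall (fun l => eval P.rep (pderiv l F) = 0) he hj hk l)

/-- Two curves with independent gradients at `P` have local equations that form a system of local
coordinates. -/
lemma isLocalCoordinates_germ {F G : Form} {m n : ℕ} (hF : F.IsHomogeneous m)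
    (hG : G.IsHomogeneous n) {P : Plane} (hFP : eval P.rep F = 0) (hGP : eval P.rep G = 0)
    (h : ∃ i j, eval P.rep (pderiv i F) * eval P.rep (pderiv j G) ≠
      eval P.rep (pderiv j F) * eval P.rep (pderiv i G)) :
    IsLocalCoordinates (germ F P) (germ G P) := by
  refine ⟨(constantCoeff_germ_eq_zero_iff hF P).2 hFP,
    (constantCoeff_germ_eq_zero_iff hG P).2 hGP, ?_⟩
  obtain ⟨i, j, k, hi, hsum, hall, -, h1, h2⟩ := eval_zero_aeval_localCoords P.rep P.rep_nonzero
  change lin 0 _ * lin 1 _ - lin 1 _ * lin 0 _ ≠ 0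
  rw [germ, germ, lin_coe, lin_coe, lin_coe, lin_coe, h1, h2, h1, h2,
    eval_smul_of_isHomogeneous hF.pderiv, eval_smul_of_isHomogeneous hF.pderiv,
    eval_smul_of_isHomogeneous hG.pderiv, eval_smul_of_isHomogeneous hG.pderiv]
  intro h0
  -- By Euler's relation both gradients annihilate the vector `P.rep`, so their 2×2 minors are
  -- proportional to its coordinates. As `P.rep i ≠ 0`, vanishing of the `j k` minor forces all of
  -- them to vanish.
  have heF := euler_eval hF P.rep
  have heG := euler_eval hG P.rep
  rw [hsum, hFP] at heF
  rw [hsum, hGP] at heG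
  have h3 : ((P.rep i)⁻¹ ^ (m - 1) * (P.rep i)⁻¹ ^ (n - 1)) *
      (eval P.rep (pderiv j F) * eval P.rep (pderiv k G) -
        eval P.rep (pderiv k F) * eval P.rep (pderiv j G)) = 0 := by
    linear_combination h0
  have hjk : eval P.rep (pderiv j F) * eval P.rep (pderiv k G) -
        eval P.rep (pderiv k F) * eval P.rep (pderiv j G) = 0 := by
    rcases mul_eq_zero.1 h3 with h4 | h4
    · simp [hi] at h4
    · exact h4
  have hij : eval P.rep (pderiv i F) * eval P.rep (pderiv j G) =
        eval P.rep (pderiv j F) * eval P.rep (pderiv i G) := by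
    apply mul_left_cancel₀ hi
    linear_combination eval P.rep (pderiv j G) * heF - eval P.rep (pderiv j F) * heG
      + P.rep k * hjk
  have hik : eval P.rep (pderiv i F) * eval P.rep (pderiv k G) =
        eval P.rep (pderiv k F) * eval P.rep (pderiv i G) := by
    apply mul_left_cancel₀ hi
    linear_combination eval P.rep (pderiv k G) * heF - eval P.rep (pderiv k F) * heG
      - P.rep j * hjk
  obtain ⟨a, b, hab⟩ := h
  apply hab
  have key : ∀ a b, eval P.rep (pderiv a F) * eval P.rep (pderiv b G) =
        eval P.rep (pderiv b F) * eval P.rep (pderiv a G) := by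
    apply hall
    · apply hall
      · ring
      · exact hij
      · exact hik
    · apply hall
      · linear_combination -hij
      · ring
      · linear_combination hjk
    · apply hall
      · linear_combination -hik
      · linear_combination -hjk
      · ring
  exact key a b

/-! ### Curves through a point -/

/-- Restriction of germs to a parametrized curve `Φ` through `P`. -/
lemma exists_restriction (P : Plane) (Φ : Fin 3 → PowerSeries ℂ) (lam : ℂ) (hlam : lam ≠ 0)
    (hΦ : ∀ l, PowerSeries.constantCoeff (Φ l) = lam * P.rep l)
    (himm : ∀ κ : ℂ, ∃ l, PowerSeries.coeff 1 (Φ l) ≠ κ * P.rep l) :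
    ∃ (ψ : Germ →ₐ[ℂ] PowerSeries ℂ) (μ : PowerSeries ℂ), IsUnit μ ∧
      (∀ x, PowerSeries.constantCoeff (ψ x) = MvPowerSeries.constantCoeff x) ∧
      (∀ (F : Form) (n : ℕ), F.IsHomogeneous n → aeval Φ F = μ ^ n * ψ (germ F P)) ∧
      ∃ p : Fin 2 → ℂ, (∃ i, p i ≠ 0) ∧
        ∀ x, PowerSeries.coeff 1 (ψ x) = lin 0 x * p 0 + lin 1 x * p 1 := by
  obtain ⟨i, j, k, hi, -, hall, hci, hcj, hck⟩ := exists_chart P.rep_nonzero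
  have hμ0 : PowerSeries.constantCoeff (Φ i) ≠ 0 := by
    rw [hΦ]
    exact mul_ne_zero hlam hi
  have hμ : IsUnit (Φ i) :=
    PowerSeries.isUnit_iff_constantCoeff.2 (isUnit_iff_ne_zero.2 hμ0)
  obtain ⟨ν, hν⟩ := hμ.exists_left_inv
  have hν0 : PowerSeries.constantCoeff ν * (lam * P.rep i) = 1 := by
    have := congrArg PowerSeries.constantCoeff hν
    rwa [map_mul, hΦ, map_one] at this
  -- The arc in the affine chart at `P`: divide by the unit `Φ i`, then centre at `P`. Substituting
  -- `s` is the restriction map.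
  let s : Fin 2 → PowerSeries ℂ := ![ν * Φ j - PowerSeries.C (P.rep j / P.rep i),
    ν * Φ k - PowerSeries.C (P.rep k / P.rep i)]
  have hs0 : ∀ a, PowerSeries.constantCoeff (s a) = 0 := by
    have : ∀ l, PowerSeries.constantCoeff (ν * Φ l - PowerSeries.C (P.rep l / P.rep i)) = 0 := by
      intro l
      rw [map_sub, map_mul, hΦ, PowerSeries.constantCoeff_C]
      field_simp
      linear_combination P.rep l * hν0
    intro a
    fin_cases a
    · exact this j
    · exact this k
  have hsub : MvPowerSeries.HasSubst s := MvPowerSeries.hasSubst_of_constantCoeff_zero hs0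
  let ψ : Germ →ₐ[ℂ] PowerSeries ℂ := MvPowerSeries.substAlgHom hsub
  have hψX : ∀ a, ψ (MvPowerSeries.X a) = s a := fun a => MvPowerSeries.substAlgHom_X hsub a
  have hψp : ∀ p : MvPolynomial (Fin 2) ℂ, ψ (p : Germ) = aeval s p :=
    fun p => MvPowerSeries.substAlgHom_coe hsub p
  have hψC : ∀ c : ℂ, ψ (MvPowerSeries.C c) = PowerSeries.C c := fun c => ψ.commutes c
  have hloc : ∀ l, Φ l = Φ i * aeval s (localCoords P.rep l) := by
    have hC : ∀ c : ℂ, (algebraMap ℂ (PowerSeries ℂ)) c = PowerSeries.C c := fun _ => rfl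
    apply hall
    · rw [hci, map_one, mul_one]
    · rw [hcj, map_add, aeval_X, aeval_C, hC]
      change Φ j = Φ i * (_ + (ν * Φ j - PowerSeries.C (P.rep j / P.rep i)))
      linear_combination (-Φ j) * hν
    · rw [hck, map_add, aeval_X, aeval_C, hC]
      change Φ k = Φ i * (_ + (ν * Φ k - PowerSeries.C (P.rep k / P.rep i)))
      linear_combination (-Φ k) * hν
  have hconst : ∀ x, PowerSeries.constantCoeff (ψ x) = MvPowerSeries.constantCoeff x := by
    intro x
    obtain ⟨p, q, hpq, -, -⟩ := exists_eq_X_mul_add_X_mul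
      (x - MvPowerSeries.C (MvPowerSeries.constantCoeff x)) (by simp)
    have h1 := congrArg ψ (sub_eq_iff_eq_add.1 hpq)
    rw [map_add ψ, map_add ψ, map_mul ψ, map_mul ψ, hψX, hψX, hψC] at h1
    rw [h1]
    simp [hs0]
  have hlin : ∀ x, PowerSeries.coeff 1 (ψ x) =
      lin 0 x * PowerSeries.coeff 1 (s 0) + lin 1 x * PowerSeries.coeff 1 (s 1) := by
    intro x
    obtain ⟨p, q, hpq, hp, hq⟩ := exists_eq_X_mul_add_X_mul
      (x - MvPowerSeries.C (MvPowerSeries.constantCoeff x)) (by simp)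
    have h1 := congrArg ψ (sub_eq_iff_eq_add.1 hpq)
    rw [map_add ψ, map_add ψ, map_mul ψ, map_mul ψ, hψX, hψX, hψC] at h1
    rw [lin_sub, lin_C, sub_zero] at hp hq
    rw [h1, ← hp, ← hq, ← hconst p, ← hconst q]
    simp [PowerSeries.coeff_mul, Finset.Nat.antidiagonal_succ, hs0]
    ring
  refine ⟨ψ, Φ i, hμ, hconst, ?_, fun a => PowerSeries.coeff 1 (s a), ?_, hlin⟩
  · intro F n hF
    have h1 : Φ = fun l => Φ i * aeval s (localCoords P.rep l) := funext hloc
    have h2 : aeval (fun l => aeval s (localCoords P.rep l)) F = ψ (germ F P) := by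
      rw [germ, hψp]
      have : (aeval (R := ℂ) s).comp (aeval (localCoords P.rep)) =
          aeval (R := ℂ) (fun l => aeval s (localCoords P.rep l)) := by
        apply algHom_ext
        intro l
        simp
      exact (DFunLike.congr_fun this F).symm
    rw [← h2, ← aeval_mul_of_isHomogeneous hF]
    exact congrArg (fun g => aeval g F) h1
  · by_contra! hc
    have hj := hc 0
    have hk := hc 1
    have hloc' : ∀ l, PowerSeries.coeff 1 (aeval s (localCoords P.rep l)) = 0 ∧
        PowerSeries.constantCoeff (aeval s (localCoords P.rep l)) = P.rep l / P.rep i := by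
      apply hall
      · rw [hci]
        simp [PowerSeries.coeff_one, hi]
      · rw [hcj]
        simp [hj, hs0]
      · rw [hck]
        simp [hk, hs0]
    -- If both local coordinates had zero derivative, the velocity of `Φ` would be this multiple of
    -- `P.rep`, so the arc would not be immersed in the projective plane.
    obtain ⟨l, hl⟩ := himm (PowerSeries.coeff 1 (Φ i) / P.rep i)
    apply hl
    rw [hloc l, PowerSeries.coeff_mul]
    simp [Finset.Nat.antidiagonal_succ, hloc']
    ring

/-- A smooth curve `G` parametrized near `P` by `Φ` gives a branch in the ring of germs. -/
lemma exists_isBranch {P : Plane} {G : Form} {n : ℕ} (hG : G.IsHomogeneous n)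
    (hGP : IsSmoothPoint G P) (Φ : Fin 3 → PowerSeries ℂ) (lam : ℂ) (hlam : lam ≠ 0)
    (hΦ : ∀ l, PowerSeries.constantCoeff (Φ l) = lam * P.rep l)
    (himm : ∀ κ : ℂ, ∃ l, PowerSeries.coeff 1 (Φ l) ≠ κ * P.rep l) (hGΦ : aeval Φ G = 0) :
    ∃ (ψ : Germ →ₐ[ℂ] PowerSeries ℂ) (c : Germ) (μ : PowerSeries ℂ), IsUnit μ ∧
      (∀ (F : Form) (n : ℕ), F.IsHomogeneous n → aeval Φ F = μ ^ n * ψ (germ F P)) ∧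
      IsBranch ψ (germ G P) c := by
  obtain ⟨ψ, μ, hμ, hconst, hF, p, ⟨i, hpi⟩, hp⟩ := exists_restriction P Φ lam hlam hΦ himm
  have hz : ψ (germ G P) = 0 := by
    have := hF G n hG
    rw [hGΦ] at this
    exact ((hμ.pow n).mul_right_eq_zero.1 this.symm)
  obtain ⟨a, ha⟩ := exists_lin_germ_ne_zero hG hGP
  have hpz := hp (germ G P)
  rw [hz, map_zero] at hpz
  -- The tangent vector `p` has `p i ≠ 0` and is killed by the non-zero linear part of `G`, so `X i`
  -- is a transversal coordinate.
  refine ⟨ψ, MvPowerSeries.X i, μ, hμ, hF, ⟨(constantCoeff_germ_eq_zero_iff hG P).2 hGP.1,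
    by simp, ?_⟩, hz, ?_⟩
  · change lin 0 _ * lin 1 _ - lin 1 _ * lin 0 _ ≠ 0
    rw [lin_X, lin_X]
    intro h0
    fin_cases i
    · simp at h0 hpi
      rw [h0] at hpz
      simp [hpi] at hpz
      fin_cases a
      · exact ha hpz
      · exact ha h0
    · simp at h0 hpi
      rw [h0] at hpz
      simp [hpi] at hpz
      fin_cases a
      · exact ha h0
      · exact ha hpz
  · have hX : PowerSeries.X ∣ ψ (MvPowerSeries.X i) := by
      rw [PowerSeries.X_dvd_iff, hconst]
      simp
    obtain ⟨τ, hτ⟩ := hX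
    refine ⟨τ, ?_, hτ⟩
    rw [PowerSeries.isUnit_iff_constantCoeff, isUnit_iff_ne_zero]
    have h1 := hp (MvPowerSeries.X i)
    have h2 : PowerSeries.coeff 1 (PowerSeries.X * τ) = PowerSeries.constantCoeff τ := by
      rw [← PowerSeries.coeff_zero_eq_constantCoeff_apply]
      exact PowerSeries.coeff_succ_X_mul 0 τ
    rw [hτ, h2] at h1
    rw [h1, lin_X, lin_X]
    fin_cases i <;> simpa using hpi

/-! ### Polynomial parametrizations -/

/-- The value of a parametrized curve at `t`. -/
def arcEval (φ : Fin 3 → Polynomial ℂ) (t : ℂ) : Fin 3 → ℂ := fun l => (φ l).eval t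

lemma eval_aeval (φ : Fin 3 → Polynomial ℂ) (t : ℂ) (F : Form) :
    (aeval φ F).eval t = eval (arcEval φ t) F := by
  have h : ((Polynomial.aeval (R := ℂ) t).comp (aeval φ) : Form →ₐ[ℂ] ℂ) =
      aeval (arcEval φ t) := by
    apply algHom_ext
    intro l
    simp [arcEval]
  have := DFunLike.congr_fun h F
  simpa [aeval_eq_eval] using this

/-- `φ` parametrizes a smooth branch of the curve `G` at the point `P`, at the parameter `t`. -/
structure IsArc (φ : Fin 3 → Polynomial ℂ) (t : ℂ) (G : Form) (P : Plane) : Prop where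
  exists_eq : ∃ lam : ℂ, lam ≠ 0 ∧ arcEval φ t = lam • P.rep
  immersive : ∀ κ : ℂ, ∃ l, (φ l).derivative.eval t ≠ κ * arcEval φ t l
  aeval_eq_zero : aeval φ G = 0
  smooth : ∃ l, eval P.rep (pderiv l G) ≠ 0

namespace IsArc

variable {φ : Fin 3 → Polynomial ℂ} {t : ℂ} {G : Form} {P : Plane}

lemma eval_eq_zero {n : ℕ} (hG : G.IsHomogeneous n) (h : IsArc φ t G P) : eval P.rep G = 0 := by
  obtain ⟨lam, hlam, he⟩ := h.exists_eq
  have h1 : (aeval φ G).eval t = 0 := by rw [h.aeval_eq_zero, Polynomial.eval_zero]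
  rw [eval_aeval, he, eval_smul_of_isHomogeneous hG] at h1
  simpa [hlam] using h1

lemma isSmoothPoint {n : ℕ} (hG : G.IsHomogeneous n) (h : IsArc φ t G P) : IsSmoothPoint G P :=
  ⟨h.eval_eq_zero hG, h.smooth⟩

end IsArc

/-- The power series expansion of a polynomial at `t`. -/
def expansion (t : ℂ) : Polynomial ℂ →ₐ[ℂ] PowerSeries ℂ :=
  (Polynomial.coeToPowerSeries.algHom ℂ).comp (Polynomial.aeval (Polynomial.X + Polynomial.C t))

lemma expansion_apply (t : ℂ) (p : Polynomial ℂ) :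
    expansion t p = ((p.comp (Polynomial.X + Polynomial.C t) : Polynomial ℂ) : PowerSeries ℂ) := by
  rw [expansion, AlgHom.comp_apply, Polynomial.coeToPowerSeries.algHom_apply]
  simp [Polynomial.aeval_def, Polynomial.comp, Polynomial.algebraMap_eq]

lemma X_pow_dvd_expansion_iff (t : ℂ) (p : Polynomial ℂ) (n : ℕ) :
    PowerSeries.X ^ n ∣ expansion t p ↔ (Polynomial.X - Polynomial.C t) ^ n ∣ p := by
  have h1 : (Polynomial.X - Polynomial.C t) ^ n ∣ p ↔
      Polynomial.X ^ n ∣ p.comp (Polynomial.X + Polynomial.C t) := by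
    constructor
    · rintro ⟨q, rfl⟩
      refine ⟨q.comp (Polynomial.X + Polynomial.C t), ?_⟩
      simp
    · rintro ⟨q, hq⟩
      refine ⟨q.comp (Polynomial.X - Polynomial.C t), ?_⟩
      have h2 := congrArg (fun r => Polynomial.comp r (Polynomial.X - Polynomial.C t)) hq
      simpa [Polynomial.comp_assoc] using h2
  rw [h1, expansion_apply, PowerSeries.X_pow_dvd_iff, Polynomial.X_pow_dvd_iff]
  simp

lemma constantCoeff_expansion (t : ℂ) (p : Polynomial ℂ) :
    PowerSeries.constantCoeff (expansion t p) = p.eval t := by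
  rw [expansion_apply, ← PowerSeries.coeff_zero_eq_constantCoeff_apply, Polynomial.coeff_coe,
    Polynomial.coeff_zero_eq_eval_zero]
  simp

lemma coeff_one_expansion (t : ℂ) (p : Polynomial ℂ) :
    PowerSeries.coeff 1 (expansion t p) = p.derivative.eval t := by
  rw [expansion_apply, Polynomial.coeff_coe]
  have : ∀ q : Polynomial ℂ, q.coeff 1 = q.derivative.eval 0 := by
    intro q
    rw [← Polynomial.coeff_zero_eq_eval_zero, Polynomial.coeff_derivative]
    simp
  rw [this, Polynomial.derivative_comp]
  simp

namespace IsArc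

variable {φ : Fin 3 → Polynomial ℂ} {t : ℂ} {G : Form} {P : Plane}

lemma exists_isBranch {n : ℕ} (hG : G.IsHomogeneous n) (h : IsArc φ t G P) :
    ∃ (ψ : Germ →ₐ[ℂ] PowerSeries ℂ) (c : Germ), IsBranch ψ (germ G P) c ∧
      ∀ (F : Form) (n : ℕ), F.IsHomogeneous n → ∀ k,
        (PowerSeries.X ^ k ∣ ψ (germ F P) ↔ (Polynomial.X - Polynomial.C t) ^ k ∣ aeval φ F) := by
  obtain ⟨lam, hlam, he⟩ := h.exists_eq
  have hcomp : ∀ F : Form, aeval (fun l => expansion t (φ l)) F = expansion t (aeval φ F) := by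
    intro F
    have : aeval (fun l => expansion t (φ l)) = (expansion t).comp (aeval (R := ℂ) φ) := by
      apply algHom_ext
      intro l
      simp
    exact DFunLike.congr_fun this F
  obtain ⟨ψ, c, μ, hμ, hF, hb⟩ := ThreeConics.exists_isBranch hG (h.isSmoothPoint hG)
    (fun l => expansion t (φ l)) lam hlam
    (fun l => by rw [constantCoeff_expansion]; exact congrFun he l)
    (fun κ => by
      obtain ⟨l, hl⟩ := h.immersive (κ / lam)
      refine ⟨l, ?_⟩
      rw [coeff_one_expansion]
      intro h'
      apply hl
      rw [h', he, Pi.smul_apply, smul_eq_mul]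
      field_simp)
    (by rw [hcomp, h.aeval_eq_zero, map_zero])
  refine ⟨ψ, c, hb, fun F n hFn k => ?_⟩
  rw [← X_pow_dvd_expansion_iff, ← hcomp, hF F n hFn]
  exact (hμ.pow n).dvd_mul_left.symm

/-- The intersection number with a smooth parametrized curve is the order of vanishing along the
parametrization. -/
lemma le_interMult_iff {n m : ℕ} (hG : G.IsHomogeneous n) (h : IsArc φ t G P) {F : Form}
    (hF : F.IsHomogeneous m) (k : ℕ) :
    (k : ℕ∞) ≤ interMult G F P ↔ (Polynomial.X - Polynomial.C t) ^ k ∣ aeval φ F := by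
  obtain ⟨ψ, c, hb, hdvd⟩ := h.exists_isBranch hG
  rw [interMult, hb.le_length_iff, hdvd F m hF]

lemma isTypeA_five {n m l : ℕ} (hG : G.IsHomogeneous n) (h : IsArc φ t G P) {F K : Form}
    (hF : F.IsHomogeneous m) (hK : K.IsHomogeneous l) (hFP : IsSmoothPoint F P)
    (hKP : eval P.rep K ≠ 0) (h3 : (Polynomial.X - Polynomial.C t) ^ 3 ∣ aeval φ F)
    (h4 : ¬ (Polynomial.X - Polynomial.C t) ^ 4 ∣ aeval φ F) : IsTypeA 5 (G * F * K) P := by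
  obtain ⟨ψ, c, hb, hdvd⟩ := h.exists_isBranch hG
  obtain ⟨u, v, w, huv, hw, heq⟩ := hb.exists_typeA_five (exists_lin_germ_ne_zero hF hFP)
    (isUnit_germ_of_eval_ne_zero hK hKP) ((hdvd F m hF 3).2 h3) (mt (hdvd F m hF 4).1 h4)
  refine ⟨u, v, w, huv, hw, ?_⟩
  rw [← heq]
  simp [germ]

end IsArc

lemma isTypeA_one {F G K : Form} {n m l : ℕ} (hF : F.IsHomogeneous n) (hG : G.IsHomogeneous m)
    (hK : K.IsHomogeneous l) {P : Plane} (hFP : eval P.rep F = 0) (hGP : eval P.rep G = 0)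
    (hKP : eval P.rep K ≠ 0)
    (h : ∃ i j, eval P.rep (pderiv i F) * eval P.rep (pderiv j G) ≠
      eval P.rep (pderiv j F) * eval P.rep (pderiv i G)) : IsTypeA 1 (F * G * K) P := by
  obtain ⟨u, v, w, huv, hw, heq⟩ := exists_typeA_one (isLocalCoordinates_germ hF hG hFP hGP h)
    (isUnit_germ_of_eval_ne_zero hK hKP)
  refine ⟨u, v, w, huv, hw, ?_⟩
  rw [← heq]
  simp [germ]

/-! ### Linear changes of coordinates -/

/-- The action of a matrix on triples of elements of a `ℂ`-algebra. -/
def act {A : Type*} [CommRing A] [Algebra ℂ A] (M : Matrix (Fin 3) (Fin 3) ℂ) (g : Fin 3 → A) :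
    Fin 3 → A := fun i => ∑ j, algebraMap ℂ A (M i j) * g j

lemma act_act {A : Type*} [CommRing A] [Algebra ℂ A] {M N : Matrix (Fin 3) (Fin 3) ℂ}
    (h : M * N = 1) (g : Fin 3 → A) : act M (act N g) = g := by
  ext i
  have h1 : ∀ k, ∑ j, M i j * N j k = (1 : Matrix (Fin 3) (Fin 3) ℂ) i k := fun k => by
    rw [← h, Matrix.mul_apply]
  simp only [act, Finset.mul_sum]
  rw [Finset.sum_comm]
  calc ∑ k, ∑ j, algebraMap ℂ A (M i j) * (algebraMap ℂ A (N j k) * g k)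
      = ∑ k, algebraMap ℂ A (∑ j, M i j * N j k) * g k := by
        refine Finset.sum_congr rfl fun k _ => ?_
        rw [map_sum, Finset.sum_mul]
        refine Finset.sum_congr rfl fun j _ => ?_
        rw [map_mul]
        ring
    _ = g i := by
        simp [h1, Matrix.one_apply]

/-- The form `F` in the coordinates given by the rows of `M`. -/
def pull (M : Matrix (Fin 3) (Fin 3) ℂ) : Form →ₐ[ℂ] Form := aeval (act M X)

lemma aeval_pull {A : Type*} [CommRing A] [Algebra ℂ A] (M : Matrix (Fin 3) (Fin 3) ℂ)
    (g : Fin 3 → A) (F : Form) : aeval g (pull M F) = aeval (act M g) F := by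
  have : (aeval g).comp (pull M) = aeval (R := ℂ) (act M g) := by
    apply algHom_ext
    intro l
    simp [pull, act, algebraMap_eq]
  exact DFunLike.congr_fun this F

lemma eval_pull (M : Matrix (Fin 3) (Fin 3) ℂ) (v : Fin 3 → ℂ) (F : Form) :
    eval v (pull M F) = eval (act M v) F := by
  simpa [aeval_eq_eval] using aeval_pull M v F

lemma pull_pull {M N : Matrix (Fin 3) (Fin 3) ℂ} (h : M * N = 1) (F : Form) :
    pull N (pull M F) = F := by
  have h1 := aeval_pull M (act N (X : Fin 3 → Form)) F
  rw [act_act h, aeval_X_left_apply] at h1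
  exact h1

lemma isHomogeneous_pull (M : Matrix (Fin 3) (Fin 3) ℂ) {F : Form} {n : ℕ}
    (hF : F.IsHomogeneous n) : (pull M F).IsHomogeneous n := by
  have h1 : ∀ i, (act M (X : Fin 3 → Form) i).IsHomogeneous 1 := fun i =>
    IsHomogeneous.sum Finset.univ _ 1 fun j _ => isHomogeneous_C_mul_X (M i j) j
  have h2 := hF.aeval (act M (X : Fin 3 → Form)) h1
  rwa [one_mul] at h2

lemma eval_pderiv_pull (M : Matrix (Fin 3) (Fin 3) ℂ) (v : Fin 3 → ℂ) (F : Form) (i : Fin 3) :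
    eval v (pderiv i (pull M F)) = ∑ l, eval (act M v) (pderiv l F) * M l i := by
  rw [pull, derivation_aeval, map_sum]
  refine Finset.sum_congr rfl fun l _ => ?_
  have h1 : pderiv i (act M X l : Form) = C (M l i) := by
    simp only [act, map_sum, Derivation.leibniz, pderiv_X, algebraMap_eq, pderiv_C]
    rw [Finset.sum_eq_single i]
    · simp
    · intro b _ hb
      simp [hb.symm]
    · simp
  have h2 := eval_pull M v (pderiv l F)
  rw [pull] at h2
  rw [map_mul, h1, eval_C, h2]

lemma exists_eval_pderiv_pull_ne_zero_iff {M N : Matrix (Fin 3) (Fin 3) ℂ} (h : M * N = 1)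
    (v : Fin 3 → ℂ) (F : Form) : (∃ i, eval v (pderiv i (pull M F)) ≠ 0) ↔
      ∃ i, eval (act M v) (pderiv i F) ≠ 0 := by
  constructor
  · contrapose!
    intro h0 i
    rw [eval_pderiv_pull]
    simp [h0]
  · contrapose!
    intro h0 i
    have h1 := eval_pderiv_pull N (act M v) (pull M F) i
    rw [pull_pull h, act_act (mul_eq_one_comm.1 h)] at h1
    rw [h1]
    simp [h0]

/-- Gradients transform by an invertible matrix, so if every minor of the transformed gradients
vanished, the original ones, which are combinations of these, would vanish too. -/
lemma exists_minor_pull_ne_zero {M N : Matrix (Fin 3) (Fin 3) ℂ} (h : M * N = 1)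
    (v : Fin 3 → ℂ) (F G : Form) (hm : ∃ i j, eval (act M v) (pderiv i F) *
      eval (act M v) (pderiv j G) ≠ eval (act M v) (pderiv j F) * eval (act M v) (pderiv i G)) :
    ∃ i j, eval v (pderiv i (pull M F)) * eval v (pderiv j (pull M G)) ≠
      eval v (pderiv j (pull M F)) * eval v (pderiv i (pull M G)) := by
  contrapose! hm
  intro i j
  have h1 := fun F i => eval_pderiv_pull N (act M v) (pull M F) i
  simp only [pull_pull h, act_act (mul_eq_one_comm.1 h)] at h1
  rw [h1, h1, h1, h1, Finset.sum_mul_sum, Finset.sum_mul_sum, Finset.sum_comm]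
  refine Finset.sum_congr rfl fun k _ => Finset.sum_congr rfl fun l _ => ?_
  linear_combination N l i * N k j * hm l k

lemma act_smul (M : Matrix (Fin 3) (Fin 3) ℂ) (c : ℂ) (v : Fin 3 → ℂ) :
    act M (c • v) = c • act M v := by
  ext i
  simp only [act, Pi.smul_apply, smul_eq_mul, Finset.mul_sum]
  refine Finset.sum_congr rfl fun j _ => ?_
  ring

lemma act_ne_zero {M N : Matrix (Fin 3) (Fin 3) ℂ} (h : M * N = 1) {v : Fin 3 → ℂ} (hv : v ≠ 0) :
    act M v ≠ 0 := by
  intro h0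
  apply hv
  rw [← act_act (mul_eq_one_comm.1 h) v, h0]
  ext i
  simp [act]

/-- Forms are pulled back by `M`, so arcs are carried by its inverse `N`; invertibility preserves
immersions and smooth points. -/
lemma isArc_pull {M N : Matrix (Fin 3) (Fin 3) ℂ} (h : M * N = 1) {φ : Fin 3 → Polynomial ℂ}
    {t : ℂ} {G : Form} {P : Plane} {lam : ℂ} (hlam : lam ≠ 0)
    (he : act M P.rep = lam • arcEval φ t)
    (himm : ∀ κ : ℂ, ∃ l, (φ l).derivative.eval t ≠ κ * arcEval φ t l) (h0 : aeval φ G = 0)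
    (hsm : ∃ l, eval (act M P.rep) (pderiv l G) ≠ 0) :
    IsArc (act N φ) t (pull M G) P := by
  have harc : arcEval (act N φ) t = act N (arcEval φ t) := by
    ext i
    simp [arcEval, act, Polynomial.eval_finsetSum, Polynomial.algebraMap_eq]
  have hder : (fun l => (act N φ l).derivative.eval t) =
      act N (fun l => (φ l).derivative.eval t) := by
    ext i
    simp [act, Polynomial.eval_finsetSum, Polynomial.algebraMap_eq]
  refine ⟨⟨lam⁻¹, inv_ne_zero hlam, ?_⟩, fun κ => ?_, ?_, ?_⟩
  · rw [harc, ← act_act (mul_eq_one_comm.1 h) P.rep, he, ← act_smul, smul_smul,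
      inv_mul_cancel₀ hlam, one_smul]
  · by_contra! hc
    obtain ⟨l, hl⟩ := himm κ
    apply hl
    have h1 : act N (fun l => (φ l).derivative.eval t) = act N (κ • arcEval φ t) := by
      rw [← hder, act_smul, ← harc]
      exact funext hc
    have h2 := congrArg (act M) h1
    rw [act_act h, act_act h] at h2
    exact congrFun h2 l
  · rw [aeval_pull, act_act h, h0]
  · exact (exists_eval_pderiv_pull_ne_zero_iff h _ _).2 hsm

lemma aeval_act_pull {M N : Matrix (Fin 3) (Fin 3) ℂ} (h : M * N = 1) {A : Type*} [CommRing A]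
    [Algebra ℂ A] (φ : Fin 3 → A) (F : Form) : aeval (act N φ) (pull M F) = aeval φ F := by
  rw [aeval_pull, act_act h]

/-- The point with given coordinates with respect to the rows of the inverse of `N`. -/
def point {M N : Matrix (Fin 3) (Fin 3) ℂ} (h : M * N = 1) (v : Fin 3 → ℂ) (hv : v ≠ 0) : Plane :=
  Projectivization.mk ℂ (act N v) (act_ne_zero (mul_eq_one_comm.1 h) hv)

lemma exists_act_rep_point {M N : Matrix (Fin 3) (Fin 3) ℂ} (h : M * N = 1) (v : Fin 3 → ℂ)
    (hv : v ≠ 0) : ∃ c : ℂ, c ≠ 0 ∧ act M (point h v hv).rep = c • v := by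
  obtain ⟨a, ha⟩ := Projectivization.exists_smul_eq_mk_rep ℂ (act N v)
    (act_ne_zero (mul_eq_one_comm.1 h) hv)
  refine ⟨a, a.ne_zero, ?_⟩
  rw [point, ← ha, Units.smul_def, act_smul, act_act h]

lemma eq_of_act_rep {M N : Matrix (Fin 3) (Fin 3) ℂ} (h : M * N = 1) {P Q : Plane} {v : Fin 3 → ℂ}
    {a b : ℂ} (hb : b ≠ 0) (hP : act M P.rep = a • v) (hQ : act M Q.rep = b • v) :
    P = Q := by
  rw [← P.mk_rep, ← Q.mk_rep, Projectivization.mk_eq_mk_iff']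
  refine ⟨a / b, ?_⟩
  rw [← act_act (mul_eq_one_comm.1 h) P.rep, ← act_act (mul_eq_one_comm.1 h) Q.rep, hP, hQ,
    ← act_smul, smul_smul, div_mul_cancel₀ _ hb]

/-! ### Quadratic forms -/

/-- The quadratic form with given coefficients. -/
def quad (a b c d e k : ℂ) : Form :=
  C a * X 0 ^ 2 + C b * (X 0 * X 1) + C c * (X 0 * X 2) + C d * X 1 ^ 2 + C e * (X 1 * X 2) +
    C k * X 2 ^ 2

section quad

variable (a b c d e k : ℂ)

lemma isHomogeneous_quad : (quad a b c d e k).IsHomogeneous 2 := by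
  have hX : ∀ i j : Fin 3, (X i * X j : Form).IsHomogeneous 2 := fun i j =>
    (isHomogeneous_X ℂ i).mul (isHomogeneous_X ℂ j)
  have hX2 : ∀ i : Fin 3, (X i ^ 2 : Form).IsHomogeneous 2 := fun i => by
    rw [pow_two]
    exact hX i i
  exact ((((((hX2 0).C_mul a).add ((hX 0 1).C_mul b)).add ((hX 0 2).C_mul c)).add
    ((hX2 1).C_mul d)).add ((hX 1 2).C_mul e)).add ((hX2 2).C_mul k)

lemma aeval_quad {A : Type*} [CommRing A] [Algebra ℂ A] (g : Fin 3 → A) :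
    aeval g (quad a b c d e k) = algebraMap ℂ A a * g 0 ^ 2 + algebraMap ℂ A b * (g 0 * g 1) +
      algebraMap ℂ A c * (g 0 * g 2) + algebraMap ℂ A d * g 1 ^ 2 +
      algebraMap ℂ A e * (g 1 * g 2) + algebraMap ℂ A k * g 2 ^ 2 := by
  simp [quad]

lemma eval_quad (v : Fin 3 → ℂ) :
    eval v (quad a b c d e k) = a * v 0 ^ 2 + b * (v 0 * v 1) + c * (v 0 * v 2) + d * v 1 ^ 2 +
      e * (v 1 * v 2) + k * v 2 ^ 2 := by
  simp [quad]

lemma pderiv_zero_quad :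
    pderiv 0 (quad a b c d e k) = 2 * C a * X 0 + C b * X 1 + C c * X 2 := by
  simp [quad, pderiv_X]
  ring

lemma pderiv_one_quad :
    pderiv 1 (quad a b c d e k) = C b * X 0 + 2 * C d * X 1 + C e * X 2 := by
  simp [quad, pderiv_X]
  ring

lemma pderiv_two_quad :
    pderiv 2 (quad a b c d e k) = C c * X 0 + C e * X 1 + 2 * C k * X 2 := by
  simp [quad, pderiv_X]
  ring

lemma eval_pderiv_zero_quad (v : Fin 3 → ℂ) :
    eval v (pderiv 0 (quad a b c d e k)) = 2 * a * v 0 + b * v 1 + c * v 2 := by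
  simp [pderiv_zero_quad]

lemma eval_pderiv_one_quad (v : Fin 3 → ℂ) :
    eval v (pderiv 1 (quad a b c d e k)) = b * v 0 + 2 * d * v 1 + e * v 2 := by
  simp [pderiv_one_quad]

lemma eval_pderiv_two_quad (v : Fin 3 → ℂ) :
    eval v (pderiv 2 (quad a b c d e k)) = c * v 0 + e * v 1 + 2 * k * v 2 := by
  simp [pderiv_two_quad]

end quad

lemma exists_eq_C_of_isHomogeneous_zero {F : Form} (hF : F.IsHomogeneous 0) : ∃ c, F = C c :=
  ⟨_, totalDegree_eq_zero_iff_eq_C.1 ((totalDegree_zero_iff_isHomogeneous _).2 hF)⟩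

lemma exists_eq_of_isHomogeneous_one {F : Form} (hF : F.IsHomogeneous 1) :
    ∃ a b c : ℂ, F = C a * X 0 + C b * X 1 + C c * X 2 := by
  obtain ⟨a, ha⟩ := exists_eq_C_of_isHomogeneous_zero (hF.pderiv (i := 0))
  obtain ⟨b, hb⟩ := exists_eq_C_of_isHomogeneous_zero (hF.pderiv (i := 1))
  obtain ⟨c, hc⟩ := exists_eq_C_of_isHomogeneous_zero (hF.pderiv (i := 2))
  refine ⟨a, b, c, ?_⟩
  have := hF.sum_X_mul_pderiv
  rw [Fin.sum_univ_three, ha, hb, hc, one_smul] at this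
  rw [← this]
  ring

/-- Euler's relation 2F = Σ xᵢ ∂ᵢF reduces the claim to the linear forms ∂ᵢF. -/
lemma exists_eq_quad {F : Form} (hF : F.IsHomogeneous 2) :
    ∃ a b c d e k : ℂ, F = quad a b c d e k := by
  obtain ⟨a, b, c, h0⟩ := exists_eq_of_isHomogeneous_one (hF.pderiv (i := 0))
  obtain ⟨a', b', c', h1⟩ := exists_eq_of_isHomogeneous_one (hF.pderiv (i := 1))
  obtain ⟨a'', b'', c'', h2⟩ := exists_eq_of_isHomogeneous_one (hF.pderiv (i := 2))
  refine ⟨a * (1 / 2), (b + a') * (1 / 2), (c + a'') * (1 / 2), b' * (1 / 2), (c' + b'') * (1 / 2),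
    c'' * (1 / 2), ?_⟩
  have h3 := hF.sum_X_mul_pderiv
  rw [Fin.sum_univ_three, h0, h1, h2] at h3
  have hhalf : (C (1 / 2 : ℂ) : Form) * 2 = 1 := by
    rw [show (2 : Form) = C (2 : ℂ) from (map_ofNat C 2).symm, ← C_mul]
    norm_num
  have h4 : F = C (1 / 2 : ℂ) * (2 • F) := by
    rw [two_smul]
    linear_combination (-F) * hhalf
  rw [h4, ← h3, quad]
  simp only [C_mul, C_add]
  ring

lemma pull_ne_zero {M N : Matrix (Fin 3) (Fin 3) ℂ} (h : M * N = 1) {F : Form} (hF : F ≠ 0) :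
    pull M F ≠ 0 := by
  intro h0
  apply hF
  rw [← pull_pull h F, h0, map_zero]

/-! ### Irreducibility -/

lemma exists_eq_of_totalDegree_le_one {F : Form} (hF : F.totalDegree ≤ 1) :
    ∃ k a b c : ℂ, F = C k + (C a * X 0 + C b * X 1 + C c * X 2) := by
  obtain ⟨k, hk⟩ := exists_eq_C_of_isHomogeneous_zero (homogeneousComponent_isHomogeneous 0 F)
  obtain ⟨a, b, c, habc⟩ :=
    exists_eq_of_isHomogeneous_one (homogeneousComponent_isHomogeneous 1 F)
  refine ⟨k, a, b, c, ?_⟩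
  rw [← hk, ← habc]
  have h1 : ∑ i ∈ Finset.range 2, homogeneousComponent i F = F := by
    conv_rhs => rw [← sum_homogeneousComponent F]
    symm
    apply Finset.sum_subset
    · intro i hi
      simp only [Finset.mem_range] at hi ⊢
      omega
    · intro i _ hi
      apply homogeneousComponent_eq_zero
      simp only [Finset.mem_range] at hi
      omega
  simpa [Finset.sum_range_succ] using h1.symm

lemma exists_common_zero (a b c a' b' c' : ℂ) :
    ∃ v : Fin 3 → ℂ, v ≠ 0 ∧ a * v 0 + b * v 1 + c * v 2 = 0 ∧
      a' * v 0 + b' * v 1 + c' * v 2 = 0 := by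
  let L : (Fin 3 → ℂ) →ₗ[ℂ] (Fin 2 → ℂ) := Matrix.toLin' !![a, b, c; a', b', c']
  have hL : LinearMap.ker L ≠ ⊥ := LinearMap.ker_ne_bot_of_finrank_lt (by simp)
  obtain ⟨v, hv, hv0⟩ := (Submodule.ne_bot_iff _).1 hL
  refine ⟨v, hv0, ?_, ?_⟩
  · have := congrFun (LinearMap.mem_ker.1 hv) 0
    simpa [L, Matrix.mulVec, dotProduct, Fin.sum_univ_three] using this
  · have := congrFun (LinearMap.mem_ker.1 hv) 1
    simpa [L, Matrix.mulVec, dotProduct, Fin.sum_univ_three] using this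

lemma isUnit_of_totalDegree_eq_zero {F : Form} (hF : F ≠ 0) (h : F.totalDegree = 0) :
    IsUnit F := by
  rw [totalDegree_eq_zero_iff_eq_C] at h
  rw [h] at hF ⊢
  exact (isUnit_iff_ne_zero.2 (by simpa using hF)).map C

/-- A smooth conic is irreducible. -/
lemma isConic_of_smooth {F : Form} (hF : F.IsHomogeneous 2)
    (hsm : ∀ v : Fin 3 → ℂ, v ≠ 0 → ∃ i, eval v (pderiv i F) ≠ 0) : IsConic F := by
  have hF0 : F ≠ 0 := by
    rintro rfl
    obtain ⟨i, hi⟩ := hsm ![1, 0, 0] (fun h => by simpa using congrFun h 0)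
    simp at hi
  have hdeg := hF.totalDegree hF0
  refine ⟨hF, fun hu => ?_, fun G H hGH => ?_⟩
  · obtain ⟨c, hc, hcF⟩ := MvPolynomial.isUnit_iff_eq_C_of_isReduced.1 hu
    rw [hcF] at hdeg
    simp at hdeg
  · by_contra! hcon
    have hG0 : G ≠ 0 := by rintro rfl; simp [hF0] at hGH
    have hH0 : H ≠ 0 := by rintro rfl; simp [hF0] at hGH
    have hGd : G.totalDegree ≠ 0 := fun h => hcon.1 (isUnit_of_totalDegree_eq_zero hG0 h)
    have hHd : H.totalDegree ≠ 0 := fun h => hcon.2 (isUnit_of_totalDegree_eq_zero hH0 h)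
    have hsum := totalDegree_mul_of_isDomain hG0 hH0
    rw [← hGH, hdeg] at hsum
    obtain ⟨k, a, b, c, hG⟩ := exists_eq_of_totalDegree_le_one (F := G) (by omega)
    obtain ⟨k', a', b', c', hH⟩ := exists_eq_of_totalDegree_le_one (F := H) (by omega)
    obtain ⟨v, hv0, hv1, hv2⟩ := exists_common_zero a b c a' b' c'
    obtain ⟨i, hi⟩ := hsm v hv0
    apply hi
    -- The factors may have constant terms. Since the linear parts vanish at `v`, each factor has
    -- the same value at `v` as at the origin, so the gradient of the product at `v` equals the one
    -- at the origin, which is zero.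
    have h0 : eval ((0 : ℂ) • v) (pderiv i F) = 0 := by
      rw [eval_smul_of_isHomogeneous hF.pderiv]
      simp
    rw [← h0, hGH, hG, hH]
    simp only [Derivation.leibniz, map_add, map_mul, pderiv_C, pderiv_X, smul_eq_mul, eval_X,
      eval_C, Pi.smul_apply]
    fin_cases i <;> simp
    · linear_combination a' * hv1 + a * hv2
    · linear_combination b' * hv1 + b * hv2
    · linear_combination c' * hv1 + c * hv2

/-! ### Divisibility by powers of a linear factor -/

lemma pow_three_dvd_iff (p : Polynomial ℂ) (r : ℂ) :
    (Polynomial.X - Polynomial.C r) ^ 3 ∣ p ↔ p.eval r = 0 ∧ p.derivative.eval r = 0 ∧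
      p.derivative.derivative.eval r = 0 := by
  by_cases hp : p = 0
  · simp [hp]
  rw [← Polynomial.le_rootMultiplicity_iff hp, Nat.succ_le_iff,
    Polynomial.lt_rootMultiplicity_iff_isRoot_iterate_derivative hp]
  constructor
  · intro h
    exact ⟨h 0 (by norm_num), h 1 (by norm_num), h 2 (by norm_num)⟩
  · rintro ⟨h0, h1, h2⟩ m hm
    interval_cases m
    · exact h0
    · exact h1
    · exact h2

/-! ### The three conics in normal form -/

/-- The conic `c (u² - v w)`. -/
def conicF (c : ℂ) : Form := quad c 0 0 0 (-c) 0

/-- The conic `c (u² - v w + u v + δ v²)`. -/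
def conicG (c δ : ℂ) : Form := quad c c 0 (c * δ) (-c) 0

/-- The conic `A (u² - v w) + B u w + K w²`. -/
def conicH (A B K : ℂ) : Form := quad A 0 B 0 (-A) K

lemma smooth_conicF {c : ℂ} (hc : c ≠ 0) (v : Fin 3 → ℂ) (hv : v ≠ 0) :
    ∃ i, eval v (pderiv i (conicF c)) ≠ 0 := by
  by_contra! h
  apply hv
  have h0 := h 0
  have h1 := h 1
  have h2 := h 2
  rw [conicF, eval_pderiv_zero_quad] at h0
  rw [conicF, eval_pderiv_one_quad] at h1
  rw [conicF, eval_pderiv_two_quad] at h2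
  simp [hc] at h0 h1 h2
  ext i
  fin_cases i <;> assumption

lemma smooth_conicG {c : ℂ} (hc : c ≠ 0) (δ : ℂ) (v : Fin 3 → ℂ) (hv : v ≠ 0) :
    ∃ i, eval v (pderiv i (conicG c δ)) ≠ 0 := by
  by_contra! h
  apply hv
  have h0 := h 0
  have h1 := h 1
  have h2 := h 2
  rw [conicG, eval_pderiv_zero_quad] at h0
  rw [conicG, eval_pderiv_one_quad] at h1
  rw [conicG, eval_pderiv_two_quad] at h2
  simp [hc] at h2
  simp [hc, h2] at h0
  simp [hc, h2, h0] at h1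
  ext i
  fin_cases i <;> assumption

lemma smooth_conicH {A : ℂ} (hA : A ≠ 0) (B K : ℂ) (v : Fin 3 → ℂ) (hv : v ≠ 0) :
    ∃ i, eval v (pderiv i (conicH A B K)) ≠ 0 := by
  by_contra! h
  apply hv
  have h0 := h 0
  have h1 := h 1
  have h2 := h 2
  rw [conicH, eval_pderiv_zero_quad] at h0
  rw [conicH, eval_pderiv_one_quad] at h1
  rw [conicH, eval_pderiv_two_quad] at h2
  simp [hA] at h1
  simp [hA, h1] at h0
  simp [hA, h1, h0] at h2
  ext i
  fin_cases i <;> assumption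

/-- Parametrization of `conicF`. -/
def arcF : Fin 3 → Polynomial ℂ := ![Polynomial.X, 1, Polynomial.X ^ 2]

/-- Parametrization of `conicF` near the point `(0 : 0 : 1)`. -/
def arcF' : Fin 3 → Polynomial ℂ := ![Polynomial.X, Polynomial.X ^ 2, 1]

/-- Parametrization of `conicG`. -/
def arcG (δ : ℂ) : Fin 3 → Polynomial ℂ :=
  ![Polynomial.X, 1, Polynomial.X ^ 2 + Polynomial.X + Polynomial.C δ]

/-- Parametrization of `conicG` near the point `(0 : 0 : 1)`. -/
def arcG' (δ : ℂ) : Fin 3 → Polynomial ℂ :=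
  ![Polynomial.X, Polynomial.X ^ 2, 1 + Polynomial.X + Polynomial.C δ * Polynomial.X ^ 2]

lemma arcEval_arcF (t : ℂ) : arcEval arcF t = ![t, 1, t ^ 2] := by
  ext i
  fin_cases i <;> simp [arcEval, arcF]

lemma arcEval_arcF' (t : ℂ) : arcEval arcF' t = ![t, t ^ 2, 1] := by
  ext i
  fin_cases i <;> simp [arcEval, arcF']

lemma arcEval_arcG (δ t : ℂ) : arcEval (arcG δ) t = ![t, 1, t ^ 2 + t + δ] := by
  ext i
  fin_cases i <;> simp [arcEval, arcG]

lemma arcEval_arcG' (δ t : ℂ) : arcEval (arcG' δ) t = ![t, t ^ 2, 1 + t + δ * t ^ 2] := by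
  ext i
  fin_cases i <;> simp [arcEval, arcG']

section frame

variable {M N : Matrix (Fin 3) (Fin 3) ℂ} (hMN : M * N = 1)

include hMN

lemma smooth_pull {F : Form} (hF : ∀ v : Fin 3 → ℂ, v ≠ 0 → ∃ i, eval v (pderiv i F) ≠ 0)
    (v : Fin 3 → ℂ) (hv : v ≠ 0) : ∃ i, eval v (pderiv i (pull M F)) ≠ 0 :=
  (exists_eval_pderiv_pull_ne_zero_iff hMN v F).2 (hF _ (act_ne_zero hMN hv))

lemma isConic_pull {F : Form} (hF2 : F.IsHomogeneous 2)
    (hF : ∀ v : Fin 3 → ℂ, v ≠ 0 → ∃ i, eval v (pderiv i F) ≠ 0) : IsConic (pull M F) :=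
  isConic_of_smooth (isHomogeneous_pull M hF2) (smooth_pull hMN hF)

lemma isArc_arcF {c : ℂ} (hc : c ≠ 0) {P : Plane} {lam t : ℂ} (hlam : lam ≠ 0)
    (hP : act M P.rep = lam • ![t, 1, t ^ 2]) :
    IsArc (act N arcF) t (pull M (conicF c)) P := by
  refine isArc_pull hMN hlam (by rw [arcEval_arcF, hP]) (fun κ => ?_) ?_
    (smooth_conicF hc _ (act_ne_zero hMN P.rep_nonzero))
  · by_contra! h
    have h0 := h 0
    have h1 := h 1
    rw [arcEval_arcF] at h0 h1
    simp [arcF] at h0 h1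
    simp [← h1] at h0
  · rw [conicF, aeval_quad]
    simp [arcF]

lemma isArc_arcF' {c : ℂ} (hc : c ≠ 0) {P : Plane} {lam : ℂ} (hlam : lam ≠ 0)
    (hP : act M P.rep = lam • ![0, 0, 1]) :
    IsArc (act N arcF') 0 (pull M (conicF c)) P := by
  refine isArc_pull hMN hlam (by rw [arcEval_arcF', hP]; simp) (fun κ => ⟨0, ?_⟩) ?_
    (smooth_conicF hc _ (act_ne_zero hMN P.rep_nonzero))
  · rw [arcEval_arcF']
    simp [arcF']
  · rw [conicF, aeval_quad]
    simp [arcF']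

lemma isArc_arcG {c : ℂ} (hc : c ≠ 0) {P : Plane} {δ lam t : ℂ} (hlam : lam ≠ 0)
    (hP : act M P.rep = lam • ![t, 1, t ^ 2 + t + δ]) :
    IsArc (act N (arcG δ)) t (pull M (conicG c δ)) P := by
  refine isArc_pull hMN hlam (by rw [arcEval_arcG, hP]) (fun κ => ?_) ?_
    (smooth_conicG hc δ _ (act_ne_zero hMN P.rep_nonzero))
  · by_contra! h
    have h0 := h 0
    have h1 := h 1
    rw [arcEval_arcG] at h0 h1
    simp [arcG] at h0 h1
    simp [← h1] at h0
  · rw [conicG, aeval_quad]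
    simp [arcG, Polynomial.algebraMap_eq]
    ring

lemma isArc_arcG' {c : ℂ} (hc : c ≠ 0) {P : Plane} {δ lam : ℂ} (hlam : lam ≠ 0)
    (hP : act M P.rep = lam • ![0, 0, 1]) :
    IsArc (act N (arcG' δ)) 0 (pull M (conicG c δ)) P := by
  refine isArc_pull hMN hlam (by rw [arcEval_arcG', hP]; simp) (fun κ => ⟨0, ?_⟩) ?_
    (smooth_conicG hc δ _ (act_ne_zero hMN P.rep_nonzero))
  · rw [arcEval_arcG']
    simp [arcG']
  · rw [conicG, aeval_quad]
    simp [arcG', Polynomial.algebraMap_eq]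
    ring

end frame

/-! ### Singular points of a union of three smooth curves -/

/-- At a point of only one component, the gradient of the product is a non-zero multiple of the
gradient of that component. -/
lemma singular_mul_iff {F G H : Form} {v : Fin 3 → ℂ}
    (hF : ∃ i, eval v (pderiv i F) ≠ 0) (hG : ∃ i, eval v (pderiv i G) ≠ 0)
    (hH : ∃ i, eval v (pderiv i H) ≠ 0) :
    (eval v (F * G * H) = 0 ∧ ∀ i, eval v (pderiv i (F * G * H)) = 0) ↔
      (eval v F = 0 ∧ eval v G = 0) ∨
      (eval v F = 0 ∧ eval v H = 0) ∨ (eval v G = 0 ∧ eval v H = 0) := by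
  have hd : ∀ i, eval v (pderiv i (F * G * H)) =
      eval v F * eval v G * eval v (pderiv i H) + eval v H *
        (eval v F * eval v (pderiv i G) + eval v G * eval v (pderiv i F)) := by
    intro i
    simp only [Derivation.leibniz, smul_eq_mul, map_add, map_mul]
  simp only [hd, map_mul]
  obtain ⟨i, hi⟩ := hF
  obtain ⟨j, hj⟩ := hG
  obtain ⟨k, hk⟩ := hH
  constructor
  · rintro ⟨h0, h1⟩
    by_cases hF0 : eval v F = 0
    · have := h1 i
      simp [hF0, hi] at this
      tauto
    by_cases hG0 : eval v G = 0
    · have := h1 j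
      simp [hF0, hG0, hj] at this
      tauto
    · have hH0 : eval v H = 0 := by simpa [hF0, hG0] using h0
      have := h1 k
      simp [hF0, hG0, hH0, hk] at this
  · rintro (⟨h1, h2⟩ | ⟨h1, h2⟩ | ⟨h1, h2⟩) <;> simp [h1, h2]

lemma isSingularPoint_mul_iff {F G H : Form} {P : Plane}
    (hF : ∃ i, eval P.rep (pderiv i F) ≠ 0) (hG : ∃ i, eval P.rep (pderiv i G) ≠ 0)
    (hH : ∃ i, eval P.rep (pderiv i H) ≠ 0) :
    IsSingularPoint (F * G * H) P ↔ (eval P.rep F = 0 ∧ eval P.rep G = 0) ∨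
      (eval P.rep F = 0 ∧ eval P.rep H = 0) ∨ (eval P.rep G = 0 ∧ eval P.rep H = 0) :=
  singular_mul_iff hF hG hH

/-! ### Conics in osculating position -/

/-- The condition that `conicH A B K` meets the conic `conicG c δ` with intersection number at
least `3` at the point with parameter `r`. -/
structure IsOsculating (δ r A B K : ℂ) : Prop where
  value : -A * (r + δ) + B * (r * (r ^ 2 + r + δ)) + K * (r ^ 2 + r + δ) ^ 2 = 0
  slope : -A + B * ((r ^ 2 + r + δ) + r * (2 * r + 1)) +
    2 * K * (r ^ 2 + r + δ) * (2 * r + 1) = 0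
  curvature : B * (3 * r + 1) + K * (6 * r ^ 2 + 6 * r + 1 + 2 * δ) = 0

/-- The restriction of `conicH A B K` to `conicG c δ`. -/
def restr (δ A B K : ℂ) : Polynomial ℂ :=
  -Polynomial.C A * (Polynomial.X + Polynomial.C δ) +
    Polynomial.C B * (Polynomial.X * (Polynomial.X ^ 2 + Polynomial.X + Polynomial.C δ)) +
    Polynomial.C K * (Polynomial.X ^ 2 + Polynomial.X + Polynomial.C δ) ^ 2

lemma aeval_arcG_conicH (δ A B K : ℂ) : aeval (arcG δ) (conicH A B K) = restr δ A B K := by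
  rw [conicH, aeval_quad, restr]
  simp [arcG, Polynomial.algebraMap_eq]
  ring

lemma isOsculating_iff (δ r A B K : ℂ) :
    (Polynomial.X - Polynomial.C r) ^ 3 ∣ restr δ A B K ↔ IsOsculating δ r A B K := by
  rw [pow_three_dvd_iff]
  constructor
  · rintro ⟨h0, h1, h2⟩
    simp [restr, pow_two] at h0 h1 h2
    exact ⟨by linear_combination h0, by linear_combination h1, by linear_combination h2 / 2⟩
  · rintro ⟨h0, h1, h2⟩
    simp [restr, pow_two]
    exact ⟨by linear_combination h0, by linear_combination h1, by linear_combination 2 * h2⟩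

/-- Taylor expansion at `r` with its first three terms removed. The linear cofactor locates the
fourth intersection point of the two conics. -/
lemma IsOsculating.restr_eq {δ r A B K : ℂ} (h : IsOsculating δ r A B K) :
    restr δ A B K = (Polynomial.X - Polynomial.C r) ^ 3 *
      (Polynomial.C K * Polynomial.X + Polynomial.C ((3 * r + 2) * K + B)) := by
  apply Polynomial.funext
  intro t
  simp [restr]
  linear_combination h.value + (t - r) * h.slope + (t - r) ^ 2 * h.curvature

/-- An osculating conic in general position. -/
structure IsGeneralOsculating (δ r A B K : ℂ) : Prop extends IsOsculating δ r A B K where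
  -- Geometric meaning, with F, G, H the three conics in normal form: `δ_ne` keeps G away from P₂;
  -- `A_ne` makes H smooth; `B_ne` makes the contact of F and H at P₂ exactly 3; `K_ne` keeps H away
  -- from P₁; `r_ne` gives uniqueness of H; `no_triple_point` keeps H off the fourth point of F ∩ G;
  -- `exact_contact` separates the fourth point of G ∩ H from the osculation point.
  δ_ne : δ ≠ 0
  A_ne : A ≠ 0
  B_ne : B ≠ 0
  K_ne : K ≠ 0
  r_ne : 3 * r + 1 ≠ 0
  no_triple_point : B - K * δ ≠ 0
  exact_contact : 2 * (2 * r + 1) * K + B ≠ 0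

/-! ### The singularities of the three conics -/

lemma isHomogeneous_conicF (c : ℂ) : (conicF c).IsHomogeneous 2 := isHomogeneous_quad ..

lemma isHomogeneous_conicG (c δ : ℂ) : (conicG c δ).IsHomogeneous 2 := isHomogeneous_quad ..

lemma isHomogeneous_conicH (A B K : ℂ) : (conicH A B K).IsHomogeneous 2 := isHomogeneous_quad ..

/-- `P` has the homogeneous coordinates `v` with respect to the rows of `M`. -/
def HasCoords (M : Matrix (Fin 3) (Fin 3) ℂ) (P : Plane) (v : Fin 3 → ℂ) : Prop :=
  ∃ a : ℂ, a ≠ 0 ∧ act M P.rep = a • v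

namespace HasCoords

variable {M N : Matrix (Fin 3) (Fin 3) ℂ} {P Q : Plane} {v w : Fin 3 → ℂ}

lemma eval_eq_zero_iff (h : HasCoords M P v) {F : Form} {n : ℕ} (hF : F.IsHomogeneous n) :
    eval P.rep (pull M F) = 0 ↔ eval v F = 0 := by
  obtain ⟨a, ha, hv⟩ := h
  rw [eval_pull, hv, eval_smul_of_isHomogeneous hF]
  simp [ha]

lemma minor_ne_zero (hMN : M * N = 1) (h : HasCoords M P v) {F G : Form} {m n : ℕ}
    (hF : F.IsHomogeneous m) (hG : G.IsHomogeneous n) (i j : Fin 3)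
    (hm : eval v (pderiv i F) * eval v (pderiv j G) ≠ eval v (pderiv j F) * eval v (pderiv i G)) :
    ∃ i j, eval P.rep (pderiv i (pull M F)) * eval P.rep (pderiv j (pull M G)) ≠
      eval P.rep (pderiv j (pull M F)) * eval P.rep (pderiv i (pull M G)) := by
  obtain ⟨a, ha, hv⟩ := h
  apply exists_minor_pull_ne_zero hMN
  refine ⟨i, j, ?_⟩
  simp only [hv, eval_smul_of_isHomogeneous hF.pderiv, eval_smul_of_isHomogeneous hG.pderiv]
  intro h0
  apply hm
  have h1 : a ^ (m - 1) * a ^ (n - 1) ≠ 0 := mul_ne_zero (pow_ne_zero _ ha) (pow_ne_zero _ ha)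
  apply mul_left_cancel₀ h1
  linear_combination h0

lemma eq (hMN : M * N = 1) (hP : HasCoords M P v) (hQ : HasCoords M Q v) : P = Q := by
  obtain ⟨a, ha, hP⟩ := hP
  obtain ⟨b, hb, hQ⟩ := hQ
  exact eq_of_act_rep hMN hb hP hQ

lemma exists_eq_smul (hP : HasCoords M P v) (hQ : HasCoords M P w) : ∃ c : ℂ, v = c • w := by
  obtain ⟨a, ha, hP⟩ := hP
  obtain ⟨b, hb, hQ⟩ := hQ
  refine ⟨a⁻¹ * b, ?_⟩
  rw [mul_smul, ← hQ, hP, smul_smul, inv_mul_cancel₀ ha, one_smul]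

end HasCoords

lemma hasCoords_point {M N : Matrix (Fin 3) (Fin 3) ℂ} (h : M * N = 1) (v : Fin 3 → ℂ)
    (hv : v ≠ 0) : HasCoords M (point h v hv) v := exists_act_rep_point h v hv

lemma hasCoords_of_act_eq {M N : Matrix (Fin 3) (Fin 3) ℂ} (h : M * N = 1) {P : Plane}
    {v : Fin 3 → ℂ} {a : ℂ} (hP : act M P.rep = a • v) : HasCoords M P v := by
  refine ⟨a, ?_, hP⟩
  rintro rfl
  rw [zero_smul] at hP
  exact act_ne_zero h P.rep_nonzero hP

lemma eval_conicF (c : ℂ) (v : Fin 3 → ℂ) :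
    eval v (conicF c) = c * (v 0 ^ 2 - v 1 * v 2) := by
  rw [conicF, eval_quad]
  ring

lemma eval_conicG (c δ : ℂ) (v : Fin 3 → ℂ) :
    eval v (conicG c δ) = c * (v 0 ^ 2 - v 1 * v 2 + v 0 * v 1 + δ * v 1 ^ 2) := by
  rw [conicG, eval_quad]
  ring

lemma eval_conicH (A B K : ℂ) (v : Fin 3 → ℂ) :
    eval v (conicH A B K) = A * (v 0 ^ 2 - v 1 * v 2) + B * (v 0 * v 2) + K * v 2 ^ 2 := by
  rw [conicH, eval_quad]
  ring

section intersections

variable {M N : Matrix (Fin 3) (Fin 3) ℂ} (hMN : M * N = 1) {P : Plane}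

include hMN

lemma hasCoords_of_apply {x y z : ℂ} (a : ℂ) (h0 : act M P.rep 0 = a * x)
    (h1 : act M P.rep 1 = a * y) (h2 : act M P.rep 2 = a * z) : HasCoords M P ![x, y, z] := by
  refine hasCoords_of_act_eq hMN (a := a) ?_
  ext i
  fin_cases i
  · simpa using h0
  · simpa using h1
  · simpa using h2

/-- Subtracting the normalized equations leaves v(u + δv) = 0. -/
lemma hasCoords_of_mem_F_of_mem_G {c c' δ : ℂ} (hc : c ≠ 0) (hc' : c' ≠ 0)
    (hF : eval P.rep (pull M (conicF c)) = 0) (hG : eval P.rep (pull M (conicG c' δ)) = 0) :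
    HasCoords M P ![0, 0, 1] ∨ HasCoords M P ![-δ, 1, δ ^ 2] := by
  rw [eval_pull, eval_conicF] at hF
  rw [eval_pull, eval_conicG] at hG
  simp only [mul_eq_zero, hc, hc', false_or] at hF hG
  by_cases h : act M P.rep 1 = 0
  · left
    rw [h] at hF
    have h0 : act M P.rep 0 = 0 := by simpa using hF
    exact hasCoords_of_apply hMN (act M P.rep 2) (by simp [h0]) (by simp [h]) (by simp)
  · right
    have h0 : act M P.rep 0 = act M P.rep 1 * -δ := by
      apply mul_left_cancel₀ h
      linear_combination hG - hF
    refine hasCoords_of_apply hMN (act M P.rep 1) h0 (by simp) ?_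
    apply mul_left_cancel₀ h
    linear_combination -hF + (act M P.rep 0 - act M P.rep 1 * δ) * h0

/-- Subtracting A(u² − vw) leaves w(Bu + Kw) = 0. -/
lemma hasCoords_of_mem_F_of_mem_H {c A B K : ℂ} (hc : c ≠ 0) (hK : K ≠ 0)
    (hF : eval P.rep (pull M (conicF c)) = 0) (hH : eval P.rep (pull M (conicH A B K)) = 0) :
    HasCoords M P ![0, 1, 0] ∨ HasCoords M P ![-(B / K), 1, (-(B / K)) ^ 2] := by
  rw [eval_pull, eval_conicF] at hF
  rw [eval_pull, eval_conicH] at hH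
  simp only [mul_eq_zero, hc, false_or] at hF
  by_cases h : act M P.rep 2 = 0
  · left
    rw [h] at hF
    have h0 : act M P.rep 0 = 0 := by simpa using hF
    exact hasCoords_of_apply hMN (act M P.rep 1) (by simp [h0]) (by simp) (by simp [h])
  · right
    have h2 : act M P.rep 2 = act M P.rep 0 * -(B / K) := by
      have h3 : K * act M P.rep 2 + B * act M P.rep 0 = 0 := by
        apply mul_left_cancel₀ h
        linear_combination hH - A * hF
      field_simp
      linear_combination h3
    have hu : act M P.rep 0 ≠ 0 := by
      intro h0
      rw [h0, zero_mul] at h2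
      exact h h2
    have h0 : act M P.rep 0 = act M P.rep 1 * -(B / K) := by
      apply mul_left_cancel₀ hu
      linear_combination hF + act M P.rep 1 * h2
    refine hasCoords_of_apply hMN (act M P.rep 1) h0 (by simp) ?_
    linear_combination h2 - B / K * h0

/-- On the line v = 0 the equation reads u² = 0, so (0:0:1) is the only point missed by the
parametrization `arcG`. -/
lemma hasCoords_of_mem_G {c δ : ℂ} (hc : c ≠ 0)
    (hG : eval P.rep (pull M (conicG c δ)) = 0) :
    HasCoords M P ![0, 0, 1] ∨ ∃ t, HasCoords M P ![t, 1, t ^ 2 + t + δ] := by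
  rw [eval_pull, eval_conicG] at hG
  simp only [mul_eq_zero, hc, false_or] at hG
  by_cases h : act M P.rep 1 = 0
  · left
    rw [h] at hG
    have h0 : act M P.rep 0 = 0 := by simpa using hG
    exact hasCoords_of_apply hMN (act M P.rep 2) (by simp [h0]) (by simp [h]) (by simp)
  · right
    refine ⟨act M P.rep 0 / act M P.rep 1, hasCoords_of_apply hMN (act M P.rep 1) ?_ (by simp) ?_⟩
    · field_simp
    · field_simp
      linear_combination -hG

lemma hasCoords_of_mem_G_of_mem_H {c δ r A B K : ℂ} (hc : c ≠ 0) (hK : K ≠ 0)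
    (h : IsOsculating δ r A B K) (hG : eval P.rep (pull M (conicG c δ)) = 0)
    (hH : eval P.rep (pull M (conicH A B K)) = 0) :
    HasCoords M P ![r, 1, r ^ 2 + r + δ] ∨
      ∃ t, t = -(3 * r + 2) - B / K ∧ HasCoords M P ![t, 1, t ^ 2 + t + δ] := by
  rcases hasCoords_of_mem_G hMN hc hG with hP | ⟨t, hP⟩
  · rw [hP.eval_eq_zero_iff (isHomogeneous_conicH A B K), eval_conicH] at hH
    simp [hK] at hH
  · have h1 := hP.eval_eq_zero_iff (isHomogeneous_conicH A B K)
    rw [← arcEval_arcG, ← eval_aeval, aeval_arcG_conicH, h.restr_eq] at h1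
    have h2 := h1.1 hH
    simp only [Polynomial.eval_mul, Polynomial.eval_pow, Polynomial.eval_sub, Polynomial.eval_X,
      Polynomial.eval_C, Polynomial.eval_add, mul_eq_zero, pow_eq_zero_iff', sub_eq_zero] at h2
    rcases h2 with h2 | h2
    · left
      rwa [← h2.1]
    · right
      refine ⟨t, ?_, hP⟩
      field_simp
      linear_combination h2

end intersections

/-- The singularities of the union of the conics `conicF`, `conicG` and an osculating conic
`conicH` in general position. -/
theorem hasSingularities {M N : Matrix (Fin 3) (Fin 3) ℂ} (hMN : M * N = 1)
    {c c' δ r A B K : ℂ} (hc : c ≠ 0) (hc' : c' ≠ 0) (h : IsGeneralOsculating δ r A B K)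
    {p₁ p₂ q : Plane} (h₁ : HasCoords M p₁ ![0, 0, 1]) (h₂ : HasCoords M p₂ ![0, 1, 0])
    (hq : HasCoords M q ![r, 1, r ^ 2 + r + δ]) :
    HasSingularities3A5And3A1
      (pull M (conicF c) * pull M (conicG c' δ) * pull M (conicH A B K)) {p₁, p₂, q} := by
  have hδ := h.δ_ne
  have hA := h.A_ne
  have hB := h.B_ne
  have hK := h.K_ne
  have hF2 := isHomogeneous_conicF c
  have hG2 := isHomogeneous_conicG c' δ
  have hH2 := isHomogeneous_conicH A B K
  have hF2' := isHomogeneous_pull M hF2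
  have hG2' := isHomogeneous_pull M hG2
  have hH2' := isHomogeneous_pull M hH2
  -- `s` and `t` are the parameters of the transversal intersections of H with F and with G: the
  -- roots of the linear factors left after the triple zeros.
  obtain ⟨s, hs⟩ : ∃ s, s = -(B / K) := ⟨_, rfl⟩
  obtain ⟨t, ht⟩ : ∃ t, t = -(3 * r + 2) - B / K := ⟨_, rfl⟩
  have hs' : K * s + B = 0 := by rw [hs]; field_simp; ring
  have ht' : K * t + ((3 * r + 2) * K + B) = 0 := by rw [ht]; field_simp; ring
  have hs0 : s ≠ 0 := by
    rintro rfl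
    apply hB
    linear_combination hs'
  have htr : t ≠ r := by
    intro h0
    apply h.exact_contact
    rw [h0] at ht'
    linear_combination ht'
  have hrestr : ∀ x, eval ![x, 1, x ^ 2 + x + δ] (conicH A B K) =
      (x - r) ^ 3 * (K * x + ((3 * r + 2) * K + B)) := by
    intro x
    rw [← arcEval_arcG, ← eval_aeval, aeval_arcG_conicH, h.toIsOsculating.restr_eq]
    simp
  -- This is the value of H at (−δ : 1 : δ²), the transversal intersection of F and G.
  have hntp : -δ ^ 3 * (B - K * δ) ≠ 0 :=
    mul_ne_zero (neg_ne_zero.2 (pow_ne_zero 3 hδ)) h.no_triple_point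
  have hnt : ∀ x, eval ![x, 1, x ^ 2 + x + δ] (conicH A B K) = 0 → x + δ ≠ 0 := by
    intro x hx h0
    have hxd : x = -δ := by linear_combination h0
    rw [hxd, eval_conicH] at hx
    simp at hx
    apply hntp
    linear_combination hx
  let pfg := point hMN ![-δ, 1, δ ^ 2] (fun h => by simpa using congrFun h 1)
  let pfh := point hMN ![s, 1, s ^ 2] (fun h => by simpa using congrFun h 1)
  let pgh := point hMN ![t, 1, t ^ 2 + t + δ] (fun h => by simpa using congrFun h 1)
  have hfg : HasCoords M pfg ![-δ, 1, δ ^ 2] := hasCoords_point hMN _ _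
  have hfh : HasCoords M pfh ![s, 1, s ^ 2] := hasCoords_point hMN _ _
  have hgh : HasCoords M pgh ![t, 1, t ^ 2 + t + δ] := hasCoords_point hMN _ _
  -- which points lie on which conic
  have f1 : eval p₁.rep (pull M (conicF c)) = 0 := by
    rw [h₁.eval_eq_zero_iff hF2, eval_conicF]; simp
  have g1 : eval p₁.rep (pull M (conicG c' δ)) = 0 := by
    rw [h₁.eval_eq_zero_iff hG2, eval_conicG]; simp
  have h1 : eval p₁.rep (pull M (conicH A B K)) ≠ 0 := by
    rw [Ne, h₁.eval_eq_zero_iff hH2, eval_conicH]; simpa using hK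
  have f2 : eval p₂.rep (pull M (conicF c)) = 0 := by
    rw [h₂.eval_eq_zero_iff hF2, eval_conicF]; simp
  have g2 : eval p₂.rep (pull M (conicG c' δ)) ≠ 0 := by
    rw [Ne, h₂.eval_eq_zero_iff hG2, eval_conicG]; simp [hc', hδ]
  have h2 : eval p₂.rep (pull M (conicH A B K)) = 0 := by
    rw [h₂.eval_eq_zero_iff hH2, eval_conicH]; simp
  have hq0 : eval ![r, 1, r ^ 2 + r + δ] (conicH A B K) = 0 := by rw [hrestr]; ring
  have fq : eval q.rep (pull M (conicF c)) ≠ 0 := by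
    rw [Ne, hq.eval_eq_zero_iff hF2, eval_conicF]
    intro h0
    simp [hc] at h0
    exact hnt r hq0 (by linear_combination -h0)
  have gq : eval q.rep (pull M (conicG c' δ)) = 0 := by
    rw [hq.eval_eq_zero_iff hG2, eval_conicG]; simp; ring_nf; simp
  have hq' : eval q.rep (pull M (conicH A B K)) = 0 := by
    rwa [hq.eval_eq_zero_iff hH2]
  have ffg : eval pfg.rep (pull M (conicF c)) = 0 := by
    rw [hfg.eval_eq_zero_iff hF2, eval_conicF]; simp
  have gfg : eval pfg.rep (pull M (conicG c' δ)) = 0 := by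
    rw [hfg.eval_eq_zero_iff hG2, eval_conicG]; simp
  have hfg' : eval pfg.rep (pull M (conicH A B K)) ≠ 0 := by
    rw [Ne, hfg.eval_eq_zero_iff hH2, eval_conicH]
    intro h0
    simp at h0
    apply hntp
    linear_combination h0
  have ffh : eval pfh.rep (pull M (conicF c)) = 0 := by
    rw [hfh.eval_eq_zero_iff hF2, eval_conicF]; simp
  have gfh : eval pfh.rep (pull M (conicG c' δ)) ≠ 0 := by
    rw [Ne, hfh.eval_eq_zero_iff hG2, eval_conicG]
    intro h0
    simp [hc'] at h0
    apply h.no_triple_point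
    linear_combination hs' - K * h0
  have hfh' : eval pfh.rep (pull M (conicH A B K)) = 0 := by
    rw [hfh.eval_eq_zero_iff hH2, eval_conicH]
    simp
    linear_combination s ^ 3 * hs'
  have ht0 : eval ![t, 1, t ^ 2 + t + δ] (conicH A B K) = 0 := by rw [hrestr, ht', mul_zero]
  have fgh : eval pgh.rep (pull M (conicF c)) ≠ 0 := by
    rw [Ne, hgh.eval_eq_zero_iff hF2, eval_conicF]
    intro h0
    simp [hc] at h0
    exact hnt t ht0 (by linear_combination -h0)
  have ggh : eval pgh.rep (pull M (conicG c' δ)) = 0 := by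
    rw [hgh.eval_eq_zero_iff hG2, eval_conicG]; simp; ring_nf; simp
  have hgh' : eval pgh.rep (pull M (conicH A B K)) = 0 := by
    rwa [hgh.eval_eq_zero_iff hH2]
  have ne_of : ∀ (F : Form) (p q : Plane), eval p.rep F = 0 → eval q.rep F ≠ 0 → p ≠ q := by
    rintro F p q hp hq rfl
    exact hq hp
  refine ⟨?_, ?_, {pfg, pfh, pgh}, ?_, ?_, ?_, ?_⟩
  · rw [Set.ncard_eq_three]
    exact ⟨p₁, p₂, q, ne_of _ _ _ g1 g2, ne_of _ _ _ f1 fq, ne_of _ _ _ f2 fq, rfl⟩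
  · have hsmG := smooth_pull hMN (smooth_conicG hc' δ)
    have hsmH := smooth_pull hMN (smooth_conicH hA B K)
    rintro P (rfl | rfl | rfl)
    · obtain ⟨a, ha, hP⟩ := h₁
      have harc := isArc_arcF' hMN hc ha hP
      have hval : aeval (act N arcF') (pull M (conicG c' δ)) =
          Polynomial.X ^ 3 * (Polynomial.C c' * (1 + Polynomial.C δ * Polynomial.X)) := by
        rw [aeval_act_pull hMN, conicG, aeval_quad]
        simp [arcF', Polynomial.algebraMap_eq]
        ring
      refine harc.isTypeA_five hF2' hG2' hH2' ⟨g1, hsmG _ P.rep_nonzero⟩ h1 ?_ ?_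
      · rw [hval, Polynomial.C_0, sub_zero]
        exact dvd_mul_right _ _
      · rw [hval, Polynomial.C_0, sub_zero, pow_succ,
          mul_dvd_mul_iff_left (pow_ne_zero 3 Polynomial.X_ne_zero), Polynomial.X_dvd_iff]
        simpa using hc'
    · obtain ⟨a, ha, hP⟩ := h₂
      have harc := isArc_arcF (t := 0) hMN hc ha (by rw [hP]; simp)
      have hval : aeval (act N arcF) (pull M (conicH A B K)) =
          Polynomial.X ^ 3 * (Polynomial.C B + Polynomial.C K * Polynomial.X) := by
        rw [aeval_act_pull hMN, conicH, aeval_quad]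
        simp [arcF, Polynomial.algebraMap_eq]
        ring
      rw [mul_right_comm]
      refine harc.isTypeA_five hF2' hH2' hG2' ⟨h2, hsmH _ P.rep_nonzero⟩ g2 ?_ ?_
      · rw [hval, Polynomial.C_0, sub_zero]
        exact dvd_mul_right _ _
      · rw [hval, Polynomial.C_0, sub_zero, pow_succ,
          mul_dvd_mul_iff_left (pow_ne_zero 3 Polynomial.X_ne_zero), Polynomial.X_dvd_iff]
        simpa using hB
    · obtain ⟨a, ha, hP⟩ := hq
      have harc := isArc_arcG hMN hc' ha hP
      have hval : aeval (act N (arcG δ)) (pull M (conicH A B K)) =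
          (Polynomial.X - Polynomial.C r) ^ 3 *
            (Polynomial.C K * Polynomial.X + Polynomial.C ((3 * r + 2) * K + B)) := by
        rw [aeval_act_pull hMN, aeval_arcG_conicH, h.toIsOsculating.restr_eq]
      rw [show pull M (conicF c) * pull M (conicG c' δ) * pull M (conicH A B K) =
        pull M (conicG c' δ) * pull M (conicH A B K) * pull M (conicF c) by ring]
      refine harc.isTypeA_five hG2' hH2' hF2' ⟨hq', hsmH _ P.rep_nonzero⟩ fq ?_ ?_
      · rw [hval]
        exact dvd_mul_right _ _
      · rw [hval, pow_succ,
          mul_dvd_mul_iff_left (pow_ne_zero 3 (Polynomial.X_sub_C_ne_zero r)),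
          Polynomial.dvd_iff_isRoot, Polynomial.IsRoot.def]
        simp only [Polynomial.eval_add, Polynomial.eval_mul, Polynomial.eval_C, Polynomial.eval_X]
        intro h0
        apply h.exact_contact
        linear_combination h0
  · rw [Set.ncard_eq_three]
    exact ⟨pfg, pfh, pgh, ne_of _ _ _ gfg gfh, ne_of _ _ _ ffg fgh, ne_of _ _ _ ffh fgh, rfl⟩
  · have e1 : p₁ ≠ pfg := by
      intro he
      obtain ⟨x, hx⟩ := hfg.exists_eq_smul (he ▸ h₁)
      simpa using congrFun hx 1
    have e2 : p₂ ≠ pfh := by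
      intro he
      obtain ⟨x, hx⟩ := hfh.exists_eq_smul (he ▸ h₂)
      exact hs0 (by simpa using congrFun hx 0)
    have e3 : q ≠ pgh := by
      intro he
      obtain ⟨x, hx⟩ := hgh.exists_eq_smul (he ▸ hq)
      have hx0 := congrFun hx 0
      have hx1 := congrFun hx 1
      simp at hx0 hx1
      rw [← hx1, one_mul] at hx0
      exact htr hx0
    simp only [Set.disjoint_insert_left, Set.disjoint_singleton_left, Set.mem_insert_iff,
      Set.mem_singleton_iff, not_or]
    exact ⟨⟨e1, (ne_of _ _ _ hfh' h1).symm, ne_of _ _ _ f1 fgh⟩,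
      ⟨(ne_of _ _ _ gfg g2).symm, e2, ne_of _ _ _ f2 fgh⟩,
      ⟨(ne_of _ _ _ ffg fq).symm, (ne_of _ _ _ ffh fq).symm, e3⟩⟩
  · rintro P (rfl | rfl | rfl)
    · refine isTypeA_one hF2' hG2' hH2' ffg gfg hfg'
        (hfg.minor_ne_zero hMN hF2 hG2 0 2 ?_)
      rw [conicF, conicG, eval_pderiv_zero_quad, eval_pderiv_zero_quad, eval_pderiv_two_quad,
        eval_pderiv_two_quad]
      simp
      intro h0
      apply mul_ne_zero hc hc'
      linear_combination h0
    · rw [mul_right_comm]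
      refine isTypeA_one hF2' hH2' hG2' ffh hfh' gfh
        (hfh.minor_ne_zero hMN hF2 hH2 0 1 ?_)
      rw [conicF, conicH, eval_pderiv_zero_quad, eval_pderiv_zero_quad, eval_pderiv_one_quad,
        eval_pderiv_one_quad]
      simp
      intro h0
      apply mul_ne_zero (mul_ne_zero hc hB) (pow_ne_zero 4 hs0)
      linear_combination -h0
    · rw [show pull M (conicF c) * pull M (conicG c' δ) * pull M (conicH A B K) =
        pull M (conicG c' δ) * pull M (conicH A B K) * pull M (conicF c) by ring]
      refine isTypeA_one hG2' hH2' hF2' ggh hgh' fgh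
        (hgh.minor_ne_zero hMN hG2 hH2 0 2 ?_)
      rw [conicG, conicH, eval_pderiv_zero_quad, eval_pderiv_zero_quad, eval_pderiv_two_quad,
        eval_pderiv_two_quad]
      simp
      intro h0
      -- The minor equals c' times the derivative at `t` of H restricted to G. The factorization
      -- gives K(t − r)³ for that derivative, as the linear factor vanishes at `t`.
      have hd := congrArg (fun p => (Polynomial.derivative p).eval t) h.toIsOsculating.restr_eq
      simp [restr, pow_two, pow_three] at hd
      apply mul_ne_zero (mul_ne_zero hc' hK) (pow_ne_zero 3 (sub_ne_zero.2 htr))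
      linear_combination h0 - c' * hd - 3 * c' * (t - r) ^ 2 * ht'
  · ext P
    rw [Set.mem_ofPred_eq, isSingularPoint_mul_iff
      (smooth_pull hMN (smooth_conicF hc) _ P.rep_nonzero)
      (smooth_pull hMN (smooth_conicG hc' δ) _ P.rep_nonzero)
      (smooth_pull hMN (smooth_conicH hA B K) _ P.rep_nonzero)]
    simp only [Set.mem_union, Set.mem_insert_iff, Set.mem_singleton_iff]
    constructor
    · rintro (⟨ha, hb⟩ | ⟨ha, hb⟩ | ⟨ha, hb⟩)
      · rcases hasCoords_of_mem_F_of_mem_G hMN hc hc' ha hb with hP | hP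
        · exact Or.inl (Or.inl (hP.eq hMN h₁))
        · exact Or.inr (Or.inl (hP.eq hMN hfg))
      · rcases hasCoords_of_mem_F_of_mem_H hMN hc hK ha hb with hP | hP
        · exact Or.inl (Or.inr (Or.inl (hP.eq hMN h₂)))
        · rw [← hs] at hP
          exact Or.inr (Or.inr (Or.inl (hP.eq hMN hfh)))
      · rcases hasCoords_of_mem_G_of_mem_H hMN hc' hK h.toIsOsculating ha hb with hP | ⟨x, hx, hP⟩
        · exact Or.inl (Or.inr (Or.inr (hP.eq hMN hq)))
        · rw [← ht] at hx
          rw [hx] at hP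
          exact Or.inr (Or.inr (Or.inr (hP.eq hMN hgh)))
    · rintro ((rfl | rfl | rfl) | (rfl | rfl | rfl))
      · exact Or.inl ⟨f1, g1⟩
      · exact Or.inr (Or.inl ⟨f2, h2⟩)
      · exact Or.inr (Or.inr ⟨gq, hq'⟩)
      · exact Or.inl ⟨ffg, gfg⟩
      · exact Or.inr (Or.inl ⟨ffh, hfh'⟩)
      · exact Or.inr (Or.inr ⟨ggh, hgh'⟩)

/-! ### Sextics of torus type -/

lemma IsTorusType.pull {M N : Matrix (Fin 3) (Fin 3) ℂ} (hMN : M * N = 1) {F : Form}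
    (h : IsTorusType F) : IsTorusType (pull M F) := by
  obtain ⟨c, hc, F₂, F₃, h2, h3, h2', h3', he⟩ := h
  have h1 := congrArg (ThreeConics.pull M) he
  refine ⟨c, hc, ThreeConics.pull M F₂, ThreeConics.pull M F₃, pull_ne_zero hMN h2,
    pull_ne_zero hMN h3, isHomogeneous_pull M h2', isHomogeneous_pull M h3', ?_⟩
  rw [map_mul, map_add, map_pow, map_pow] at h1
  rw [← h1]
  congr 1
  exact ((ThreeConics.pull M).commutes c).symm

lemma isTorusType_pull_iff {M N : Matrix (Fin 3) (Fin 3) ℂ} (hMN : M * N = 1) {F : Form} :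
    IsTorusType (pull M F) ↔ IsTorusType F := by
  refine ⟨fun h => ?_, fun h => h.pull hMN⟩
  have := h.pull (mul_eq_one_comm.1 hMN)
  rwa [pull_pull hMN] at this

/-- The torus decomposition for the osculating conic at the parameter `r = -2δ`. -/
lemma isTorusType_conics {c c' r : ℂ} (hc : c ≠ 0) (hc' : c' ≠ 0) (hr : 2 * r + 1 ≠ 0) :
    IsTorusType (conicF c * conicG c' (-r / 2) *
      conicH (-(r / 2) * (2 * r + 1) ^ 2) (-(2 * r + 1)) 1) := by
  let v : Fin 3 → ℂ := ![1, 0, 0]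
  -- The conic (2r + 1)u² − 2rvw is what the coefficient comparison in `not_isTorusType` permits, up
  -- to scale, when r = −2δ. The factor i in the cubic supplies the sign in F₂³ + F₃².
  refine ⟨-4 / (c * c'), by simp [hc, hc'], quad (2 * r + 1) 0 0 0 (-2 * r) 0,
    C Complex.I * (X 0 ^ 3 + quad 1 0 0 0 (-1) 0 *
      (C (-2 * (r + 1)) * X 0 + C (r * (2 * r + 1)) * X 1 + C 2 * X 2)),
    fun h0 => hr ?_, fun h0 => hr ?_, isHomogeneous_quad .., ?_, ?_⟩
  · have := congrArg (eval v) h0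
    rw [eval_quad] at this
    simpa [v] using this
  · have := congrArg (eval v) h0
    rw [map_mul, map_add, map_mul, eval_quad] at this
    simp [v] at this
    linear_combination -this
  · have hX : ∀ i : Fin 3, (X i : Form).IsHomogeneous 1 := fun i => isHomogeneous_X ℂ i
    have h1 : (X 0 ^ 3 : Form).IsHomogeneous 3 := by
      have := (hX 0).pow 3
      rwa [one_mul] at this
    exact (h1.add ((isHomogeneous_quad ..).mul
      ((((hX 0).C_mul _).add ((hX 1).C_mul _)).add ((hX 2).C_mul _)))).C_mul _
  · apply MvPolynomial.funext
    intro x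
    simp only [map_mul, map_add, map_pow, eval_C, eval_X, eval_quad, eval_conicF, eval_conicG,
      eval_conicH, mul_pow, Complex.I_sq]
    field_simp
    ring

/-- At a node of a sextic of torus type the conic does not vanish: the Hessian there has rank `2`,
while it would be the square of a linear form. -/
lemma eval_ne_zero_of_node {F G H F₂ F₃ : Form} {c : ℂ} (hc : c ≠ 0)
    (he : C c * (F * G * H) = F₂ ^ 3 + F₃ ^ 2) {v : Fin 3 → ℂ} (hF : eval v F = 0)
    (hG : eval v G = 0) (hH : eval v H ≠ 0) (i j : Fin 3)
    (hm : eval v (pderiv i F) * eval v (pderiv j G) ≠ eval v (pderiv j F) * eval v (pderiv i G)) :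
    eval v F₂ ≠ 0 := by
  intro h2
  have h3 : eval v F₃ = 0 := by
    have := congrArg (eval v) he
    simpa [hF, h2] using this.symm
  -- Second derivatives at a point where F, G, F₂ and F₃ all vanish: F₂³ contributes nothing and F₃²
  -- contributes a matrix of rank at most one.
  have hess : ∀ a b, c * eval v H * (eval v (pderiv a F) * eval v (pderiv b G) +
      eval v (pderiv b F) * eval v (pderiv a G)) =
        2 * eval v (pderiv a F₃) * eval v (pderiv b F₃) := by
    intro a b
    have := congrArg (fun p => eval v (pderiv b (pderiv a p))) he
    simp [Derivation.leibniz, pow_succ, hF, hG, h2, h3] at this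
    linear_combination this
  apply hm
  have hk : c * eval v H ≠ 0 := mul_ne_zero hc hH
  -- The vanishing 2×2 determinant of the rank-one side, computed on the other side, where it is
  -- minus the square of the gradient minor up to a non-zero factor.
  have hsq : (c * eval v H) ^ 2 * (eval v (pderiv i F) * eval v (pderiv j G) -
      eval v (pderiv j F) * eval v (pderiv i G)) ^ 2 = 0 := by
    have hij := hess i j
    have hii := hess i i
    have hjj := hess j j
    linear_combination (c * eval v H * (eval v (pderiv i F) * eval v (pderiv j G) +
      eval v (pderiv j F) * eval v (pderiv i G)) + 2 * eval v (pderiv i F₃) *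
        eval v (pderiv j F₃)) * hij - c * eval v H *
          (eval v (pderiv j F) * eval v (pderiv j G) + eval v (pderiv j F) * eval v (pderiv j G))
          * hii - 2 * eval v (pderiv i F₃) ^ 2 * hjj
  rcases mul_eq_zero.1 hsq with h | h
  · exact absurd h (pow_ne_zero 2 hk)
  · exact sub_eq_zero.1 (by simpa using h)

/-- On a smooth component of a sextic of torus type, the conic vanishes only at points of the
other components. -/
lemma singular_of_eval_eq_zero {F G H F₂ F₃ : Form} {c : ℂ} (hc : c ≠ 0)
    (he : C c * (F * G * H) = F₂ ^ 3 + F₃ ^ 2) {v : Fin 3 → ℂ}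
    (hv : eval v (F * G * H) = 0) (h2 : eval v F₂ = 0) :
    eval v (F * G * H) = 0 ∧ ∀ i, eval v (pderiv i (F * G * H)) = 0 := by
  have h3 : eval v F₃ = 0 := by
    have := congrArg (eval v) he
    rw [map_mul, hv] at this
    simpa [h2] using this.symm
  refine ⟨hv, fun i => ?_⟩
  have := congrArg (fun p => eval v (pderiv i p)) he
  simp only [pderiv_C_mul, map_mul (eval v), map_add, eval_C, pderiv_pow, map_pow, h2, h3] at this
  simpa [hc] using this

lemma exists_eq_C_mul_pow {p : Polynomial ℂ} (hp : p ≠ 0) {r : ℂ}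
    (h : ∀ x, p.eval x = 0 → x = r) :
    ∃ (κ : ℂ) (n : ℕ), κ ≠ 0 ∧ p = Polynomial.C κ * (Polynomial.X - Polynomial.C r) ^ n := by
  have h1 : p.roots = Multiset.replicate p.roots.card r :=
    Multiset.eq_replicate_card.2 fun x hx => h x ((Polynomial.mem_roots hp).1 hx)
  refine ⟨p.leadingCoeff, p.roots.card, Polynomial.leadingCoeff_ne_zero.2 hp, ?_⟩
  have h2 := (IsAlgClosed.splits p).eq_prod_roots
  rw [h1] at h2
  simpa using h2

/-- Comparing degrees in a³ = −b² gives 3n = 2 deg b. -/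
lemma even_of_cube_eq {a b : Polynomial ℂ} {κ r : ℂ} {n : ℕ} (hκ : κ ≠ 0)
    (ha : a = Polynomial.C κ * (Polynomial.X - Polynomial.C r) ^ n) (h : a ^ 3 + b ^ 2 = 0) :
    Even n := by
  have h1 : (a ^ 3).natDegree = (b ^ 2).natDegree := by
    rw [eq_neg_of_add_eq_zero_left h, Polynomial.natDegree_neg]
  rw [Polynomial.natDegree_pow, Polynomial.natDegree_pow, ha,
    Polynomial.natDegree_C_mul hκ, Polynomial.natDegree_pow, Polynomial.natDegree_X_sub_C] at h1
  rw [Nat.even_iff]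
  omega

lemma quartic_eq_zero {p₀ p₁ p₂ p₃ p₄ : ℂ}
    (h : ∀ t : ℂ, p₀ + p₁ * t + p₂ * t ^ 2 + p₃ * t ^ 3 + p₄ * t ^ 4 = 0) :
    p₀ = 0 ∧ p₁ = 0 ∧ p₂ = 0 ∧ p₃ = 0 ∧ p₄ = 0 := by
  have h0 := h 0
  have h1 := h 1
  have h2 := h (-1)
  have h3 := h 2
  have h4 := h (-2)
  refine ⟨by linear_combination h0, ?_, ?_, ?_, ?_⟩
  · linear_combination (8 * h1 - 8 * h2 - h3 + h4) / 12
  · linear_combination (16 * h1 + 16 * h2 - h3 - h4 - 30 * h0) / 24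
  · linear_combination (-2 * h1 + 2 * h2 + h3 - h4) / 12
  · linear_combination (6 * h0 - 4 * h1 - 4 * h2 + h3 + h4) / 24

/-- Away from the parameter `r = -2δ` the sextic is not of torus type. -/
theorem not_isTorusType {c c' δ r A B K : ℂ} (hc : c ≠ 0) (hc' : c' ≠ 0)
    (h : IsGeneralOsculating δ r A B K) (hr0 : r ≠ 0) (hr1 : 2 * r + 1 ≠ 0) (hr2 : r + 2 * δ ≠ 0) :
    ¬ IsTorusType (conicF c * conicG c' δ * conicH A B K) := by
  rintro ⟨c₀, hc₀, F₂, F₃, -, -, h2, h3, he⟩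
  have hδ := h.δ_ne
  have hA := h.A_ne
  have hB := h.B_ne
  have hK := h.K_ne
  have hntp : -δ ^ 3 * (B - K * δ) ≠ 0 :=
    mul_ne_zero (neg_ne_zero.2 (pow_ne_zero 3 hδ)) h.no_triple_point
  have hrestr : ∀ x, eval ![x, 1, x ^ 2 + x + δ] (conicH A B K) =
      (x - r) ^ 3 * (K * x + ((3 * r + 2) * K + B)) := by
    intro x
    rw [← arcEval_arcG, ← eval_aeval, aeval_arcG_conicH, h.toIsOsculating.restr_eq]
    simp
  have hnt : ∀ x, eval ![x, 1, x ^ 2 + x + δ] (conicH A B K) = 0 → x + δ ≠ 0 := by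
    intro x hx h0
    have hxd : x = -δ := by linear_combination h0
    rw [hxd, eval_conicH] at hx
    simp at hx
    apply hntp
    linear_combination hx
  -- the conic does not vanish at the nodes
  have node_fg : eval ![-δ, 1, δ ^ 2] F₂ ≠ 0 := by
    refine eval_ne_zero_of_node hc₀ he (by rw [eval_conicF]; simp) (by rw [eval_conicG]; simp)
      ?_ 0 2 ?_
    · rw [eval_conicH]
      intro h0
      simp at h0
      apply hntp
      linear_combination h0
    · rw [conicF, conicG, eval_pderiv_zero_quad, eval_pderiv_zero_quad, eval_pderiv_two_quad,
        eval_pderiv_two_quad]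
      simp
      intro h0
      apply mul_ne_zero hc hc'
      linear_combination h0
  have node_fh : ∀ s, K * s + B = 0 → eval ![s, 1, s ^ 2] F₂ ≠ 0 := by
    intro s hs
    have hs0 : s ≠ 0 := by
      rintro rfl
      apply hB
      linear_combination hs
    rw [mul_right_comm] at he
    refine eval_ne_zero_of_node hc₀ he (by rw [eval_conicF]; simp) ?_ ?_ 0 1 ?_
    · rw [eval_conicH]
      simp
      linear_combination s ^ 3 * hs
    · rw [eval_conicG]
      intro h0
      simp [hc'] at h0
      apply h.no_triple_point
      linear_combination hs - K * h0
    · rw [conicF, conicH, eval_pderiv_zero_quad, eval_pderiv_zero_quad, eval_pderiv_one_quad,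
        eval_pderiv_one_quad]
      simp
      intro h0
      apply mul_ne_zero (mul_ne_zero hc hB) (pow_ne_zero 4 hs0)
      linear_combination -h0
  have node_gh : ∀ t, K * t + ((3 * r + 2) * K + B) = 0 →
      eval ![t, 1, t ^ 2 + t + δ] F₂ ≠ 0 := by
    intro t ht
    have htr : t ≠ r := by
      intro h0
      apply h.exact_contact
      rw [h0] at ht
      linear_combination ht
    have ht0 : eval ![t, 1, t ^ 2 + t + δ] (conicH A B K) = 0 := by rw [hrestr, ht, mul_zero]
    rw [show conicF c * conicG c' δ * conicH A B K =
      conicG c' δ * conicH A B K * conicF c by ring] at he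
    refine eval_ne_zero_of_node hc₀ he ?_ ht0 ?_ 0 2 ?_
    · rw [eval_conicG]
      simp
      ring_nf
      simp
    · rw [eval_conicF]
      intro h0
      simp [hc] at h0
      exact hnt t ht0 (by linear_combination -h0)
    · rw [conicG, conicH, eval_pderiv_zero_quad, eval_pderiv_zero_quad, eval_pderiv_two_quad,
        eval_pderiv_two_quad]
      simp
      intro h0
      have hd := congrArg (fun p => (Polynomial.derivative p).eval t) h.toIsOsculating.restr_eq
      simp [restr, pow_two, pow_three] at hd
      apply mul_ne_zero (mul_ne_zero hc' hK) (pow_ne_zero 3 (sub_ne_zero.2 htr))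
      linear_combination h0 - c' * hd - 3 * c' * (t - r) ^ 2 * ht
  have sing : ∀ v : Fin 3 → ℂ, v ≠ 0 → eval v (conicF c * conicG c' δ * conicH A B K) = 0 →
      eval v F₂ = 0 → (eval v (conicF c) = 0 ∧ eval v (conicG c' δ) = 0) ∨
      (eval v (conicF c) = 0 ∧ eval v (conicH A B K) = 0) ∨
      (eval v (conicG c' δ) = 0 ∧ eval v (conicH A B K) = 0) := fun v hv0 hv hv2 =>
    (singular_mul_iff (smooth_conicF hc v hv0) (smooth_conicG hc' δ v hv0)
      (smooth_conicH hA B K v hv0)).1 (singular_of_eval_eq_zero hc₀ he hv hv2)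
  have hne : ∀ x y : ℂ, ![x, 1, y] ≠ 0 := fun x y h => by simpa using congrFun h 1
  -- zeros of the conic on the components
  have zero_f : ∀ t, eval ![t, 1, t ^ 2] F₂ = 0 → t = 0 := by
    intro t ht
    have hf : eval ![t, 1, t ^ 2] (conicF c) = 0 := by rw [eval_conicF]; simp
    have hg : eval ![t, 1, t ^ 2] (conicG c' δ) ≠ 0 := by
      rw [eval_conicG]
      intro h0
      simp [hc'] at h0
      have : t = -δ := by linear_combination h0
      apply node_fg
      rw [this] at ht
      simpa using ht
    have hh : eval ![t, 1, t ^ 2] (conicH A B K) = 0 := by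
      rcases sing _ (hne _ _) (by simp [hf]) ht with h0 | h0 | h0
      · exact absurd h0.2 hg
      · exact h0.2
      · exact h0.2
    rw [eval_conicH] at hh
    simp at hh
    have h1 : t ^ 3 * (K * t + B) = 0 := by linear_combination hh
    rcases mul_eq_zero.1 h1 with h1 | h1
    · simpa using h1
    · exact absurd ht (node_fh t h1)
  have zero_g : ∀ t, eval ![t, 1, t ^ 2 + t + δ] F₂ = 0 → t = r := by
    intro t ht
    have hg : eval ![t, 1, t ^ 2 + t + δ] (conicG c' δ) = 0 := by
      rw [eval_conicG]
      simp
      ring_nf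
      simp
    have hf : eval ![t, 1, t ^ 2 + t + δ] (conicF c) ≠ 0 := by
      rw [eval_conicF]
      intro h0
      simp [hc] at h0
      have : t = -δ := by linear_combination -h0
      apply node_fg
      rw [this] at ht
      simpa using ht
    have hh : eval ![t, 1, t ^ 2 + t + δ] (conicH A B K) = 0 := by
      rcases sing _ (hne _ _) (by simp [hg]) ht with h0 | h0 | h0
      · exact absurd h0.1 hf
      · exact h0.2
      · exact h0.2
    rw [hrestr] at hh
    rcases mul_eq_zero.1 hh with h1 | h1
    · exact sub_eq_zero.1 (by simpa using h1)
    · exact absurd ht (node_gh t h1)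
  -- the restrictions of the conic to the components
  have hcube : ∀ (φ : Fin 3 → Polynomial ℂ), aeval φ (conicF c * conicG c' δ * conicH A B K) = 0 →
      aeval φ F₂ ^ 3 + aeval φ F₃ ^ 2 = 0 := by
    intro φ hφ
    have := congrArg (aeval φ) he
    rw [map_mul, hφ, mul_zero, map_add, map_pow, map_pow] at this
    exact this.symm
  -- With the coefficients of F₂ unknown, its restrictions to F and G must be κtⁿ and κ'(t − r)ⁿ'
  -- with n, n' ∈ {0, 2, 4}. The nine cases are excluded one by one.
  obtain ⟨a, b, g, d, e, k, rfl⟩ := exists_eq_quad h2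
  have ef : ∀ t, (aeval arcF (quad a b g d e k)).eval t =
      d + b * t + (a + e) * t ^ 2 + g * t ^ 3 + k * t ^ 4 := by
    intro t
    rw [eval_aeval, arcEval_arcF, eval_quad]
    simp
    ring
  have eg : ∀ t, (aeval (arcG δ) (quad a b g d e k)).eval t = (d + e * δ + k * δ ^ 2) +
      (b + g * δ + e + 2 * k * δ) * t + (a + g + e + k * (1 + 2 * δ)) * t ^ 2 +
      (g + 2 * k) * t ^ 3 + k * t ^ 4 := by
    intro t
    rw [eval_aeval, arcEval_arcG, eval_quad]
    simp
    ring
  have hdegf : (aeval arcF (quad a b g d e k)).natDegree ≤ 4 := by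
    rw [aeval_quad]
    simp only [arcF, Polynomial.algebraMap_eq, Matrix.cons_val]
    compute_degree
  have hdegg : (aeval (arcG δ) (quad a b g d e k)).natDegree ≤ 4 := by
    rw [aeval_quad]
    simp only [arcG, Polynomial.algebraMap_eq, Matrix.cons_val]
    compute_degree
  have nef : aeval arcF (quad a b g d e k) ≠ 0 := by
    intro h0
    have := zero_f 1 (by rw [← arcEval_arcF, ← eval_aeval, h0, Polynomial.eval_zero])
    norm_num at this
  have neg : aeval (arcG δ) (quad a b g d e k) ≠ 0 := by
    intro h0
    have := zero_g (r + 1) (by rw [← arcEval_arcG, ← eval_aeval, h0, Polynomial.eval_zero])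
    norm_num at this
  obtain ⟨κ, n, hκ, hn⟩ := exists_eq_C_mul_pow nef (r := 0) fun x hx => zero_f x (by
    rwa [← arcEval_arcF, ← eval_aeval])
  obtain ⟨κ', n', hκ', hn'⟩ := exists_eq_C_mul_pow neg (r := r) fun x hx => zero_g x (by
    rwa [← arcEval_arcG, ← eval_aeval])
  have evn : Even n := even_of_cube_eq hκ hn (hcube arcF (by
    rw [map_mul, map_mul, conicF, aeval_quad]
    simp [arcF]))
  have evn' : Even n' := even_of_cube_eq hκ' hn' (hcube (arcG δ) (by
    rw [map_mul, map_mul, mul_comm (aeval _ (conicF c)), mul_assoc]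
    apply mul_eq_zero_of_left
    rw [conicG, aeval_quad]
    simp [arcG, Polynomial.algebraMap_eq]
    ring))
  rw [hn, Polynomial.natDegree_C_mul hκ, Polynomial.natDegree_pow,
    Polynomial.natDegree_X_sub_C] at hdegf
  rw [hn', Polynomial.natDegree_C_mul hκ', Polynomial.natDegree_pow,
    Polynomial.natDegree_X_sub_C] at hdegg
  have hf : ∀ t, d + b * t + (a + e) * t ^ 2 + g * t ^ 3 + k * t ^ 4 = κ * t ^ n := by
    intro t
    rw [← ef, hn]
    simp
  have hg : ∀ t, (d + e * δ + k * δ ^ 2) +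
      (b + g * δ + e + 2 * k * δ) * t + (a + g + e + k * (1 + 2 * δ)) * t ^ 2 +
      (g + 2 * k) * t ^ 3 + k * t ^ 4 = κ' * (t - r) ^ n' := by
    intro t
    rw [← eg, hn']
    simp
  clear hn hn' nef neg
  have hn : n = 0 ∨ n = 2 ∨ n = 4 := by
    obtain ⟨m, rfl⟩ := evn
    omega
  have hn' : n' = 0 ∨ n' = 2 ∨ n' = 4 := by
    obtain ⟨m, rfl⟩ := evn'
    omega
  have hg4 : ∃ q₁ q₂ q₃ q₄ : ℂ, b + g * δ + e + 2 * k * δ = q₁ ∧ d + e * δ + k * δ ^ 2 = q₂ ∧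
      a + g + e + k * (1 + 2 * δ) = q₃ ∧ g + 2 * k = q₄ ∧
      ((n' = 0 ∧ q₁ = 0 ∧ q₃ = 0 ∧ q₄ = 0 ∧ k = 0) ∨
       (n' = 2 ∧ q₁ = -2 * r * κ' ∧ q₂ = κ' * r ^ 2 ∧ q₃ = κ' ∧ q₄ = 0 ∧ k = 0) ∨
       (n' = 4 ∧ q₄ = -4 * r * κ' ∧ k = κ')) := by
    refine ⟨_, _, _, _, rfl, rfl, rfl, rfl, ?_⟩
    rcases hn' with rfl | rfl | rfl
    · left
      obtain ⟨-, h1, h2, h3, h4⟩ := quartic_eq_zero (p₀ := d + e * δ + k * δ ^ 2 - κ')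
        (p₁ := b + g * δ + e + 2 * k * δ) (p₂ := a + g + e + k * (1 + 2 * δ)) (p₃ := g + 2 * k)
        (p₄ := k) (fun t => by linear_combination hg t)
      exact ⟨rfl, h1, h2, h3, h4⟩
    · right; left
      obtain ⟨h0, h1, h2, h3, h4⟩ := quartic_eq_zero (p₀ := d + e * δ + k * δ ^ 2 - κ' * r ^ 2)
        (p₁ := b + g * δ + e + 2 * k * δ + 2 * r * κ')
        (p₂ := a + g + e + k * (1 + 2 * δ) - κ') (p₃ := g + 2 * k)
        (p₄ := k) (fun t => by linear_combination hg t)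
      exact ⟨rfl, by linear_combination h1, by linear_combination h0, by linear_combination h2,
        h3, h4⟩
    · right; right
      obtain ⟨-, -, -, h3, h4⟩ := quartic_eq_zero (p₀ := d + e * δ + k * δ ^ 2 - κ' * r ^ 4)
        (p₁ := b + g * δ + e + 2 * k * δ + 4 * r ^ 3 * κ')
        (p₂ := a + g + e + k * (1 + 2 * δ) - 6 * r ^ 2 * κ') (p₃ := g + 2 * k + 4 * r * κ')
        (p₄ := k - κ') (fun t => by linear_combination hg t)
      exact ⟨rfl, by linear_combination h3, by linear_combination h4⟩
  obtain ⟨q₁, q₂, q₃, q₄, hq₁, hq₂, hq₃, hq₄, hcases⟩ := hg4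
  rcases hn with rfl | rfl | rfl
  · obtain ⟨h0, h1, h2, h3, h4⟩ := quartic_eq_zero (p₀ := d - κ) (p₁ := b) (p₂ := a + e)
      (p₃ := g) (p₄ := k) (fun t => by linear_combination hf t)
    have he0 : e = 0 := by
      rcases hcases with ⟨-, h5, -⟩ | ⟨-, -, -, h5, -⟩ | ⟨-, -, h5⟩
      · linear_combination hq₁ + h5 - h1 - δ * h3 - 2 * δ * h4
      · exact absurd (by linear_combination -h5 - hq₃ + h3 + h2 + (1 + 2 * δ) * h4) hκ'
      · exact absurd (by linear_combination -h5 + h4) hκ'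
    have ha0 : a = 0 := by linear_combination h2 - he0
    -- For n = n' = 0 the conic F₂ is a multiple of v². It vanishes where the line v = 0 meets H, so
    -- such a point must lie on F or G; that forces it to be (0:0:1), which H avoids because K ≠ 0.
    obtain ⟨t, ht⟩ := IsAlgClosed.exists_root
      (Polynomial.C A * Polynomial.X ^ 2 + Polynomial.C B * Polynomial.X + Polynomial.C K)
      (by rw [Polynomial.degree_quadratic hA]; norm_num)
    simp [Polynomial.IsRoot.def] at ht
    have hh : eval ![t, 0, 1] (conicH A B K) = 0 := by
      rw [eval_conicH]
      simp
      linear_combination ht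
    have ht0 : t = 0 := by
      rcases sing ![t, 0, 1] (fun h => by simpa using congrFun h 2) (by simp [hh])
        (by rw [eval_quad]; simp [ha0, h3, h4]) with h5 | h5 | h5
      · have := h5.1
        rw [eval_conicF] at this
        simpa [hc] using this
      · have := h5.1
        rw [eval_conicF] at this
        simpa [hc] using this
      · have := h5.1
        rw [eval_conicG] at this
        simpa [hc'] using this
    apply hK
    rw [ht0] at ht
    linear_combination ht
  · obtain ⟨h0, h1, h2, h3, h4⟩ := quartic_eq_zero (p₀ := d) (p₁ := b) (p₂ := a + e - κ)
      (p₃ := g) (p₄ := k) (fun t => by linear_combination hf t)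
    rcases hcases with ⟨-, -, h5, -⟩ | ⟨-, h5, h6, h7, -⟩ | ⟨-, -, h5⟩
    · exact hκ (by linear_combination -h2 + hq₃ + h5 - h3 - (1 + 2 * δ) * h4)
    -- The case n = n' = 2 is the only one compatible with r = −2δ, and it is where the torus
    -- decomposition lives.
    · have h8 : κ' * (r * (r + 2 * δ)) = 0 := by
        linear_combination -h6 - hq₂ + h0 + δ * (h5 + hq₁ - h1 - δ * h3 - 2 * δ * h4) + δ ^ 2 * h4
      exact mul_ne_zero hκ' (mul_ne_zero hr0 hr2) h8
    · exact hκ' (by linear_combination -h5 + h4)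
  · obtain ⟨h0, h1, h2, h3, h4⟩ := quartic_eq_zero (p₀ := d) (p₁ := b) (p₂ := a + e)
      (p₃ := g) (p₄ := k - κ) (fun t => by linear_combination hf t)
    rcases hcases with ⟨-, -, -, -, h5⟩ | ⟨-, -, -, -, -, h5⟩ | ⟨-, h5, h6⟩
    · exact hκ (by linear_combination -h4 + h5)
    · exact hκ (by linear_combination -h4 + h5)
    · have h7 : κ' * (2 * r + 1) = 0 := by
        linear_combination (h5 + hq₄ - h3) / 2 - h6
      exact mul_ne_zero hκ' hr1 h7

/-! ### Parameters of the conical flex points -/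

/-- The values of `δ` for which the configuration is in general position. -/
structure IsGeneralParam (δ : ℂ) : Prop where
  -- The linear conditions rule out degeneration at r = −2δ, and the first two also serve the other
  -- roots. Each quadratic one is, up to a constant, the norm from ℚ(w), with w a primitive cube
  -- root of unity, of a condition on the roots of δ = wr + (2w + 1)r².
  ne_zero : δ ≠ 0
  ne_quarter : 4 * δ - 1 ≠ 0
  ne_sixth : 6 * δ - 1 ≠ 0
  ne_third : 3 * δ - 1 ≠ 0
  contact_ne : 48 * δ ^ 2 - 12 * δ + 1 ≠ 0
  B_ne : 16 * δ ^ 2 - 4 * δ + 1 ≠ 0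
  triple_ne : 3 * δ ^ 2 - 3 * δ + 1 ≠ 0
  K_ne : 27 * δ ^ 2 - 9 * δ + 1 ≠ 0

/-- The osculating conic at the parameter `r = -2δ`. -/
lemma isGeneralOsculating_torus {δ r : ℂ} (hδ : IsGeneralParam δ) (hr : r = -2 * δ) :
    IsGeneralOsculating δ r (-(r / 2) * (2 * r + 1) ^ 2) (-(2 * r + 1)) 1 := by
  have h0 := hδ.ne_zero
  have hm : 2 * r + 1 ≠ 0 := by
    intro h
    apply hδ.ne_quarter
    linear_combination 2 * hr - h
  have hr0 : r ≠ 0 := by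
    rw [hr]
    simpa using h0
  refine ⟨⟨?_, ?_, ?_⟩, h0, ?_, neg_ne_zero.2 hm, one_ne_zero, ?_, ?_, ?_⟩
  · rw [hr]; ring
  · rw [hr]; ring
  · rw [hr]; ring
  · simp [hr0, hm]
  · intro h
    apply hδ.ne_sixth
    linear_combination 3 * hr - h
  · intro h
    apply hδ.ne_third
    linear_combination h + 2 * hr
  · intro h
    apply hm
    linear_combination h

/-- Supplies the hypotheses on r in `not_isTorusType`. The last one holds since r + 2δ = (2w +
1)r(2r + 1), where (2w + 1)² = −3. -/
lemma ne_of_cube_root {δ r w : ℂ} (hδ : IsGeneralParam δ) (hw : w ^ 2 + w + 1 = 0)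
    (hr : δ = w * r + (2 * w + 1) * r ^ 2) : r ≠ 0 ∧ 2 * r + 1 ≠ 0 ∧ r + 2 * δ ≠ 0 := by
  have hr0 : r ≠ 0 := by
    rintro rfl
    apply hδ.ne_zero
    rw [hr]
    ring
  have hm : 2 * r + 1 ≠ 0 := by
    intro h
    apply hδ.ne_quarter
    have h2 : r = -1 / 2 := by linear_combination h / 2
    rw [hr, h2]
    ring
  refine ⟨hr0, hm, ?_⟩
  intro h
  have h1 : r * (2 * r + 1) * (2 * w + 1) = 0 := by linear_combination h - 2 * hr
  have h2 : 2 * w + 1 ≠ 0 := by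
    intro h3
    have : (3 : ℂ) = 0 := by linear_combination 4 * hw - (2 * w + 1) * h3
    norm_num at this
  exact mul_ne_zero (mul_ne_zero hr0 hm) h2 h1

/-- The osculating conics at the other four flex points. -/
lemma isGeneralOsculating_cube_root {δ r w : ℂ} (hδ : IsGeneralParam δ) (hw : w ^ 2 + w + 1 = 0)
    (hr : δ = w * r + (2 * w + 1) * r ^ 2) :
    IsGeneralOsculating δ r (w * r * (2 * r + 1) ^ 2)
      (-(2 * r + 1) * ((4 + 2 * w) * r + 1)) (3 * r + 1) := by
  obtain ⟨hr0, hm, -⟩ := ne_of_cube_root hδ hw hr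
  have hw0 : w ≠ 0 := by
    rintro rfl
    norm_num at hw
  have hK : 3 * r + 1 ≠ 0 := by
    intro h
    apply hδ.K_ne
    have h2 : r = -1 / 3 := by linear_combination h / 3
    rw [hr, h2]
    linear_combination hw / 3
  have hB : (4 + 2 * w) * r + 1 ≠ 0 := by
    intro h
    apply hδ.B_ne
    have h2 : r = -(1 - w) / 6 := by linear_combination (2 - 2 * w) / 12 * h + r / 3 * hw
    have h3 : δ = -w / 4 := by
      rw [hr, h2]
      linear_combination (2 * w + 1) / 36 * hw
    rw [h3]
    linear_combination hw
  refine ⟨⟨?_, ?_, ?_⟩, hδ.ne_zero, ?_, ?_, hK, hK, ?_, ?_⟩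
  · rw [hr]
    linear_combination (-(r ^ 3 * (2 * r + 1) ^ 2)) * hw
  · rw [hr]
    linear_combination (-2 * r ^ 2 * (2 * r + 1) ^ 2) * hw
  · rw [hr]; ring
  · simp [hw0, hr0, hm]
  · exact mul_ne_zero (neg_ne_zero.2 hm) hB
  · intro h
    apply hδ.triple_ne
    -- Modulo the relations for w and δ, the quantity B − Kδ is minus a perfect cube.
    have h1 : ((2 + w) * r + 1) ^ 3 = 0 := by
      linear_combination ((w + 5) * r ^ 3 + 3 * r ^ 2) * hw - h - (3 * r + 1) * hr
    have h2 : (2 + w) * r + 1 = 0 := by simpa using h1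
    have h3 : r = -(1 - w) / 3 := by linear_combination (1 - w) / 3 * h2 + r / 3 * hw
    have h4 : δ = (1 - w) / 3 := by
      rw [hr, h3]
      linear_combination 2 * (w - 1) / 9 * hw
    rw [h4]
    linear_combination hw / 3
  · intro h
    apply hδ.contact_ne
    have h1 : (2 * r + 1) * ((2 - 2 * w) * r + 1) = 0 := by linear_combination h
    have h2 : (2 - 2 * w) * r + 1 = 0 := by simpa [hm] using h1
    have h3 : r = -(2 + w) / 6 := by linear_combination (4 + 2 * w) / 12 * h2 + r / 3 * hw
    have h4 : δ = (1 - w) / 12 := by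
      rw [hr, h3]
      linear_combination (2 * w + 1) / 36 * hw
    rw [h4]
    linear_combination hw / 3

/-- The quintic is, up to sign, the determinant of the three linear conditions on (A, B, K). -/
lemma IsOsculating.flex_equation {δ r A B K : ℂ} (h : IsOsculating δ r A B K)
    (h0 : ¬ (A = 0 ∧ B = 0 ∧ K = 0)) :
    (r + 2 * δ) * (3 * r ^ 4 + 3 * r ^ 3 + r ^ 2 + δ * r + δ ^ 2) = 0 := by
  obtain ⟨h1, h2, h3⟩ := h
  set q := r ^ 2 + r + δ with hq
  set W := (r + 2 * δ) * (3 * r ^ 4 + 3 * r ^ 3 + r ^ 2 + δ * r + δ ^ 2) with hW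
  -- Eliminate A using the slope equation, where its coefficient is −1; Cramer's rule for B and K
  -- then gives BW = KW = 0.
  have h4 : B * (r * q - (r + δ) * (q + r * (2 * r + 1))) +
      K * (q ^ 2 - 2 * (r + δ) * q * (2 * r + 1)) = 0 := by
    linear_combination h1 - (r + δ) * h2
  have hB : B * W = 0 := by
    rw [hW]
    rw [hq] at h4
    linear_combination -(6 * r ^ 2 + 6 * r + 1 + 2 * δ) * h4 +
      ((r ^ 2 + r + δ) ^ 2 - 2 * (r + δ) * (r ^ 2 + r + δ) * (2 * r + 1)) * h3
  have hK : K * W = 0 := by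
    rw [hW]
    rw [hq] at h4
    linear_combination (3 * r + 1) * h4 -
      (r * (r ^ 2 + r + δ) - (r + δ) * (r ^ 2 + r + δ + r * (2 * r + 1))) * h3
  by_contra hW0
  have hB0 : B = 0 := by simpa [hW0] using hB
  have hK0 : K = 0 := by simpa [hW0] using hK
  refine h0 ⟨?_, hB0, hK0⟩
  rw [hB0, hK0] at h2
  linear_combination -h2

/-- The discriminant w² + 4(2w + 1)δ is non-zero because its norm over ℚ(w) is 48δ² − 12δ + 1. -/
lemma exists_two_roots {δ w : ℂ} (hδ : IsGeneralParam δ) (hw : w ^ 2 + w + 1 = 0) :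
    ∃ x y : ℂ, x ≠ y ∧ ∀ t, δ = w * t + (2 * w + 1) * t ^ 2 ↔ t = x ∨ t = y := by
  obtain ⟨s, hs⟩ := IsAlgClosed.exists_pow_nat_eq (w ^ 2 + 4 * (2 * w + 1) * δ) (n := 2)
    (by norm_num)
  have hθ : 2 * w + 1 ≠ 0 := by
    intro h3
    have : (3 : ℂ) = 0 := by linear_combination 4 * hw - (2 * w + 1) * h3
    norm_num at this
  have hs0 : s ≠ 0 := by
    rintro rfl
    apply hδ.contact_ne
    have h1 : w ^ 2 + 4 * (2 * w + 1) * δ = 0 := by rw [← hs]; ring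
    linear_combination (w - 4 * (2 * w + 1) * δ) * h1 +
      (64 * δ ^ 2 - w + 1 - 4 * δ * (3 - 2 * w)) * hw
  have hθ' : 2 * (2 * w + 1) ≠ 0 := mul_ne_zero two_ne_zero hθ
  refine ⟨(-w + s) / (2 * (2 * w + 1)), (-w - s) / (2 * (2 * w + 1)), ?_, fun t => ?_⟩
  · intro h
    rw [div_left_inj' hθ'] at h
    apply hs0
    linear_combination h / 2
  · constructor
    · intro h
      have h1 : (2 * (2 * w + 1) * t + w - s) * (2 * (2 * w + 1) * t + w + s) = 0 := by
        linear_combination -hs - 4 * (2 * w + 1) * h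
      rcases mul_eq_zero.1 h1 with h1 | h1
      · left
        rw [eq_div_iff hθ']
        linear_combination h1
      · right
        rw [eq_div_iff hθ']
        linear_combination h1
    · intro h
      have h1 : (2 * (2 * w + 1) * t + w - s) * (2 * (2 * w + 1) * t + w + s) = 0 := by
        rcases h with h | h
        · have : 2 * (2 * w + 1) * t + w - s = 0 := by
            rw [h, mul_div_cancel₀ _ hθ']
            ring
          rw [this, zero_mul]
        · have : 2 * (2 * w + 1) * t + w + s = 0 := by
            rw [h, mul_div_cancel₀ _ hθ']
            ring
          rw [this, mul_zero]
      have h2 : (4 * (2 * w + 1)) * δ = (4 * (2 * w + 1)) * (w * t + (2 * w + 1) * t ^ 2) := by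
        linear_combination -hs - h1
      exact mul_left_cancel₀ (by simpa using hθ) h2

/-- The five parameters of the conical flex points. -/
lemma exists_flex_params {δ : ℂ} (hδ : IsGeneralParam δ) :
    ∃ r : Fin 5 → ℂ, Function.Injective r ∧ r 0 = -2 * δ ∧
      (∀ i ≠ 0, ∃ w, w ^ 2 + w + 1 = 0 ∧ δ = w * r i + (2 * w + 1) * r i ^ 2) ∧
      ∀ x, (x + 2 * δ) * (3 * x ^ 4 + 3 * x ^ 3 + x ^ 2 + δ * x + δ ^ 2) = 0 → ∃ i, r i = x := by
  obtain ⟨s, hs⟩ := IsAlgClosed.exists_pow_nat_eq (-3 : ℂ) (n := 2) (by norm_num)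
  obtain ⟨w, hw'⟩ : ∃ w : ℂ, w = (-1 + s) / 2 := ⟨_, rfl⟩
  have hw : w ^ 2 + w + 1 = 0 := by
    rw [hw']
    linear_combination hs / 4
  have hv : (-1 - w) ^ 2 + (-1 - w) + 1 = 0 := by linear_combination hw
  obtain ⟨x₁, y₁, hxy₁, h₁⟩ := exists_two_roots hδ hw
  obtain ⟨x₂, y₂, hxy₂, h₂⟩ := exists_two_roots hδ hv
  have hθ : 2 * w + 1 ≠ 0 := by
    intro h3
    have : (3 : ℂ) = 0 := by linear_combination 4 * hw - (2 * w + 1) * h3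
    norm_num at this
  have hdisj : ∀ t, δ = w * t + (2 * w + 1) * t ^ 2 →
      δ ≠ (-1 - w) * t + (2 * (-1 - w) + 1) * t ^ 2 := by
    intro t ht ht'
    obtain ⟨h0, h1, -⟩ := ne_of_cube_root hδ hw ht
    apply mul_ne_zero (mul_ne_zero h0 h1) hθ
    linear_combination ht' - ht
  have hx₁ := (h₁ x₁).2 (Or.inl rfl)
  have hy₁ := (h₁ y₁).2 (Or.inr rfl)
  have hx₂ := (h₂ x₂).2 (Or.inl rfl)
  have hy₂ := (h₂ y₂).2 (Or.inr rfl)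
  have hne : ∀ t v, v ^ 2 + v + 1 = 0 → δ = v * t + (2 * v + 1) * t ^ 2 → -2 * δ ≠ t := by
    intro t v hv ht h0
    apply (ne_of_cube_root hδ hv ht).2.2
    linear_combination -h0
  refine ⟨![-2 * δ, x₁, y₁, x₂, y₂], ?_, rfl, ?_, ?_⟩
  · have e₁ := hne _ _ hw hx₁
    have e₂ := hne _ _ hw hy₁
    have e₃ := hne _ _ hv hx₂
    have e₄ := hne _ _ hv hy₂
    have e₅ : x₁ ≠ x₂ := fun h => hdisj _ hx₁ (h ▸ hx₂)
    have e₆ : x₁ ≠ y₂ := fun h => hdisj _ hx₁ (h ▸ hy₂)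
    have e₇ : y₁ ≠ x₂ := fun h => hdisj _ hy₁ (h ▸ hx₂)
    have e₈ : y₁ ≠ y₂ := fun h => hdisj _ hy₁ (h ▸ hy₂)
    intro i j hij
    fin_cases i <;> fin_cases j <;> first
      | rfl | exact absurd hij e₁ | exact absurd hij e₂ | exact absurd hij e₃
      | exact absurd hij e₄ | exact absurd hij e₅ | exact absurd hij e₆ | exact absurd hij e₇
      | exact absurd hij e₈ | exact absurd hij hxy₁ | exact absurd hij hxy₂
      | exact absurd hij.symm e₁ | exact absurd hij.symm e₂ | exact absurd hij.symm e₃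
      | exact absurd hij.symm e₄ | exact absurd hij.symm e₅ | exact absurd hij.symm e₆
      | exact absurd hij.symm e₇ | exact absurd hij.symm e₈ | exact absurd hij.symm hxy₁
      | exact absurd hij.symm hxy₂
  · intro i hi
    fin_cases i
    · exact absurd rfl hi
    · exact ⟨w, hw, hx₁⟩
    · exact ⟨w, hw, hy₁⟩
    · exact ⟨_, hv, hx₂⟩
    · exact ⟨_, hv, hy₂⟩
  · intro x hx
    -- The quartic splits into two quadratics conjugate under w ↦ −1 − w.
    have hx' : (x + 2 * δ) * ((δ - (w * x + (2 * w + 1) * x ^ 2)) *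
        (δ - ((-1 - w) * x + (2 * (-1 - w) + 1) * x ^ 2))) = 0 := by
      linear_combination hx + (x + 2 * δ) * (-(4 * x ^ 4 + 4 * x ^ 3 + x ^ 2)) * hw
    rcases mul_eq_zero.1 hx' with h | h
    · exact ⟨0, by simp; linear_combination -h⟩
    rcases mul_eq_zero.1 h with h | h
    · rcases (h₁ x).1 (by linear_combination h) with h | h
      · exact ⟨1, h.symm⟩
      · exact ⟨2, h.symm⟩
    · rcases (h₂ x).1 (by linear_combination h) with h | h
      · exact ⟨3, h.symm⟩
      · exact ⟨4, h.symm⟩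

/-! ### The linear system and its conical flex points -/

/-- The conics `conicH`, in the coordinates given by `M`, as a linear family. -/
def conicFamily (M : Matrix (Fin 3) (Fin 3) ℂ) : (Fin 3 → ℂ) →ₗ[ℂ] Form where
  toFun x := pull M (conicH (x 0) (x 1) (x 2))
  map_add' x y := by
    rw [← map_add]
    congr 1
    simp only [conicH, quad, Pi.add_apply, neg_add, C_add]
    simp only [C_0]
    ring
  map_smul' c x := by
    rw [RingHom.id_apply, ← map_smul]
    congr 1
    simp only [conicH, quad, Pi.smul_apply, smul_eq_mul, smul_eq_C_mul, C_mul, C_neg, C_0]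
    ring

lemma conicFamily_apply (M : Matrix (Fin 3) (Fin 3) ℂ) (x : Fin 3 → ℂ) :
    conicFamily M x = pull M (conicH (x 0) (x 1) (x 2)) := rfl

lemma conicH_eq_zero {A B K : ℂ} (h : conicH A B K = 0) : A = 0 ∧ B = 0 ∧ K = 0 := by
  have h0 := congrArg (eval ![1, 0, 0]) h
  have h1 := congrArg (eval ![0, 0, 1]) h
  have h2 := congrArg (eval ![1, 0, 1]) h
  rw [eval_conicH] at h0 h1 h2
  simp at h0 h1 h2
  refine ⟨h0, ?_, h1⟩
  linear_combination h2 - h0 - h1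

lemma conicFamily_injective {M N : Matrix (Fin 3) (Fin 3) ℂ} (hMN : M * N = 1) :
    Function.Injective (conicFamily M) := by
  rw [← LinearMap.ker_eq_bot, LinearMap.ker_eq_bot']
  intro x hx
  rw [conicFamily_apply] at hx
  have h0 : conicH (x 0) (x 1) (x 2) = 0 := by
    rw [← pull_pull hMN (conicH (x 0) (x 1) (x 2)), hx, map_zero]
  obtain ⟨h0, h1, h2⟩ := conicH_eq_zero h0
  ext i
  fin_cases i <;> assumption

/-- The conics meeting `conicF` at `(0 : 1 : 0)` with intersection number at least `3`. -/
lemma mem_range_conicFamily_iff {M N : Matrix (Fin 3) (Fin 3) ℂ} (hMN : M * N = 1) {c : ℂ}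
    (hc : c ≠ 0) {p : Plane} (hp : HasCoords M p ![0, 1, 0]) (h : Form) :
    h ∈ LinearMap.range (conicFamily M) ↔
      h.IsHomogeneous 2 ∧ 3 ≤ interMult (pull M (conicF c)) h p := by
  obtain ⟨a, ha, hp⟩ := hp
  have harc := isArc_arcF (t := 0) hMN hc ha (by rw [hp]; simp)
  have key : ∀ F : Form, F.IsHomogeneous 2 → ((3 : ℕ∞) ≤ interMult (pull M (conicF c)) (pull M F) p ↔
      Polynomial.X ^ 3 ∣ aeval arcF F) := by
    intro F hF
    have := harc.le_interMult_iff (isHomogeneous_pull M (isHomogeneous_conicF c))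
      (isHomogeneous_pull M hF) 3
    rw [aeval_act_pull hMN, Polynomial.C_0, sub_zero] at this
    exact_mod_cast this
  constructor
  · rintro ⟨x, rfl⟩
    rw [conicFamily_apply]
    refine ⟨isHomogeneous_pull M (isHomogeneous_conicH ..),
      (key _ (isHomogeneous_conicH ..)).2 ⟨Polynomial.C (x 1) + Polynomial.C (x 2) * Polynomial.X, ?_⟩⟩
    rw [conicH, aeval_quad]
    simp [arcF, Polynomial.algebraMap_eq]
    ring
  · rintro ⟨h2, h3⟩
    have hMN' := mul_eq_one_comm.1 hMN
    rw [← pull_pull hMN' h] at h3 ⊢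
    have hN := isHomogeneous_pull N h2
    rw [key _ hN] at h3
    obtain ⟨a, b, g, d, e, k, hq⟩ := exists_eq_quad hN
    rw [hq] at h3 ⊢
    rw [← sub_zero Polynomial.X, ← Polynomial.C_0, pow_three_dvd_iff, aeval_quad] at h3
    simp [arcF, Polynomial.algebraMap_eq, pow_two] at h3
    obtain ⟨hd, hb, he⟩ := h3
    refine ⟨![a, g, k], ?_⟩
    have he' : e = -a := by linear_combination he / 2
    rw [hd, hb, he']
    rfl

lemma three_le_interMult_conicG_iff {M N : Matrix (Fin 3) (Fin 3) ℂ} (hMN : M * N = 1) {c δ t : ℂ}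
    (hc : c ≠ 0) {p : Plane} (hp : HasCoords M p ![t, 1, t ^ 2 + t + δ]) (A B K : ℂ) :
    3 ≤ interMult (pull M (conicG c δ)) (pull M (conicH A B K)) p ↔ IsOsculating δ t A B K := by
  obtain ⟨a, ha, hp⟩ := hp
  have := (isArc_arcG hMN hc ha hp).le_interMult_iff
    (isHomogeneous_pull M (isHomogeneous_conicG c δ))
    (isHomogeneous_pull M (isHomogeneous_conicH A B K)) 3
  rw [aeval_act_pull hMN, aeval_arcG_conicH, isOsculating_iff] at this
  exact_mod_cast this

/-- An osculating conic is unique up to a scalar. -/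
lemma IsOsculating.exists_eq_smul {δ r A B K A' B' K' : ℂ} (h : IsGeneralOsculating δ r A B K)
    (h' : IsOsculating δ r A' B' K') : ∃ c : ℂ, A' = c * A ∧ B' = c * B ∧ K' = c * K := by
  have hK := h.K_ne
  have hr := h.r_ne
  have hB : B' * K = K' * B := by
    apply mul_left_cancel₀ hr
    linear_combination K * h'.curvature - K' * h.curvature
  have hB' : B' = K' / K * B := by
    field_simp
    linear_combination hB
  refine ⟨K' / K, ?_, hB', ?_⟩
  · have hs := h'.slope
    have hs' := h.slope
    field_simp
    linear_combination K' * hs' - K * hs +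
      ((r ^ 2 + r + δ) + r * (2 * r + 1)) * hB
  · field_simp

/-- The configuration of three conics in normal form. -/
theorem normal_form_configuration {M N : Matrix (Fin 3) (Fin 3) ℂ} (hMN : M * N = 1) {c c' δ : ℂ}
    (hc : c ≠ 0) (hc' : c' ≠ 0) (hδ : IsGeneralParam δ) {p₁ p₂ : Plane}
    (h₁ : HasCoords M p₁ ![0, 0, 1]) (h₂ : HasCoords M p₂ ![0, 1, 0]) :
    ∃ Φ : Submodule ℂ Form,
      (∀ h, h ∈ Φ ↔ h.IsHomogeneous 2 ∧ 3 ≤ interMult (pull M (conicF c)) h p₂) ∧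
      Module.finrank ℂ Φ = 3 ∧
      ∃ Q : Fin 5 → Plane,
        Function.Injective Q ∧ (∀ i, Q i ≠ p₁) ∧
        {P | IsConicalFlex Φ (pull M (conicG c' δ)) P} = insert p₁ (Set.range Q) ∧
        ∀ i, ∃ h ∈ Φ, h ≠ 0 ∧ 3 ≤ interMult (pull M (conicG c' δ)) h (Q i) ∧
          (∀ h' ∈ Φ, 3 ≤ interMult (pull M (conicG c' δ)) h' (Q i) → ∃ c : ℂ, h' = c • h) ∧
          IsConic h ∧
          HasSingularities3A5And3A1 (pull M (conicF c) * pull M (conicG c' δ) * h)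
            {p₁, p₂, Q i} ∧
          (IsTorusType (pull M (conicF c) * pull M (conicG c' δ) * h) ↔ i = 0) := by
  have hfin : Module.finrank ℂ (LinearMap.range (conicFamily M)) = 3 := by
    rw [LinearMap.finrank_range_of_inj (conicFamily_injective hMN)]
    simp
  obtain ⟨r, hinj, hr0, hri, hroots⟩ := exists_flex_params hδ
  let Q : Fin 5 → Plane := fun i => point hMN ![r i, 1, r i ^ 2 + r i + δ]
    (fun h => by simpa using congrFun h 1)
  have hQ : ∀ i, HasCoords M (Q i) ![r i, 1, r i ^ 2 + r i + δ] := fun i => hasCoords_point hMN _ _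
  have hosc : ∀ i, ∃ A B K, IsGeneralOsculating δ (r i) A B K ∧
      (IsTorusType (conicF c * conicG c' δ * conicH A B K) ↔ i = 0) := by
    intro i
    by_cases hi : i = 0
    · subst hi
      refine ⟨_, _, _, isGeneralOsculating_torus hδ hr0, ?_⟩
      have hm : 2 * r 0 + 1 ≠ 0 := by
        intro h
        apply hδ.ne_quarter
        linear_combination 2 * hr0 - h
      have := isTorusType_conics hc hc' hm
      rw [show -r 0 / 2 = δ by rw [hr0]; ring] at this
      simpa using this
    · obtain ⟨w, hw, hwr⟩ := hri i hi
      have hgen := isGeneralOsculating_cube_root hδ hw hwr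
      obtain ⟨e1, e2, e3⟩ := ne_of_cube_root hδ hw hwr
      refine ⟨_, _, _, hgen, ?_⟩
      simpa [hi] using not_isTorusType hc hc' hgen e1 e2 e3
  have hsmG := smooth_pull hMN (smooth_conicG hc' δ)
  have hG2 := isHomogeneous_conicG c' δ
  refine ⟨LinearMap.range (conicFamily M), mem_range_conicFamily_iff hMN hc h₂, hfin, Q, ?_, ?_, ?_,
    ?_⟩
  · intro i j hij
    apply hinj
    obtain ⟨x, hx⟩ := (hij ▸ hQ i).exists_eq_smul (hQ j)
    have hx0 := congrFun hx 0
    have hx1 := congrFun hx 1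
    simp at hx0 hx1
    rw [← hx1, one_mul] at hx0
    exact hx0
  · intro i hi
    obtain ⟨x, hx⟩ := (hQ i).exists_eq_smul (hi ▸ h₁)
    simpa using congrFun hx 1
  · ext P
    simp only [Set.mem_ofPred_eq, Set.mem_insert_iff, Set.mem_range]
    unfold IsConicalFlex
    rw [hfin]
    constructor
    · rintro ⟨⟨hP, -⟩, h, ⟨x, rfl⟩, h0, h3⟩
      rcases hasCoords_of_mem_G hMN hc' hP with hP | ⟨t, hP⟩
      · exact Or.inl (hP.eq hMN h₁)
      · right
        rw [conicFamily_apply, Nat.cast_ofNat, three_le_interMult_conicG_iff hMN hc' hP] at h3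
        obtain ⟨i, hi⟩ := hroots t (h3.flex_equation fun hz => h0 (by
          rw [conicFamily_apply, hz.1, hz.2.1, hz.2.2]
          simp [conicH, quad]))
        refine ⟨i, ?_⟩
        rw [← hi] at hP
        exact (hQ i).eq hMN hP
    · rintro (rfl | ⟨i, rfl⟩)
      -- At P₁ the witness is the first conic of the pair itself, up to a scalar.
      · refine ⟨⟨?_, hsmG _ P.rep_nonzero⟩, pull M (conicH 1 0 0), ⟨![1, 0, 0], rfl⟩,
          pull_ne_zero hMN fun h => one_ne_zero (conicH_eq_zero h).1, ?_⟩
        · rw [h₁.eval_eq_zero_iff hG2, eval_conicG]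
          simp
        · obtain ⟨a, ha, h₁⟩ := h₁
          rw [(isArc_arcG' hMN hc' ha h₁).le_interMult_iff (isHomogeneous_pull M hG2)
            (isHomogeneous_pull M (isHomogeneous_conicH ..)), aeval_act_pull hMN, conicH,
            aeval_quad]
          refine ⟨-1 - Polynomial.C δ * Polynomial.X, ?_⟩
          simp [arcG']
          ring
      · obtain ⟨A, B, K, hgen, -⟩ := hosc i
        refine ⟨⟨?_, hsmG _ (Q i).rep_nonzero⟩, pull M (conicH A B K), ⟨![A, B, K], rfl⟩,
          pull_ne_zero hMN fun h => hgen.A_ne (conicH_eq_zero h).1, ?_⟩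
        · rw [(hQ i).eval_eq_zero_iff hG2, eval_conicG]
          simp
          ring_nf
          simp
        · rw [Nat.cast_ofNat, three_le_interMult_conicG_iff hMN hc' (hQ i)]
          exact hgen.toIsOsculating
  · intro i
    obtain ⟨A, B, K, hgen, htor⟩ := hosc i
    refine ⟨pull M (conicH A B K), ⟨![A, B, K], rfl⟩,
      pull_ne_zero hMN fun h => hgen.A_ne (conicH_eq_zero h).1, ?_, ?_, ?_, ?_, ?_⟩
    · rw [three_le_interMult_conicG_iff hMN hc' (hQ i)]
      exact hgen.toIsOsculating
    · rintro h' ⟨x, rfl⟩ h3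
      rw [conicFamily_apply, three_le_interMult_conicG_iff hMN hc' (hQ i)] at h3
      obtain ⟨s, hA, hB, hK⟩ := IsOsculating.exists_eq_smul hgen h3
      refine ⟨s, ?_⟩
      have h1 : conicFamily M x = conicFamily M (s • ![A, B, K]) := by
        congr 1
        ext j
        fin_cases j
        · simpa using hA
        · simpa using hB
        · simpa using hK
      rw [h1, map_smul]
      rfl
    · exact isConic_pull hMN (isHomogeneous_conicH ..) (smooth_conicH hgen.A_ne B K)
    · exact hasSingularities hMN hc hc' hgen h₁ h₂ (hQ i)
    · rw [← map_mul, ← map_mul, isTorusType_pull_iff hMN]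
      exact htor

/-! ### Coordinates adapted to a pair of conics -/

/-- The coordinates `s x`, `y - z`, `k (y + z)`. -/
def frame (s k : ℂ) : Matrix (Fin 3) (Fin 3) ℂ := !![s, 0, 0; 0, 1, -1; 0, k, k]

/-- The inverse of `frame s k`. -/
def coframe (s k : ℂ) : Matrix (Fin 3) (Fin 3) ℂ :=
  !![s⁻¹, 0, 0; 0, 1 / 2, 1 / 2 * k⁻¹; 0, -1 / 2, 1 / 2 * k⁻¹]

lemma frame_mul_coframe {s k : ℂ} (hs : s ≠ 0) (hk : k ≠ 0) : frame s k * coframe s k = 1 := by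
  ext i j
  fin_cases i <;> fin_cases j <;>
    simp [frame, coframe, Matrix.mul_apply, Fin.sum_univ_three, hs] <;> norm_num
  field_simp
  norm_num

lemma act_frame (s k : ℂ) (v : Fin 3 → ℂ) :
    act (frame s k) v = ![s * v 0, v 1 - v 2, k * (v 1 + v 2)] := by
  ext i
  fin_cases i <;> simp [act, frame, Fin.sum_univ_three] <;> ring

lemma exists_rep_P₁ : ∃ a : ℂ, a ≠ 0 ∧ P₁.rep = a • ![0, 1, 1] := by
  obtain ⟨a, ha⟩ := Projectivization.exists_smul_eq_mk_rep ℂ ![(0 : ℂ), 1, 1]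
    (fun h => by simpa using congrFun h 1)
  exact ⟨a, a.ne_zero, ha.symm⟩

lemma exists_rep_P₂ : ∃ a : ℂ, a ≠ 0 ∧ P₂.rep = a • ![0, -1, 1] := by
  obtain ⟨a, ha⟩ := Projectivization.exists_smul_eq_mk_rep ℂ ![(0 : ℂ), -1, 1]
    (fun h => by simpa using congrFun h 1)
  exact ⟨a, a.ne_zero, ha.symm⟩

lemma hasCoords_P₁ (s : ℂ) {k : ℂ} (hk : k ≠ 0) : HasCoords (frame s k) P₁ ![0, 0, 1] := by
  obtain ⟨a, ha, h⟩ := exists_rep_P₁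
  refine ⟨k * (2 * a), by simp [ha, hk], ?_⟩
  rw [h, act_frame]
  ext i
  fin_cases i <;> simp
  left
  ring

lemma hasCoords_P₂ (s k : ℂ) : HasCoords (frame s k) P₂ ![0, 1, 0] := by
  obtain ⟨a, ha, h⟩ := exists_rep_P₂
  refine ⟨-2 * a, by simp [ha], ?_⟩
  rw [h, act_frame]
  ext i
  fin_cases i <;> simp
  ring

/-! ### The family of pairs -/

/-- The conics touching `y = 1` at `P₁` and `y = -1` at `P₂`. -/
def pairF (a b : ℂ) : Form := quad b 0 0 a 0 (-a)

/-- The conics meeting `pairF a b` at `P₁` with intersection number at least `3`. -/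
def pairG (a b α β γ : ℂ) : Form :=
  quad (α * b) β (-β) (α * a + γ) (-2 * γ) (-(α * a) + γ)

lemma pull_conicF {s k c a b : ℂ} (hb : b = c * s ^ 2) (ha : a = -(c * k)) :
    pull (frame s k) (conicF c) = pairF a b := by
  apply MvPolynomial.funext
  intro v
  rw [eval_pull, act_frame, eval_conicF, pairF, eval_quad, ha, hb]
  simp
  ring

lemma pull_quad_eq_pairG {s k a b α β γ x y z : ℂ} (h1 : α * b = x * s ^ 2)
    (h2 : α * a = -(x * k)) (h3 : β = s * y) (h4 : γ = z) :
    pull (frame s k) (quad x y 0 z (-x) 0) = pairG a b α β γ := by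
  apply MvPolynomial.funext
  intro v
  rw [eval_pull, act_frame, eval_quad, pairG, eval_quad, h1, h2, h3, h4]
  simp
  ring

lemma interMult_comm (F G : Form) (P : Plane) : interMult F G P = interMult G F P := by
  rw [interMult, interMult, Set.pair_comm]

lemma isArc_line₁ : IsArc ![Polynomial.X, 1, 1] 0 (X 1 - X 2) P₁ := by
  obtain ⟨a, ha, h⟩ := exists_rep_P₁
  refine ⟨⟨a⁻¹, inv_ne_zero ha, ?_⟩, fun κ => ⟨0, ?_⟩, by simp, ⟨1, by simp [pderiv_X]⟩⟩
  · rw [h, smul_smul, inv_mul_cancel₀ ha, one_smul]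
    ext i
    fin_cases i <;> simp [arcEval]
  · simp [arcEval]

lemma isArc_line₂ : IsArc ![Polynomial.X, -1, 1] 0 (X 1 + X 2) P₂ := by
  obtain ⟨a, ha, h⟩ := exists_rep_P₂
  refine ⟨⟨a⁻¹, inv_ne_zero ha, ?_⟩, fun κ => ⟨0, ?_⟩, by simp, ⟨1, by simp [pderiv_X]⟩⟩
  · rw [h, smul_smul, inv_mul_cancel₀ ha, one_smul]
    ext i
    fin_cases i <;> simp [arcEval]
  · simp [arcEval]

/-- The order is taken along the line, which has an evident parametrization; symmetry of the
intersection number allows this. -/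
lemma two_le_interMult_line₁_iff {F : Form} (hF : F.IsHomogeneous 2) :
    2 ≤ interMult F (X 1 - X 2) P₁ ↔
      Polynomial.X ^ 2 ∣ aeval ![Polynomial.X, (1 : Polynomial ℂ), 1] F := by
  have h1 : (X 1 - X 2 : Form).IsHomogeneous 1 := (isHomogeneous_X ℂ _).sub (isHomogeneous_X ℂ _)
  have := isArc_line₁.le_interMult_iff h1 hF 2
  rw [Polynomial.C_0, sub_zero, interMult_comm] at this
  exact_mod_cast this

lemma two_le_interMult_line₂_iff {F : Form} (hF : F.IsHomogeneous 2) :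
    2 ≤ interMult F (X 1 + X 2) P₂ ↔
      Polynomial.X ^ 2 ∣ aeval ![Polynomial.X, (-1 : Polynomial ℂ), 1] F := by
  have h1 : (X 1 + X 2 : Form).IsHomogeneous 1 := (isHomogeneous_X ℂ _).add (isHomogeneous_X ℂ _)
  have := isArc_line₂.le_interMult_iff h1 hF 2
  rw [Polynomial.C_0, sub_zero, interMult_comm] at this
  exact_mod_cast this

lemma le_interMult_P₁_iff {s k c : ℂ} (hs : s ≠ 0) (hk : k ≠ 0) (hc : c ≠ 0) {F : Form}
    (hF : F.IsHomogeneous 2) (n : ℕ) :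
    n ≤ interMult (pull (frame s k) (conicF c)) (pull (frame s k) F) P₁ ↔
      Polynomial.X ^ n ∣ aeval arcF' F := by
  have hMN := frame_mul_coframe hs hk
  obtain ⟨a, ha, hP⟩ := hasCoords_P₁ s hk
  have := (isArc_arcF' hMN hc ha hP).le_interMult_iff
    (isHomogeneous_pull (frame s k) (isHomogeneous_conicF c))
    (isHomogeneous_pull (frame s k) hF) n
  rwa [aeval_act_pull hMN, Polynomial.C_0, sub_zero] at this

lemma not_isUnit_of_isHomogeneous_one {F : Form} (hF : F.IsHomogeneous 1) : ¬ IsUnit F := by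
  intro hu
  obtain ⟨c, hc, rfl⟩ := MvPolynomial.isUnit_iff_eq_C_of_isReduced.1 hu
  have h0 : (C c : Form) ≠ 0 := by simpa using hc.ne_zero
  exact zero_ne_one ((isHomogeneous_C (Fin 3) c).inj_right hF h0)

lemma not_irreducible_mul {F G : Form} (hF : F.IsHomogeneous 1) (hG : G.IsHomogeneous 1) :
    ¬ Irreducible (F * G) := fun h =>
  (h.isUnit_or_isUnit rfl).elim (not_isUnit_of_isHomogeneous_one hF)
    (not_isUnit_of_isHomogeneous_one hG)

/-- Every pair of the family is of the form `pairF`, `pairG`. -/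
lemma IsConicPair.exists_eq {f g : Form} (h : IsConicPair f g) :
    ∃ a b α β γ : ℂ, a ≠ 0 ∧ b ≠ 0 ∧ α ≠ 0 ∧ β ≠ 0 ∧ f = pairF a b ∧ g = pairG a b α β γ := by
  obtain ⟨⟨hf2, hf⟩, ⟨hg2, hg⟩, ht1, ht2, hcon⟩ := h
  have hX : ∀ i : Fin 3, (X i : Form).IsHomogeneous 1 := fun i => isHomogeneous_X ℂ i
  rw [two_le_interMult_line₁_iff hf2] at ht1
  rw [two_le_interMult_line₂_iff hf2] at ht2
  obtain ⟨a', b', c', d', e', k', hfq⟩ := exists_eq_quad hf2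
  obtain ⟨a, b, ha, hb, hfe⟩ : ∃ a b : ℂ, a ≠ 0 ∧ b ≠ 0 ∧ f = pairF a b := by
    rw [hfq, aeval_quad, Polynomial.X_pow_dvd_iff] at ht1 ht2
    have h10 := ht1 0 (by norm_num)
    have h11 := ht1 1 (by norm_num)
    have h20 := ht2 0 (by norm_num)
    have h21 := ht2 1 (by norm_num)
    simp [Polynomial.algebraMap_eq, Polynomial.coeff_X, Polynomial.coeff_C,
      Polynomial.coeff_X_pow] at h10 h11 h20 h21
    have e1 : e' = 0 := by linear_combination (h10 - h20) / 2
    have e2 : k' = -d' := by linear_combination (h10 + h20) / 2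
    have e3 : b' = 0 := by linear_combination (h11 - h21) / 2
    have e4 : c' = 0 := by linear_combination (h11 + h21) / 2
    have hfe : f = pairF d' a' := by rw [hfq, e1, e2, e3, e4, pairF]
    refine ⟨d', a', ?_, ?_, hfe⟩
    -- With a = 0 the conic is a double line, and with b = 0 a pair of lines; irreducibility
    -- excludes both.
    · rintro rfl
      apply not_irreducible_mul ((hX 0).C_mul a') (hX 0)
      convert hf using 1
      rw [hfe, pairF, quad]
      simp
      ring
    · rintro rfl
      apply not_irreducible_mul (((hX 1).sub (hX 2)).C_mul d') ((hX 1).add (hX 2))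
      convert hf using 1
      rw [hfe, pairF, quad]
      simp
      ring
  have hk : -(a / b) ≠ 0 := by simp [ha, hb]
  -- A preliminary frame that normalizes only f; g is handled by reading off its coefficients along
  -- f.
  have hMN := frame_mul_coframe one_ne_zero hk
  have hfp : pull (frame 1 (-(a / b))) (conicF b) = f := by
    rw [hfe]
    refine pull_conicF (by ring) ?_
    field_simp
  have hgN := isHomogeneous_pull (coframe 1 (-(a / b))) hg2
  have hgp := pull_pull (mul_eq_one_comm.1 hMN) g
  obtain ⟨x, y, u, z, e, k, hq⟩ := exists_eq_quad hgN
  have key := fun n : ℕ => le_interMult_P₁_iff one_ne_zero hk hb hgN n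
  simp only [hfp, hgp, hcon] at key
  have h3 := (key 3).1 (by norm_num)
  have h4 := mt (key 4).2 (by rw [not_le]; exact_mod_cast (by norm_num : (3 : ℕ) < 4))
  rw [hq, aeval_quad, Polynomial.X_pow_dvd_iff] at h3
  have h30 := h3 0 (by norm_num)
  have h31 := h3 1 (by norm_num)
  have h32 := h3 2 (by norm_num)
  simp [arcF', Polynomial.algebraMap_eq, Polynomial.coeff_X, Polynomial.coeff_C, ← pow_mul,
    ← pow_succ', Polynomial.coeff_X_pow] at h30 h31 h32
  have he : e = -x := by linear_combination h32
  -- With y = 0 the contact at P₁ would be at least 4.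
  have hy : y ≠ 0 := by
    rintro rfl
    apply h4
    refine ⟨Polynomial.C z, ?_⟩
    rw [hq, aeval_quad, h30, h31, he]
    simp [arcF', Polynomial.algebraMap_eq]
    left
    ring
  have hge : g = pairG a b (x / b) y z := by
    rw [← hgp, hq, h30, h31, he]
    refine pull_quad_eq_pairG ?_ ?_ (by ring) rfl
    · field_simp
    · field_simp
  refine ⟨a, b, x / b, y, z, ha, hb, ?_, hy, hfe, hge⟩
  -- With α = 0 the tangent line y = z would be a component of g.
  intro hx
  apply not_irreducible_mul (((hX 0).C_mul y).add (((hX 1).sub (hX 2)).C_mul z))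
    ((hX 1).sub (hX 2))
  convert hg using 1
  rw [hge, hx]
  apply MvPolynomial.funext
  intro v
  rw [pairG, eval_quad]
  simp
  ring

/-- The normal form of a pair of the family. -/
lemma exists_normal_form {a b α β : ℂ} (γ : ℂ) (ha : a ≠ 0) (hb : b ≠ 0) (hα : α ≠ 0)
    (hβ : β ≠ 0) : ∃ s k c c' : ℂ, s ≠ 0 ∧ k ≠ 0 ∧ c ≠ 0 ∧ c' ≠ 0 ∧
      pull (frame s k) (conicF c) = pairF a b ∧
      pull (frame s k) (conicG c' (γ * α * b / β ^ 2)) = pairG a b α β γ := by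
  -- The scalings of u and w are forced by making the coefficients of u², uv and −vw in g equal; f
  -- then becomes a multiple of u² − vw.
  refine ⟨α * b / β, -(a * α ^ 2 * b / β ^ 2), β ^ 2 / (α ^ 2 * b), β ^ 2 / (α * b), ?_, ?_, ?_, ?_,
    pull_conicF ?_ ?_, pull_quad_eq_pairG ?_ ?_ ?_ ?_⟩
  · simp [hα, hb, hβ]
  · simp [ha, hα, hb, hβ]
  · simp [hα, hb, hβ]
  · simp [hα, hb, hβ]
  all_goals field_simp

lemma isConicPair_pairF_pairG {a b α β : ℂ} (γ : ℂ) (ha : a ≠ 0) (hb : b ≠ 0) (hα : α ≠ 0)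
    (hβ : β ≠ 0) : IsConicPair (pairF a b) (pairG a b α β γ) := by
  obtain ⟨s, k, c, c', hs, hk, hc, hc', hF, hG⟩ := exists_normal_form γ ha hb hα hβ
  have hMN := frame_mul_coframe hs hk
  refine ⟨?_, ?_, ?_, ?_, ?_⟩
  · rw [← hF]
    exact isConic_pull hMN (isHomogeneous_conicF c) (smooth_conicF hc)
  · rw [← hG]
    exact isConic_pull hMN (isHomogeneous_conicG ..) (smooth_conicG hc' _)
  · rw [pairF, two_le_interMult_line₁_iff (isHomogeneous_quad ..), aeval_quad]
    exact ⟨Polynomial.C b, by simp [Polynomial.algebraMap_eq]⟩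
  · rw [pairF, two_le_interMult_line₂_iff (isHomogeneous_quad ..), aeval_quad]
    exact ⟨Polynomial.C b, by simp [Polynomial.algebraMap_eq]⟩
  · have key := fun n : ℕ =>
      le_interMult_P₁_iff hs hk hc (isHomogeneous_conicG c' (γ * α * b / β ^ 2)) n
    simp only [hF, hG] at key
    set δ := γ * α * b / β ^ 2
    have hval : aeval arcF' (conicG c' δ) =
        Polynomial.X ^ 3 * (Polynomial.C c' * (1 + Polynomial.C δ * Polynomial.X)) := by
      rw [conicG, aeval_quad]
      simp [arcF', Polynomial.algebraMap_eq]
      ring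
    have h3 := (key 3).2 (by rw [hval]; exact dvd_mul_right _ _)
    have h4 := mt (key 4).1 (by
      rw [hval, pow_succ, mul_dvd_mul_iff_left (pow_ne_zero 3 Polynomial.X_ne_zero),
        Polynomial.X_dvd_iff]
      simpa using hc')
    rw [not_le] at h4
    refine le_antisymm ?_ (by exact_mod_cast h3)
    exact Order.le_of_lt_add_one (by exact_mod_cast h4)

/-! ### Generic pairs -/

lemma coeff_quad (m : Fin 3 →₀ ℕ) (a b c d e k : ℂ) :
    coeff m (quad a b c d e k) = a * coeff m (X 0 ^ 2 : Form) + b * coeff m (X 0 * X 1 : Form) +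
      c * coeff m (X 0 * X 2 : Form) + d * coeff m (X 1 ^ 2 : Form) +
      e * coeff m (X 1 * X 2 : Form) + k * coeff m (X 2 ^ 2 : Form) := by
  simp only [quad, coeff_add, coeff_C_mul]

/-- The exponent of `x^i y^j z^k`. -/
def expo (i j k : ℕ) : Fin 3 →₀ ℕ := Finsupp.equivFunOnFinite.symm ![i, j, k]

lemma X_pow_two_eq (i : Fin 3) : (X i ^ 2 : Form) = monomial (Finsupp.single i 2) 1 := by
  rw [X_pow_eq_monomial]

lemma X_mul_X_eq (i j : Fin 3) :
    (X i * X j : Form) = monomial (Finsupp.single i 1 + Finsupp.single j 1) 1 := by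
  simp [X, monomial_mul]

lemma coeff_quad_xx (a b c d e k : ℂ) : coeff (expo 2 0 0) (quad a b c d e k) = a := by
  rw [coeff_quad]
  simp [X_pow_two_eq, X_mul_X_eq, coeff_monomial, expo, Finsupp.ext_iff, Fin.forall_fin_succ,
    Finsupp.single_apply]

lemma coeff_quad_xy (a b c d e k : ℂ) : coeff (expo 1 1 0) (quad a b c d e k) = b := by
  rw [coeff_quad]
  simp [X_pow_two_eq, X_mul_X_eq, coeff_monomial, expo, Finsupp.ext_iff, Fin.forall_fin_succ,
    Finsupp.single_apply]

lemma coeff_quad_yz (a b c d e k : ℂ) : coeff (expo 0 1 1) (quad a b c d e k) = e := by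
  rw [coeff_quad]
  simp [X_pow_two_eq, X_mul_X_eq, coeff_monomial, expo, Finsupp.ext_iff, Fin.forall_fin_succ,
    Finsupp.single_apply]

/-- The product of the polynomials excluded by `IsGeneralParam`, homogenised:
its value at `(n, m)` is non-zero iff `n / m` is general, provided `m ≠ 0`. -/
def excluded {R : Type*} [CommRing R] (n m : R) : R :=
  n * (4 * n - m) * (6 * n - m) * (3 * n - m) * (48 * n ^ 2 - 12 * n * m + m ^ 2) *
    (16 * n ^ 2 - 4 * n * m + m ^ 2) * (3 * n ^ 2 - 3 * n * m + m ^ 2) *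
    (27 * n ^ 2 - 9 * n * m + m ^ 2)

lemma isGeneralParam_div {n m : ℂ} (hm : m ≠ 0) (h : excluded n m ≠ 0) :
    IsGeneralParam (n / m) := by
  simp only [excluded, mul_ne_zero_iff] at h
  obtain ⟨⟨⟨⟨⟨⟨⟨h1, h2⟩, h3⟩, h4⟩, h5⟩, h6⟩, h7⟩, h8⟩ := h
  have hn : n = n / m * m := by field_simp
  generalize n / m = δ at hn
  subst hn
  constructor <;> intro h0
  · exact h1 (by rw [h0, zero_mul])
  · exact h2 (by linear_combination m * h0)
  · exact h3 (by linear_combination m * h0)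
  · exact h4 (by linear_combination m * h0)
  · exact h5 (by linear_combination m ^ 2 * h0)
  · exact h6 (by linear_combination m ^ 2 * h0)
  · exact h7 (by linear_combination m ^ 2 * h0)
  · exact h8 (by linear_combination m ^ 2 * h0)

/-- A polynomial in the coefficients of a pair of conics that vanishes on the special pairs. -/
def discr : MvPolynomial ((Fin 3 →₀ ℕ) ⊕ (Fin 3 →₀ ℕ)) ℂ :=
  excluded (C (-1 / 2) * X (Sum.inr (expo 0 1 1)) * X (Sum.inr (expo 2 0 0)))
    (X (Sum.inr (expo 1 1 0)) ^ 2)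

/-- The coefficients of yz, x² and xy in g are −2γ, αb and β, so δ = γαb/β² can be read off g alone.
-/
lemma evalCoeffs_discr (f : Form) (a b α β γ : ℂ) :
    evalCoeffs discr f (pairG a b α β γ) = excluded (γ * α * b) (β ^ 2) := by
  have h : -1 / 2 * (-2 * γ) * (α * b) = γ * α * b := by ring
  rw [← h]
  simp [evalCoeffs, discr, excluded, pairG, coeff_quad_xx, coeff_quad_xy, coeff_quad_yz]

/-- The coefficient at `m` of a quadratic form whose coefficients are polynomials. -/
def quadCoeff {σ : Type*} (m : Fin 3 →₀ ℕ) (a b c d e k : MvPolynomial σ ℂ) : MvPolynomial σ ℂ :=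
  a * C (coeff m (X 0 ^ 2 : Form)) + b * C (coeff m (X 0 * X 1 : Form)) +
    c * C (coeff m (X 0 * X 2 : Form)) + d * C (coeff m (X 1 ^ 2 : Form)) +
    e * C (coeff m (X 1 * X 2 : Form)) + k * C (coeff m (X 2 ^ 2 : Form))

lemma eval_quadCoeff {σ : Type*} (p : σ → ℂ) (m : Fin 3 →₀ ℕ)
    (a b c d e k : MvPolynomial σ ℂ) :
    eval p (quadCoeff m a b c d e k) =
      coeff m (quad (eval p a) (eval p b) (eval p c) (eval p d) (eval p e) (eval p k)) := by
  simp only [quadCoeff, coeff_quad, map_add, map_mul, eval_C]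

/-- A polynomial in the coefficients of a pair of conics, as a polynomial in the parameters of the
family. -/
def paramPoly (E : MvPolynomial ((Fin 3 →₀ ℕ) ⊕ (Fin 3 →₀ ℕ)) ℂ) : MvPolynomial (Fin 5) ℂ :=
  aeval (Sum.elim (fun m => quadCoeff m (X 1) 0 0 (X 0) 0 (-X 0))
    (fun m => quadCoeff m (X 2 * X 1) (X 3) (-X 3) (X 2 * X 0 + X 4) (-2 * X 4)
      (-(X 2 * X 0) + X 4))) E

lemma eval_paramPoly (p : Fin 5 → ℂ) (E : MvPolynomial ((Fin 3 →₀ ℕ) ⊕ (Fin 3 →₀ ℕ)) ℂ) :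
    eval p (paramPoly E) =
      evalCoeffs E (pairF (p 0) (p 1)) (pairG (p 0) (p 1) (p 2) (p 3) (p 4)) := by
  rw [paramPoly, evalCoeffs]
  induction E using MvPolynomial.induction_on with
  | C a => simp [algebraMap_eq]
  | add E₁ E₂ h₁ h₂ => simp only [map_add, h₁, h₂]
  | mul_X E i h =>
    rw [map_mul, map_mul, map_mul, h, aeval_X, eval_X]
    congr 1
    rcases i with m | m <;> simp [eval_quadCoeff, pairF, pairG]

lemma isConicPair_one : IsConicPair (pairF 1 1) (pairG 1 1 1 1 1) :=
  isConicPair_pairF_pairG 1 one_ne_zero one_ne_zero one_ne_zero one_ne_zero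

lemma evalCoeffs_discr_one : evalCoeffs discr (pairF 1 1) (pairG 1 1 1 1 1) ≠ 0 := by
  rw [evalCoeffs_discr, excluded]
  norm_num

/-- A polynomial that vanishes on the general pairs vanishes on all pairs. -/
lemma evalCoeffs_eq_zero_of_generic {E : MvPolynomial ((Fin 3 →₀ ℕ) ⊕ (Fin 3 →₀ ℕ)) ℂ}
    (hE : ∀ f g, IsConicPair f g → evalCoeffs discr f g ≠ 0 → evalCoeffs E f g = 0)
    {f g : Form} (h : IsConicPair f g) : evalCoeffs E f g = 0 := by
  -- This product vanishes at every parameter: where the second factor is non-zero, the parameters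
  -- give a general pair of the family. In a domain one factor must be zero.
  have hprod : paramPoly E * (paramPoly discr * (X 0 * X 1 * X 2 * X 3)) = 0 := by
    apply MvPolynomial.funext
    intro p
    rw [map_mul, map_mul, map_zero, mul_eq_zero, or_iff_not_imp_right, eval_paramPoly,
      eval_paramPoly]
    intro hp
    simp only [map_mul, eval_X, mul_eq_zero, not_or] at hp
    obtain ⟨hD, ⟨⟨h0, h1⟩, h2⟩, h3⟩ := hp
    exact hE _ _ (isConicPair_pairF_pairG _ h0 h1 h2 h3) hD
  have hD : paramPoly discr ≠ 0 := by
    intro h0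
    have := eval_paramPoly (fun _ => 1) discr
    rw [h0, map_zero] at this
    exact evalCoeffs_discr_one this.symm
  have hE0 : paramPoly E = 0 := by
    simpa [hD, X_ne_zero] using hprod
  obtain ⟨a, b, α, β, γ, -, -, -, -, rfl, rfl⟩ := h.exists_eq
  simpa [hE0] using (eval_paramPoly ![a, b, α, β, γ] E).symm

end ThreeConics

end

/-! ### Reduction of a generic pair to the normal form -/

theorem mainTheorem8 :
    ThreeConics.HoldsGenerically ThreeConics.IsConicPair fun f g =>
      ∃ Φ : Submodule ℂ ThreeConics.Form,
        (∀ h, h ∈ Φ ↔ h.IsHomogeneous 2 ∧ 3 ≤ ThreeConics.interMult f h ThreeConics.P₂) ∧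
        Module.finrank ℂ Φ = 3 ∧
        ∃ Q : Fin 5 → ThreeConics.Plane,
          Function.Injective Q ∧ (∀ i, Q i ≠ ThreeConics.P₁) ∧
          {P | ThreeConics.IsConicalFlex Φ g P} = insert ThreeConics.P₁ (Set.range Q) ∧
          ∀ i, ∃ h ∈ Φ, h ≠ 0 ∧ 3 ≤ ThreeConics.interMult g h (Q i) ∧
            (∀ h' ∈ Φ, 3 ≤ ThreeConics.interMult g h' (Q i) → ∃ c : ℂ, h' = c • h) ∧
            ThreeConics.IsConic h ∧
            ThreeConics.HasSingularities3A5And3A1 (f * g * h)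
              {ThreeConics.P₁, ThreeConics.P₂, Q i} ∧
            (ThreeConics.IsTorusType (f * g * h) ↔ i = 0) := by
  refine ⟨ThreeConics.discr, ⟨_, _, ThreeConics.isConicPair_one, ThreeConics.evalCoeffs_discr_one⟩,
    fun E hE f g h => ThreeConics.evalCoeffs_eq_zero_of_generic hE h, fun f g h hD => ?_⟩
  obtain ⟨a, b, α, β, γ, ha, hb, hα, hβ, rfl, rfl⟩ := h.exists_eq
  obtain ⟨s, k, c, c', hs, hk, hc, hc', hF, hG⟩ := ThreeConics.exists_normal_form γ ha hb hα hβ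
  rw [ThreeConics.evalCoeffs_discr] at hD
  -- The normal form theorem concerns pulled-back forms in an arbitrary frame, so it applies to the
  -- original pair and to the points P₁, P₂ directly.
  rw [← hF, ← hG]
  exact ThreeConics.normal_form_configuration (ThreeConics.frame_mul_coframe hs hk) hc hc'
    (ThreeConics.isGeneralParam_div (pow_ne_zero 2 hβ) hD) (ThreeConics.hasCoords_P₁ s hk)
    (ThreeConics.hasCoords_P₂ s k)
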